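/- Let $\mathbb K$ be a field of characteristic $0$ and $V$ a finite-dimensional $\mathbb K$-vector space (placed in degree $0$). **The prop side.** For $m\ge 1$ let $Y(m)$ be the vector space with basis the ordered partitions $(I_1,\dots,I_k)$ of $[m]=\{1,\dots,m\}$ into $k\geq 1$ nonempty blocks, such a partition having degree $-k$, with the natural action of $\mathbb S_m$ and the differential $$\delta(I_1,\dots,I_k)=\sum_{i=1}^{k-1}(-1)^{i+1}(I_1,\dots,I_i\sqcup I_{i+1},\dots,I_k).$$ For $m,n\ge1$ let $Q(m,n)=Y(m)\otimes Y(n)^*[-2]$, where the right $\mathbb S_n$-module $Y(n)^*$ is $Y(n)$ with the action of $\mathbb S_n$ turned into a right action. It has a basis of generators given by pairs consisting of an ordered partition $(I_1,\dots,I_k)$ of the $m$ outputs and an ordered partition $(J_1,\dots,J_l)$ of the $n$ inputs, of degree $2-k-l$, and the differential $d(y\otimes z)=\delta y\otimes z+(-1)^{k}y\otimes\delta z$ for $y=(I_1,\dots,I_k)$. Let $\mathcal Q$ be the free dg prop generated by the dg $\mathbb S$-bimodule $Q$. A representation of $\mathcal Q$ in $V$ is given by its values on the generators, so that the complex of representations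 is $$\mathrm{Rep}(\mathcal Q)=\bigoplus_{m,n\ge1}\mathrm{Hom}_{\mathbb S_m\times\mathbb S_n}\bigl(Q(m,n),\mathrm{Hom}(V^{\otimes n},V^{\otimes m})\bigr),\qquad d\rho:=\rho\circ d,$$ where $\rho$ has degree $r$ if it vanishes on all generators of degree different from $-r$. **The Gerstenhaber–Schack side.** Let $\mathcal O_V=\odot^\bullet V^*$ be the bialgebra of polynomial functions on $V$ (the elements of $V^*$ are primitive) with comultiplication $\Delta$, $\Delta f=\sum f'\otimes f''$, and let $\bar{\mathcal O}_V=\odot^{\bullet\ge1}V^*$ be its augmentation ideal. Let $C^{\bullet,\bullet}(\bar{\mathcal O}_V)=\bigoplus_{m,n\ge1}\mathrm{Hom}(\bar{\mathcal O}_V^{\otimes m},\bar{\mathcal O}_V^{\otimes n})$, the summand $(m,n)$ being in degree $m+n-2$, where a cochain is regarded as a map $\mathcal O_V^{\otimes m}\to\mathcal O_V^{\otimes n}$ which vanishes as soon as one argument is a constant. The Gerstenhaber–Schack differential of $\Phi\in\mathrm{Hom}(\bar{\mathcal O}_V^{\otimes m},\bar{\mathcal O}_V^{\otimes n})$ is $d_{GS}\Phi=d^1_{GS}\Phi+(-1)^m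 d^2_{GS}\Phi$, with $$(d^1_{GS}\Phi)(f_0,\dots,f_m)=-\Delta^{n-1}(f_0)\cdot\Phi(f_1,\dots,f_m)+\sum_{i=0}^{m-1}(-1)^i\Phi(f_0,\dots,f_if_{i+1},\dots,f_m)+(-1)^m\Phi(f_0,\dots,f_{m-1})\cdot\Delta^{n-1}(f_m),$$ $$(d^2_{GS}\Phi)(f_1,\dots,f_m)=-\sum f_1'\cdots f_m'\otimes\Phi(f_1'',\dots,f_m'')-\sum_{i=1}^n(-1)^i\Delta_i\Phi(f_1,\dots,f_m)+(-1)^n\sum\Phi(f_1',\dots,f_m')\otimes f_1''\cdots f_m'',$$ where $\Delta_i$ is $\Delta$ applied to the $i$-th tensor factor and $\Delta^{n-1}:\mathcal O_V\to\mathcal O_V^{\otimes n}$ is the iterated comultiplication ($\Delta^0=\mathrm{Id}$); values are taken in $\bar{\mathcal O}_V^{\otimes\bullet}$ by means of the projection $\mathcal O_V\to\bar{\mathcal O}_V$ along the constants. Let $C^{\bullet,\bullet}_{\mathit{diff}}(\bar{\mathcal O}_V)\subset C^{\bullet,\bullet}(\bar{\mathcal O}_V)$ be the span of the polydifferential operators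 $$f_1\otimes\dots\otimes f_m\longmapsto (x^{J_1}\otimes\dots\otimes x^{J_n})\cdot\Delta^{n-1}\Bigl(\frac{\partial^{|I_1|}f_1}{\partial x^{I_1}}\Bigr)\cdots\Delta^{n-1}\Bigl(\frac{\partial^{|I_m|}f_m}{\partial x^{I_m}}\Bigr),\qquad m,n\ge1,$$ for all families of nonempty multi-indices $I_1,\dots,I_m$, $J_1,\dots,J_n$. **Claim.** $(\mathrm{Rep}(\mathcal Q),d)$ is a complex, and $C^{\bullet,\bullet}_{\mathit{diff}}(\bar{\mathcal O}_V)$ is stable under $d_{GS}$, with $d_{GS}^2=0$ on it (on $C^{\bullet,\bullet}_{\mathit{diff}}(\bar{\mathcal O}_V)$ the formulas for $d_{GS}$ define operators which vanish on constants and have values in $\bar{\mathcal O}_V^{\otimes\bullet}$, so that the projection changes nothing). Moreover: (i) The complexes $(\mathrm{Rep}(\mathcal Q),d)$ and $(C^{\bullet,\bullet}_{\mathit{diff}}(\bar{\mathcal O}_V),d_{GS})$ are canonically isomorphic. Explicitly, in a basis $(e_\alpha)$ of $V$ with dual basis $(x^\alpha)$, the map $$i(\rho)=\sum\frac{\Gamma^{I_1,\dots,I_k}_{J_1,\dots,J_l}}{|I_1|!\cdots|I_k|!\,|J_1|!\cdots|J_l|!}\;(x^{J_1}\otimes\dots\otimes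 x^{J_l})\cdot\Delta^{l-1}\Bigl(\frac{\partial^{|I_1|}}{\partial x^{I_1}}\Bigr)\cdots\Delta^{l-1}\Bigl(\frac{\partial^{|I_k|}}{\partial x^{I_k}}\Bigr)$$ does not depend on the basis and is an isomorphism of graded vector spaces from $\mathrm{Rep}(\mathcal Q)$ onto $C^{\bullet,\bullet}_{\mathit{diff}}(\bar{\mathcal O}_V)$ with $i\circ d=d_{GS}\circ i$. Here the sum is over $k,l\ge1$ and all families of nonempty words $I_1,\dots,I_k$, $J_1,\dots,J_l$ in the coordinate indices, and $\Gamma^{I_1,\dots,I_k}_{J_1,\dots,J_l}$ is the coefficient at $x^{J_1}\otimes\dots\otimes x^{J_l}\otimes e_{I_1}\otimes\dots\otimes e_{I_k}$ of the value of $\rho$ on the generator whose blocks of outputs and of inputs are consecutive, of sizes $|I_1|,\dots,|I_k|$ and $|J_1|,\dots,|J_l|$. (ii) The cohomology of $(C^{\bullet,\bullet}_{\mathit{diff}}(\bar{\mathcal O}_V),d_{GS})$ is $\wedge^{\bullet\ge1}V\otimes\wedge^{\bullet\ge1}V^*$: for every $r\ge0$, $$H^r\bigl(C^{\bullet,\bullet}_{\mathit{diff}}(\bar{\mathcal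 O}_V)\bigr)\cong\bigoplus_{m,n\ge1,\;m+n=r+2}\wedge^mV\otimes\wedge^nV^*.$$ -/

import Mathlib

open scoped TensorProduct DirectSum

noncomputable section

namespace PolyGS

/-! ## The complexes `Y(m)` of ordered partitions (shifted permutahedra cochains) -/

section Permutahedra

/-- An ordered partition `[m] = I_1 ⊔ … ⊔ I_k` into `k` nonempty blocks, encoded by the surjection
sending a leg to the index of its block. -/
def OrdPart (m k : ℕ) : Type := {π : Fin m → Fin k // Function.Surjective π}

instance (m k : ℕ) : Fintype (OrdPart m k) := by
  classical
  unfold OrdPart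
  infer_instance

/-- An ordered partition of `[m]` into any number of nonempty blocks: the generating corollas
with `m` labelled legs, symmetric inside each bunch. -/
abbrev Corolla (m : ℕ) : Type := Σ k : ℕ, OrdPart m k

/-- The left action of `𝕊_m` by relabelling the legs: `σ · (I_1, …, I_k) = (σ(I_1), …, σ(I_k))`. -/
def relabel {m : ℕ} (σ : Equiv.Perm (Fin m)) (P : Corolla m) : Corolla m :=
  ⟨P.1, ⟨P.2.1 ∘ σ.symm, P.2.2.comp σ.symm.surjective⟩⟩

/-- Merge the consecutive blocks number `i` and `i + 1`. -/
def mergeBlocks {m k : ℕ} (i : Fin k) (π : OrdPart m (k + 1)) : OrdPart m k :=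
  ⟨i.predAbove ∘ π.1, (Fin.predAbove_surjective i).comp π.2⟩

variable (K : Type*) [Field K]

/-- `Y(m)`: the vector space spanned by the ordered partitions of `[m]`, a partition with `k`
blocks having degree `-k`. -/
abbrev Y (m : ℕ) : Type _ := Corolla m →₀ K

variable {m : ℕ}

/-- The action of `𝕊_m` on `Y(m)`. -/
def permY (σ : Equiv.Perm (Fin m)) : Y K m →ₗ[K] Y K m := Finsupp.lmapDomain K K (relabel σ)

/-- The differential of `Y(m)` on the basis: the alternating sum of the mergings of two
consecutive blocks, `∑_{i=1}^{k-1} (-1)^{i+1} (I_1, …, I_i ⊔ I_{i+1}, …, I_k)`. -/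
def deltaCorolla : Corolla m → Y K m
  | ⟨0, _⟩ => 0
  | ⟨k + 1, π⟩ => ∑ i : Fin k, (-1 : K) ^ (i : ℕ) • Finsupp.single ⟨k, mergeBlocks i π⟩ 1

/-- The differential `δ` of `Y(m)`. -/
def delta : Y K m →ₗ[K] Y K m := Finsupp.linearCombination K (deltaCorolla K)

/-- The operator `y ↦ (-1)^{|y|} y` of `Y(m)`. -/
def parity : Y K m →ₗ[K] Y K m :=
  Finsupp.linearCombination K fun P => (-1 : K) ^ P.1 • Finsupp.single P 1

theorem relabel_mergeBlocks (σ : Equiv.Perm (Fin m)) {k : ℕ} (i : Fin k) (π : OrdPart m (k + 1)) :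
    relabel σ ⟨k, mergeBlocks i π⟩ = ⟨k, mergeBlocks i (relabel σ ⟨k + 1, π⟩).2⟩ := rfl

theorem delta_permY (σ : Equiv.Perm (Fin m)) : delta K ∘ₗ permY K σ = permY K σ ∘ₗ delta K := by
  refine Finsupp.lhom_ext fun P c => ?_
  obtain ⟨k, π⟩ := P
  cases k with
  | zero => simp [delta, permY, deltaCorolla, relabel, Finsupp.mapDomain_single]
  | succ k =>
    simp only [delta, permY, LinearMap.comp_apply, Finsupp.lmapDomain_apply,
      Finsupp.mapDomain_single, Finsupp.linearCombination_single, Finsupp.mapDomain_smul]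
    congr 1
    simp only [deltaCorolla, relabel, Finsupp.mapDomain_finsetSum, Finsupp.mapDomain_smul,
      Finsupp.mapDomain_single]
    rfl

theorem parity_permY (σ : Equiv.Perm (Fin m)) :
    parity K ∘ₗ permY K σ = permY K σ ∘ₗ parity K := by
  refine Finsupp.lhom_ext fun P c => ?_
  simp only [parity, permY, LinearMap.comp_apply, Finsupp.lmapDomain_apply,
    Finsupp.mapDomain_single, Finsupp.linearCombination_single, Finsupp.mapDomain_smul]
  rfl

end Permutahedra

/-! ## The generating dg `𝕊`-bimodule `Q` and its representations -/

section Rep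

variable (K : Type*) [Field K]

/-- `Q(m,n)`, with `m` output legs and `n` input legs; the generator with output bunches
`I_1, …, I_k` and input bunches `J_1, …, J_l` has degree `2 - k - l`. -/
abbrev Q (m n : ℕ) : Type _ := Y K m ⊗[K] Y K n

/-- The action `q ↦ σ · q · τ` of `𝕊_m` (on the left, on the outputs) and of `𝕊_n` (on the right,
on the inputs). -/
def permQ {m n : ℕ} (σ : Equiv.Perm (Fin m)) (τ : Equiv.Perm (Fin n)) : Q K m n →ₗ[K] Q K m n :=
  TensorProduct.map (permY K σ) (permY K τ⁻¹)

/-- The differential `d = δ ⊗ Id + Id ⊗ δ` of `Q(m,n)`, with the Koszul sign: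
`d (y ⊗ z) = δ y ⊗ z + (-1)^{|y|} y ⊗ δ z`. -/
def dQ {m n : ℕ} : Q K m n →ₗ[K] Q K m n :=
  TensorProduct.map (delta K) LinearMap.id + TensorProduct.map (parity K) (delta K)

theorem dQ_permQ {m n : ℕ} (σ : Equiv.Perm (Fin m)) (τ : Equiv.Perm (Fin n)) :
    dQ K ∘ₗ permQ K σ τ = permQ K σ τ ∘ₗ dQ K := by
  simp only [dQ, permQ, LinearMap.add_comp, LinearMap.comp_add, ← TensorProduct.map_comp,
    delta_permY, parity_permY, LinearMap.id_comp, LinearMap.comp_id]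

variable (V : Type*) [AddCommGroup V] [Module K V]

/-- `End_V(m,n) = Hom(V^{⊗n}, V^{⊗m})`. -/
abbrev EndV (m n : ℕ) : Type _ := (⨂[K] _ : Fin n, V) →ₗ[K] (⨂[K] _ : Fin m, V)

/-- The action of `𝕊_n` on `V^{⊗n}` by permuting the tensor factors. -/
def permV {n : ℕ} (σ : Equiv.Perm (Fin n)) : (⨂[K] _ : Fin n, V) →ₗ[K] (⨂[K] _ : Fin n, V) :=
  (PiTensorProduct.reindex K (fun _ : Fin n => V) σ).toLinearMap

/-- The maps of `𝕊`-bimodules `Q → End_V` (of any degree) in arity `(m,n)`. -/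
def HomS (m n : ℕ) : Submodule K (Q K m n →ₗ[K] EndV K V m n) where
  carrier := {ρ | ∀ σ τ q, ρ (permQ K σ τ q) = permV K V σ ∘ₗ ρ q ∘ₗ permV K V τ}
  add_mem' {ρ ρ'} h h' σ τ q := by
    simp [h σ τ q, h' σ τ q, LinearMap.comp_add, LinearMap.add_comp]
  zero_mem' σ τ q := by simp
  smul_mem' c ρ h σ τ q := by simp [h σ τ q, LinearMap.comp_smul, LinearMap.smul_comp]

/-- The space of maps of `𝕊`-bimodules `Q → End_V` in arity `(m,n)`, as a type. -/
def RepHom (m n : ℕ) : Type _ := ↥(HomS K V m n)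

instance (m n : ℕ) : AddCommGroup (RepHom K V m n) :=
  Module.addCommMonoidToAddCommGroup K (M := ↥(HomS K V m n))

instance (m n : ℕ) : Module K (RepHom K V m n) := inferInstanceAs (Module K ↥(HomS K V m n))

/-- The underlying linear map `Q(m,n) → End_V(m,n)`. -/
def toHom (m n : ℕ) : RepHom K V m n →ₗ[K] (Q K m n →ₗ[K] EndV K V m n) :=
  (HomS K V m n).subtype

/-- The space `Rep(𝒬) = ⊕_{m,n ≥ 1} Hom_{𝕊_m × 𝕊_n}(Q(m,n), End_V(m,n))` of representations in `V`
of the free prop `𝒬` generated by `Q`, a representation being given by its values on the generators.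
The summand with index `p` is the one of arity `(m,n) = (p.1 + 1, p.2 + 1)`. -/
abbrev Rep : Type _ := ⨁ p : ℕ × ℕ, RepHom K V (p.1 + 1) (p.2 + 1)

/-- `ρ ↦ ρ ∘ d` in arity `(m,n)`. -/
def dRepHom (m n : ℕ) : RepHom K V m n →ₗ[K] RepHom K V m n :=
  show HomS K V m n →ₗ[K] HomS K V m n from
  { toFun := fun ρ => ⟨ρ.1 ∘ₗ dQ K, fun σ τ q => by
      have h := LinearMap.congr_fun (dQ_permQ K σ τ) q
      simp only [LinearMap.comp_apply] at h ⊢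
      rw [h, ρ.2 σ τ]⟩
    map_add' := fun _ _ => Subtype.ext (LinearMap.add_comp _ _ _)
    map_smul' := fun _ _ => Subtype.ext (LinearMap.smul_comp _ _ _) }

/-- The differential `d ρ = ρ ∘ d` of `Rep(𝒬)`. -/
def dRep : Rep K V →ₗ[K] Rep K V := DirectSum.lmap fun p => dRepHom K V (p.1 + 1) (p.2 + 1)

/-- The representations of degree `r`: those which vanish on all generators whose degree
`2 - k - l` is not `-r`. -/
def RepDeg (r : ℕ) : Submodule K (Rep K V) where
  carrier := {ρ | ∀ (p : ℕ × ℕ) (P : Corolla (p.1 + 1)) (R : Corolla (p.2 + 1)),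
    P.1 + R.1 ≠ r + 2 →
      toHom K V _ _ (ρ p) (Finsupp.single P 1 ⊗ₜ Finsupp.single R 1) = 0}
  add_mem' {ρ ρ'} h h' p P R hr := by simp [h p P R hr, h' p P R hr]
  zero_mem' p P R hr := by simp
  smul_mem' c ρ h p P R hr := by simp [DirectSum.smul_apply, h p P R hr]

end Rep

/-! ## The Gerstenhaber–Schack complex of a commutative bialgebra -/

section GS

variable (K : Type*) [Field K] (A : Type*) [CommRing A] [Bialgebra K A]

/-- `A^{⊗n}`, a commutative algebra for the factorwise multiplication. -/
abbrev TPow (n : ℕ) : Type _ := ⨂[K] _ : Fin n, A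

variable {K A} in
/-- `f_1 ⊗ … ⊗ f_n ↦ g_1(f_1) ⋯ g_n(f_n)` for linear maps `g_i` into a commutative algebra. -/
def glue {n : ℕ} {B : Type*} [CommRing B] [Algebra K B] (g : Fin n → A →ₗ[K] B) :
    TPow K A n →ₗ[K] B :=
  PiTensorProduct.lift ((MultilinearMap.mkPiAlgebra K (Fin n) B).compLinearMap g)

/-- `f ↦ 1 ⊗ … ⊗ f ⊗ … ⊗ 1`, with `f` in position `i`. -/
def at' {n : ℕ} (i : Fin n) : A →ₗ[K] TPow K A n :=
  (PiTensorProduct.singleAlgHom (R := K) (A := fun _ : Fin n => A) i).toLinearMap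

/-- `f_0 ⊗ … ⊗ f_n ↦ f_0 ⊗ … ⊗ f_i f_{i+1} ⊗ … ⊗ f_n`. -/
def mulAt {n : ℕ} (i : Fin n) : TPow K A (n + 1) →ₗ[K] TPow K A n :=
  glue fun j => at' K A (i.predAbove j)

/-- `Δ_i`: the comultiplication applied to the tensor factor number `i`. -/
def comulAt {n : ℕ} (i : Fin n) : TPow K A n →ₗ[K] TPow K A (n + 1) :=
  glue fun j =>
    if j < i then at' K A j.castSucc
    else if i < j then at' K A j.succ
    else LinearMap.mul' K _ ∘ₗ TensorProduct.map (at' K A j.castSucc) (at' K A j.succ) ∘ₗ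
      Coalgebra.comul

/-- The iterated comultiplication `Δ^n = (Δ ⊗ Id) ∘ … ∘ Δ : A → A^{⊗(n+1)}`, with `Δ^0 = Id`. -/
def iterComul : (n : ℕ) → A →ₗ[K] TPow K A (n + 1)
  | 0 => at' K A 0
  | n + 1 => comulAt K A 0 ∘ₗ iterComul n

/-- `f_0 ⊗ … ⊗ f_n ↦ f_0 ⊗ (f_1 ⊗ … ⊗ f_n)`. -/
def headTail (n : ℕ) : TPow K A (n + 1) →ₗ[K] A ⊗[K] TPow K A n :=
  glue (Fin.cons (Algebra.TensorProduct.includeLeft (R := K) (S := K)).toLinearMap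
    fun j : Fin n => (Algebra.TensorProduct.includeRight (R := K)).toLinearMap ∘ₗ at' K A j)

/-- `f_0 ⊗ … ⊗ f_n ↦ (f_0 ⊗ … ⊗ f_{n-1}) ⊗ f_n`. -/
def initLast (n : ℕ) : TPow K A (n + 1) →ₗ[K] TPow K A n ⊗[K] A :=
  glue (Fin.snoc (α := fun _ => A →ₗ[K] TPow K A n ⊗[K] A)
    (fun j : Fin n =>
      (Algebra.TensorProduct.includeLeft (R := K) (S := K)).toLinearMap ∘ₗ at' K A j)
    (Algebra.TensorProduct.includeRight (R := K)).toLinearMap)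

/-- `f ⊗ (f_1 ⊗ … ⊗ f_n) ↦ f ⊗ f_1 ⊗ … ⊗ f_n`. -/
def consMap (n : ℕ) : A ⊗[K] TPow K A n →ₗ[K] TPow K A (n + 1) :=
  LinearMap.mul' K _ ∘ₗ TensorProduct.map (at' K A 0) (glue fun j : Fin n => at' K A j.succ)

/-- `(f_1 ⊗ … ⊗ f_n) ⊗ f ↦ f_1 ⊗ … ⊗ f_n ⊗ f`. -/
def snocMap (n : ℕ) : TPow K A n ⊗[K] A →ₗ[K] TPow K A (n + 1) :=
  LinearMap.mul' K _ ∘ₗ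
    TensorProduct.map (glue fun j : Fin n => at' K A j.castSucc) (at' K A (Fin.last n))

/-- `f_1 ⊗ … ⊗ f_n ↦ ∑ f_1' ⋯ f_n' ⊗ (f_1'' ⊗ … ⊗ f_n'')` where `Δ f = ∑ f' ⊗ f''`. -/
def coactLeft (n : ℕ) : TPow K A n →ₗ[K] A ⊗[K] TPow K A n :=
  glue fun i => TensorProduct.map LinearMap.id (at' K A i) ∘ₗ Coalgebra.comul

/-- `f_1 ⊗ … ⊗ f_n ↦ ∑ (f_1' ⊗ … ⊗ f_n') ⊗ f_1'' ⋯ f_n''` where `Δ f = ∑ f' ⊗ f''`. -/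
def coactRight (n : ℕ) : TPow K A n →ₗ[K] TPow K A n ⊗[K] A :=
  glue fun i => TensorProduct.map (at' K A i) LinearMap.id ∘ₗ Coalgebra.comul

/-- The first Gerstenhaber–Schack differential, for `Φ : A^{⊗m} → A^{⊗(n+1)}`:
`(f_0, …, f_m) ↦ - Δ^n(f_0) · Φ(f_1, …, f_m) + ∑_{i=0}^{m-1} (-1)^i Φ(f_0, …, f_i f_{i+1}, …, f_m)
+ (-1)^m Φ(f_0, …, f_{m-1}) · Δ^n(f_m)`. -/
def d1 (m n : ℕ) : (TPow K A m →ₗ[K] TPow K A (n + 1)) →ₗ[K]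
    (TPow K A (m + 1) →ₗ[K] TPow K A (n + 1)) where
  toFun Φ :=
    -(LinearMap.mul' K _ ∘ₗ TensorProduct.map (iterComul K A n) Φ ∘ₗ headTail K A m)
    + ∑ i : Fin m, (-1 : K) ^ (i : ℕ) • (Φ ∘ₗ mulAt K A i)
    + (-1 : K) ^ m •
      (LinearMap.mul' K _ ∘ₗ TensorProduct.map Φ (iterComul K A n) ∘ₗ initLast K A m)
  map_add' Φ Ψ := by
    simp only [TensorProduct.map_add_left, TensorProduct.map_add_right, LinearMap.add_comp,
      LinearMap.comp_add, smul_add, Finset.sum_add_distrib]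
    abel
  map_smul' c Φ := by
    simp only [TensorProduct.map_smul_left, TensorProduct.map_smul_right, LinearMap.smul_comp,
      LinearMap.comp_smul, smul_add, Finset.smul_sum, RingHom.id_apply, smul_neg]
    simp only [smul_comm c]

/-- The second Gerstenhaber–Schack differential, for `Φ : A^{⊗m} → A^{⊗n}`:
`(f_1, …, f_m) ↦ - ∑ f_1' ⋯ f_m' ⊗ Φ(f_1'', …, f_m'') - ∑_{i=1}^n (-1)^i Δ_i Φ(f_1, …, f_m)
+ (-1)^n ∑ Φ(f_1', …, f_m') ⊗ f_1'' ⋯ f_m''`. -/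
def d2 (m n : ℕ) : (TPow K A m →ₗ[K] TPow K A n) →ₗ[K]
    (TPow K A m →ₗ[K] TPow K A (n + 1)) where
  toFun Φ :=
    -(consMap K A n ∘ₗ TensorProduct.map LinearMap.id Φ ∘ₗ coactLeft K A m)
    + ∑ i : Fin n, (-1 : K) ^ (i : ℕ) • (comulAt K A i ∘ₗ Φ)
    + (-1 : K) ^ n • (snocMap K A n ∘ₗ TensorProduct.map Φ LinearMap.id ∘ₗ coactRight K A m)
  map_add' Φ Ψ := by
    simp only [TensorProduct.map_add_left, TensorProduct.map_add_right, LinearMap.add_comp,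
      LinearMap.comp_add, smul_add, Finset.sum_add_distrib]
    abel
  map_smul' c Φ := by
    simp only [TensorProduct.map_smul_left, TensorProduct.map_smul_right, LinearMap.smul_comp,
      LinearMap.comp_smul, smul_add, Finset.smul_sum, RingHom.id_apply, smul_neg]
    simp only [smul_comm c]

/-- The Gerstenhaber–Schack cochains of `A` itself: the summand with index `p` is
`Hom(A^{⊗m}, A^{⊗n})` with `(m,n) = (p.1 + 1, p.2 + 1)`. -/
abbrev CFull : Type _ := ⨁ p : ℕ × ℕ, TPow K A (p.1 + 1) →ₗ[K] TPow K A (p.2 + 1)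

/-- The total Gerstenhaber–Schack differential `d¹ + (-1)^m d²` on `Hom(A^{⊗m}, A^{⊗n})`. -/
def dFull : CFull K A →ₗ[K] CFull K A :=
  DirectSum.toModule K _ _ fun p =>
    DirectSum.lof K (ℕ × ℕ) (fun p => TPow K A (p.1 + 1) →ₗ[K] TPow K A (p.2 + 1))
        (p.1 + 1, p.2) ∘ₗ d1 K A (p.1 + 1) p.2
    + (-1 : K) ^ (p.1 + 1) •
      (DirectSum.lof K (ℕ × ℕ) (fun p => TPow K A (p.1 + 1) →ₗ[K] TPow K A (p.2 + 1))
        (p.1, p.2 + 1) ∘ₗ d2 K A (p.1 + 1) (p.2 + 1))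

/-- The augmentation ideal `Ā`, the kernel of the counit `ε`. -/
def Aug : Type _ := ↥(LinearMap.ker (Coalgebra.counit (R := K) (A := A)))

instance : AddCommGroup (Aug K A) :=
  inferInstanceAs (AddCommGroup ↥(LinearMap.ker (Coalgebra.counit (R := K) (A := A))))

instance : Module K (Aug K A) :=
  inferInstanceAs (Module K ↥(LinearMap.ker (Coalgebra.counit (R := K) (A := A))))

/-- The inclusion `Ā → A`. -/
def inclAug : Aug K A →ₗ[K] A :=
  (LinearMap.ker (Coalgebra.counit (R := K) (A := A))).subtype

/-- `Ā^{⊗n}`. -/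
abbrev TPowAug (n : ℕ) : Type _ := ⨂[K] _ : Fin n, Aug K A

/-- The projection `f ↦ f - ε(f) 1` of `A = K ⊕ Ā` onto `Ā`. -/
def projAug : A →ₗ[K] Aug K A :=
  LinearMap.codRestrict (LinearMap.ker (Coalgebra.counit (R := K) (A := A)))
    (LinearMap.id - Algebra.linearMap K A ∘ₗ Coalgebra.counit) fun f => by
      simp [LinearMap.mem_ker]

/-- The inclusion `Ā^{⊗n} → A^{⊗n}`. -/
def inclPow (n : ℕ) : TPowAug K A n →ₗ[K] TPow K A n :=
  PiTensorProduct.map fun _ => inclAug K A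

/-- The projection `A^{⊗n} → Ā^{⊗n}`. -/
def projPow (n : ℕ) : TPow K A n →ₗ[K] TPowAug K A n :=
  PiTensorProduct.map fun _ => projAug K A

/-- `Hom(Ā^{⊗m}, Ā^{⊗n})`. -/
def Cochain (m n : ℕ) : Type _ := TPowAug K A m →ₗ[K] TPowAug K A n

instance (m n : ℕ) : AddCommGroup (Cochain K A m n) :=
  inferInstanceAs (AddCommGroup (TPowAug K A m →ₗ[K] TPowAug K A n))

instance (m n : ℕ) : Module K (Cochain K A m n) :=
  inferInstanceAs (Module K (TPowAug K A m →ₗ[K] TPowAug K A n))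

/-- The cochains of `Ā`: the direct sum of the spaces `Hom(Ā^{⊗m}, Ā^{⊗n})`, `m, n ≥ 1`,
in degree `m + n - 2`. The summand with index `p` has `(m,n) = (p.1 + 1, p.2 + 1)`. -/
abbrev C : Type _ := ⨁ p : ℕ × ℕ, Cochain K A (p.1 + 1) (p.2 + 1)

/-- A cochain of `Ā` regarded as a cochain of `A`: extension by zero when one of the arguments is
a constant. -/
def extHom (m n : ℕ) : Cochain K A m n →ₗ[K] (TPow K A m →ₗ[K] TPow K A n) where
  toFun Φ := inclPow K A n ∘ₗ (show TPowAug K A m →ₗ[K] TPowAug K A n from Φ) ∘ₗ projPow K A m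
  map_add' _ _ := LinearMap.ext fun _ => map_add (inclPow K A n) _ _
  map_smul' c _ := LinearMap.ext fun _ => map_smul (inclPow K A n) c _

/-- Restriction of a cochain from `A` to `Ā`. -/
def resHom (m n : ℕ) : (TPow K A m →ₗ[K] TPow K A n) →ₗ[K] Cochain K A m n where
  toFun Φ := projPow K A n ∘ₗ Φ ∘ₗ inclPow K A m
  map_add' _ _ := LinearMap.ext fun _ => map_add (projPow K A n) _ _
  map_smul' c _ := LinearMap.ext fun _ => map_smul (projPow K A n) c _

/-- Extension of cochains from `Ā` to `A`. -/
def ext : C K A →ₗ[K] CFull K A := DirectSum.lmap fun p => extHom K A (p.1 + 1) (p.2 + 1)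

/-- Restriction of cochains from `A` to `Ā`. -/
def res : CFull K A →ₗ[K] C K A := DirectSum.lmap fun p => resHom K A (p.1 + 1) (p.2 + 1)

/-- The Gerstenhaber–Schack differential on the cochains of `Ā`. -/
def dGS : C K A →ₗ[K] C K A := res K A ∘ₗ dFull K A ∘ₗ ext K A

/-- The cochains of total degree `r = m + n - 2`. -/
def CDeg (r : ℕ) : Submodule K (C K A) where
  carrier := {x | ∀ p : ℕ × ℕ, p.1 + p.2 ≠ r → x p = 0}
  add_mem' {x y} hx hy p hp := by simp [hx p hp, hy p hp]
  zero_mem' p hp := by simp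
  smul_mem' c x hx p hp := by simp [DirectSum.smul_apply, hx p hp]

end GS

/-! ## Polydifferential operators -/

section Diff

variable (K : Type*) [Field K] (V : Type*) [AddCommGroup V] [Module K V]

/-- The bialgebra `𝒪_V = ⊙^• V^*` of polynomial functions, with primitive generators. -/
abbrev O : Type _ := SymmetricAlgebra K (Module.Dual K V)

variable {V}

/-- Taylor expansion `f(x) ↦ f(x + t v)`. -/
def taylor (v : V) : O K V →ₐ[K] Polynomial (O K V) :=
  SymmetricAlgebra.lift
    ((Polynomial.CAlgHom (R := K) (A := O K V)).toLinearMap ∘ₗ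
        SymmetricAlgebra.ι K (Module.Dual K V)
      + (Module.Dual.eval K V v).smulRight (Polynomial.X : Polynomial (O K V)))

theorem taylor_coeff_zero (v : V) (f : O K V) : (taylor K v f).coeff 0 = f := by
  induction f using SymmetricAlgebra.induction with
  | algebraMap r => simp [Polynomial.algebraMap_apply]
  | ι x => simp [taylor]
  | mul a b ha hb => simp [Polynomial.mul_coeff_zero, ha, hb]
  | add a b ha hb => simp [ha, hb]

/-- The derivation `∂_v` of `𝒪_V` along `v ∈ V`, the coefficient of `t` in `f(x + t v)`. -/
def partialD (v : V) : Derivation K (O K V) (O K V) :=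
  Derivation.mk' ((Polynomial.lcoeff (O K V) 1).restrictScalars K ∘ₗ (taylor K v).toLinearMap)
    fun a b => by
      simp [Polynomial.mul_coeff_one, taylor_coeff_zero, mul_comm]

theorem partialD_ι (v : V) (ξ : Module.Dual K V) :
    partialD K v (SymmetricAlgebra.ι K _ ξ) = algebraMap K (O K V) (ξ v) := by
  simp [partialD, taylor, Algebra.algebraMap_eq_smul_one]

/-- `∂^{|I|} / ∂x^I` for a multi-index `I`, given as a list of vectors. -/
def diffOp (I : List V) : O K V →ₗ[K] O K V :=
  (I.map fun v => ((partialD K v : O K V →ₗ[K] O K V) : Module.End K (O K V))).prod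

/-- The monomial `x^J` for a multi-index `J`, given as a list of linear functions. -/
def monom (J : List (Module.Dual K V)) : O K V := (J.map (SymmetricAlgebra.ι K _)).prod

/-- `(f_1, …, f_m) ↦ (x^{J_0} ⊗ … ⊗ x^{J_n}) · Δ^n(∂^{I_1} f_1) ⋯ Δ^n(∂^{I_m} f_m)`
on all of `𝒪_V`. -/
def polyOpFull {m n : ℕ} (I : Fin m → List V) (J : Fin (n + 1) → List (Module.Dual K V)) :
    TPow K (O K V) m →ₗ[K] TPow K (O K V) (n + 1) :=
  LinearMap.mulLeft K (PiTensorProduct.tprod K fun j => monom K (J j)) ∘ₗ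
    glue fun i => iterComul K (O K V) n ∘ₗ diffOp K (I i)

/-- The same operator on `Ō_V`. When the `J_j` are nonempty its values lie in `Ō_V^{⊗(n+1)}`, and
the projection onto this subspace changes nothing. -/
def polyOp {m n : ℕ} (I : Fin m → List V) (J : Fin (n + 1) → List (Module.Dual K V)) :
    Cochain K (O K V) m (n + 1) :=
  resHom K (O K V) m (n + 1) (polyOpFull K I J)

/-- The inclusion of `Hom(Ō_V^{⊗(a+1)}, Ō_V^{⊗(b+1)})` into the space of all cochains. -/
abbrev inC (a b : ℕ) : Cochain K (O K V) (a + 1) (b + 1) →ₗ[K] C K (O K V) :=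
  DirectSum.lof K (ℕ × ℕ) (fun p => Cochain K (O K V) (p.1 + 1) (p.2 + 1)) (a, b)

variable (V) in
/-- The span of the polydifferential operators, for all families of nonempty multi-indices. (By
multilinearity it is enough to take vectors of a fixed basis and linear functions of the dual
basis.) -/
def Cdiff : Submodule K (C K (O K V)) :=
  Submodule.span K {x | ∃ (a b : ℕ) (I : Fin (a + 1) → List V)
    (J : Fin (b + 1) → List (Module.Dual K V)),
    (∀ i, I i ≠ []) ∧ (∀ j, J j ≠ []) ∧ x = inC K a b (polyOp K I J)}

variable (V) in
/-- The cohomology in degree `r` of the complex of polydifferential operators: cocycles of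
degree `r` modulo coboundaries. -/
abbrev Hdiff (r : ℕ) : Type _ :=
  ↥(Cdiff K V ⊓ CDeg K (O K V) r ⊓ LinearMap.ker (dGS K (O K V))) ⧸
    Submodule.comap (Cdiff K V ⊓ CDeg K (O K V) r ⊓ LinearMap.ker (dGS K (O K V))).subtype
      (Submodule.map (dGS K (O K V)) (Cdiff K V))

end Diff

/-! ## The explicit comparison map -/

section Comparison

variable (K : Type*) [Field K] {V : Type*} [AddCommGroup V] [Module K V]

/-- The legs in the block number `i`, in increasing order. -/
def block {m k : ℕ} (π : OrdPart m k) (i : Fin k) : List (Fin m) :=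
  (List.finRange m).filter fun t => π.1 t = i

/-- `|I_1|! ⋯ |I_k|!`. -/
def blockFactorial {m k : ℕ} (π : OrdPart m k) : ℕ := ∏ i, (block π i).length.factorial

/-- The partitions of `[m]` into `k` consecutive blocks. -/
def stdPart (m k : ℕ) : Finset (OrdPart m k) := by
  classical exact Finset.univ.filter fun π => Monotone π.1

variable {ι : Type} [Fintype ι] [DecidableEq ι] (b : Module.Basis ι K V)

/-- The coefficient `Γ^{I_1, …, I_k}_{J_1, …, J_l}` of a representation, where `P = (I_1, …, I_k)` and
`R = (J_1, …, J_l)` are partitions of the outputs and of the inputs of a corolla and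
`I`, `J` label the legs by coordinates: the matrix coefficient at
`(e_{J(1)} ⊗ … ⊗ e_{J(n)}, e_{I(1)} ⊗ … ⊗ e_{I(m)})` of the value of the representation on that
corolla. -/
def coeffΓ {m n : ℕ} (P : Corolla m) (R : Corolla n) (I : Fin m → ι) (J : Fin n → ι) :
    RepHom K V m n →ₗ[K] K :=
  (Basis.piTensorProduct fun _ : Fin m => b).coord I ∘ₗ
    LinearMap.applyₗ (PiTensorProduct.tprod K fun s => b (J s)) ∘ₗ
    LinearMap.applyₗ (Finsupp.single P (1 : K) ⊗ₜ[K] Finsupp.single R (1 : K)) ∘ₗ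
    toHom K V m n

/-- The map `Rep(𝒬) → C(Ō_V)`,
`ρ ↦ ∑ Γ^{I_1, …, I_k}_{J_1, …, J_l} / (|I_1|! ⋯ |I_k|! |J_1|! ⋯ |J_l|!) ·
(x^{J_1} ⊗ … ⊗ x^{J_l}) · Δ^{l-1}(∂^{I_1}) ⋯ Δ^{l-1}(∂^{I_k})`, in the coordinates defined by a basis
`e_α` of `V` and the dual basis `x^α`; the sum is over all families of nonempty multi-indices,
that is, over all arities `(m,n)`, all partitions of `[m]` and `[n]` into consecutive nonempty
blocks, and all labellings of the `m` outputs and the `n` inputs by coordinates. -/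
def iMap : Rep K V →ₗ[K] C K (O K V) :=
  DirectSum.toModule K (ℕ × ℕ) _ fun p =>
    ∑ k ∈ Finset.range (p.1 + 1), ∑ l ∈ Finset.range (p.2 + 1),
    ∑ π ∈ stdPart (p.1 + 1) (k + 1), ∑ κ ∈ stdPart (p.2 + 1) (l + 1),
    ∑ I : Fin (p.1 + 1) → ι, ∑ J : Fin (p.2 + 1) → ι,
      (coeffΓ K b ⟨k + 1, π⟩ ⟨l + 1, κ⟩ I J).smulRight
        (((blockFactorial π : K) * (blockFactorial κ : K))⁻¹ •
          inC K k l (polyOp K (fun i => (block π i).map fun t => b (I t))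
            (fun j => (block κ j).map fun s => b.coord (J s))))

end Comparison

end PolyGS

end

open scoped TensorProduct DirectSum

noncomputable section

set_option linter.unusedSectionVars false

namespace PolyGS

/-! ## The complex of functions on lists -/

section ListComplex

variable {S N : Type*} [AddCommGroup N]

/-! Both complexes are identified with one complex of functions Γ(w, w') of two lists of
multi-indices. Its differential `totD` is the alternating sum over the mergings (additions) of two
neighbouring entries of w, plus (-1)^{|w|} times the same for w'.

The prop side. By equivariance, the matrix coefficient of a representation at a labelled pair of
ordered partitions depends only on the contents of the blocks (`coeffLabelled_factorsThrough`), and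
merging two blocks adds their contents. Thus `symbol` identifies representations with the functions
of bounded degree that vanish off nonempty lists of nonzero multi-indices (`symbol_injective`,
`exists_symbol_eq`), and ρ ↦ ρ ∘ d becomes `totD` (`symbol_dRep`).

The Gerstenhaber–Schack side. A polydifferential operator is a sum over s of γ(s) ∏ Δ^n(∂^{s_j} f_j
/ s_j!), with γ unique (`jetOp_injective`); its symbol Γ(s, t) is the derivative ∂^t of γ(s) at the
origin. With divided derivatives on the arguments and undivided ones on the coefficients, neither
the Leibniz rule nor the substitution x ↦ x' + x'' produces binomial coefficients. Hence d¹ and d²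
become alternating sums of faces (`HasSymbol.d1`, `HasSymbol.d2`), the two outer faces being the
removal of a zero entry. On symbols which vanish as soon as an entry is zero, only the mergings
remain (`faceSum_of_normalized`). The factorials in the comparison map are those for which i(ρ) has
the same symbol as ρ (`represents_iMap`), by a multinomial count (`sum_stdPart`). So i is injective,
onto, and compatible with the differentials. Characteristic 0 is used to divide by factorials and to
separate polynomials by their derivatives (`dualC_ext`).

The cohomology. In one list this is the cobar complex of functions on the monoid of multi-indices.
Modulo coboundaries every cocycle is supported on strictly decreasing words of coordinates
(`exists_of_cobarD_eq_zero`). This is proved by induction on the coordinates, starting from a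
contractible complex with one more multi-index in front (`exists_of_coresD_eq_zero`). Doing this for
each list gives `exists_of_totD_eq_zero`. Antisymmetrization kills coboundaries and reads off the
value at a decreasing word (`antisym_totD`, `antisym_eq`). So the cohomology in degree r has one
dimension for each pair of nonempty sets of coordinates with r + 2 elements in all, which is the
dimension of the sum of the ∧^m V ⊗ ∧^n V^*. -/

/-- The alternating sum over the mergings of two consecutive entries of a list. -/
def listD [Add S] : (List S → N) → List S → N
  | _, [] => 0
  | _, [_] => 0
  | Γ, a :: b :: w => Γ ((a + b) :: w) - listD (fun v => Γ (a :: v)) (b :: w)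

theorem listD_nil [Add S] (Γ : List S → N) : listD Γ [] = 0 := by rw [listD]

theorem listD_singleton [Add S] (Γ : List S → N) (a : S) : listD Γ [a] = 0 := by rw [listD]

theorem listD_cons_cons [Add S] (Γ : List S → N) (a b : S) (w : List S) :
    listD Γ (a :: b :: w) = Γ ((a + b) :: w) - listD (fun v => Γ (a :: v)) (b :: w) := by
  rw [listD]

/-- `listD` evaluates Γ only at lists with a merged entry `a + b`, so a hypothesis on those lists
suffices. Vanishing and support conditions are passed through the differential in this way. -/
theorem listD_map_congr [Add S] {N' : Type*} [AddCommGroup N'] (f : N →+ N') {Γ : List S → N}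
    {Γ' : List S → N'} (w : List S) (h : ∀ p a b q, w = p ++ a :: b :: q →
      f (Γ (p ++ (a + b) :: q)) = Γ' (p ++ (a + b) :: q)) : f (listD Γ w) = listD Γ' w := by
  induction w generalizing Γ Γ' with
  | nil => simp [listD_nil]
  | cons a w ih =>
    cases w with
    | nil => simp [listD_singleton]
    | cons b w =>
      rw [listD_cons_cons, listD_cons_cons, map_sub]
      congr 1
      · exact h [] a b w rfl
      · exact ih fun p a' b' q hw => h (a :: p) a' b' q (by rw [hw]; rfl)

theorem listD_congr [Add S] {Γ Γ' : List S → N} (w : List S) (h : ∀ p a b q, w = p ++ a :: b :: q →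
      Γ (p ++ (a + b) :: q) = Γ' (p ++ (a + b) :: q)) : listD Γ w = listD Γ' w :=
  listD_map_congr (AddMonoidHom.id N) w h

theorem map_listD [Add S] {N' : Type*} [AddCommGroup N'] (f : N →+ N') (Γ : List S → N)
    (w : List S) : f (listD Γ w) = listD (fun v => f (Γ v)) w :=
  listD_map_congr f w fun _ _ _ _ _ => rfl

theorem listD_add [Add S] (Γ Γ' : List S → N) (w : List S) :
    listD (fun v => Γ v + Γ' v) w = listD Γ w + listD Γ' w := by
  induction w generalizing Γ Γ' with
  | nil => simp [listD_nil]
  | cons a w ih =>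
    cases w with
    | nil => simp [listD_singleton]
    | cons b w => simp only [listD_cons_cons, ih]; abel

theorem listD_zero [Add S] (w : List S) : listD (fun _ => (0 : N)) w = 0 := by
  simpa using (map_listD (0 : N →+ N) (fun _ => (0 : N)) w).symm

theorem listD_sub [Add S] (Γ Γ' : List S → N) (w : List S) :
    listD (fun v => Γ v - Γ' v) w = listD Γ w - listD Γ' w := by
  rw [eq_sub_iff_add_eq, ← listD_add]
  simp

theorem listD_eq_zero [Add S] {Γ : List S → N} (w : List S) (h : ∀ p a b q, w = p ++ a :: b :: q →
      Γ (p ++ (a + b) :: q) = 0) : listD Γ w = 0 :=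
  (listD_congr w h).trans (listD_zero w)

theorem listD_smul [Add S] {K : Type*} [Ring K] [Module K N] (c : K) (Γ : List S → N)
    (w : List S) : listD (fun v => c • Γ v) w = c • listD Γ w :=
  (map_listD (DistribSMul.toAddMonoidHom N c) Γ w).symm

theorem listD_ite [Add S] (U : List S → Prop) [DecidablePred U] (Γ : List S → N) (w : List S)
    (hU : ∀ p a b q, U (p ++ (a + b) :: q) ↔ U (p ++ a :: b :: q)) :
    listD (fun v => if U v then Γ v else 0) w = if U w then listD Γ w else 0 := by
  split_ifs with h
  · exact listD_congr w fun p a b q hw => if_pos ((hU p a b q).2 (hw ▸ h))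
  · exact listD_eq_zero w fun p a b q hw => if_neg fun h' => h (hw ▸ (hU p a b q).1 h')

/-- Two disjoint mergings occur in both orders with opposite signs, and two overlapping ones agree
by associativity. The induction peels off the first entry; `Λ` is the part of `listD Γ (a :: v)` in
which `a` is merged. -/
theorem listD_listD [AddSemigroup S] (Γ : List S → N) (w : List S) :
    listD (listD Γ) w = 0 := by
  induction w generalizing Γ with
  | nil => rw [listD_nil]
  | cons a w ih =>
    cases w with
    | nil => rw [listD_singleton]
    | cons b w =>
      cases w with
      | nil => rw [listD_cons_cons, listD_singleton, listD_singleton, sub_zero]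
      | cons c w =>
        let Λ : List S → N
          | [] => 0
          | x :: v => Γ ((a + x) :: v)
        have h : (fun v => listD Γ (a :: v)) = fun v => Λ v - listD (fun v => Γ (a :: v)) v := by
          funext v
          cases v with
          | nil => simp [Λ, listD_singleton, listD_nil]
          | cons x v => exact listD_cons_cons ..
        rw [listD_cons_cons, h, listD_sub, ih, sub_zero, listD_cons_cons, listD_cons_cons]
        simp [Λ, add_assoc]

/-- `listD` as a linear endomorphism. -/
def listDHom [Add S] (K : Type*) [Ring K] [Module K N] : (List S → N) →ₗ[K] (List S → N) where
  toFun := listD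
  map_add' Γ Γ' := funext fun w => listD_add Γ Γ' w
  map_smul' c Γ := funext fun w => listD_smul c Γ w

end ListComplex

/-! ### The cobar complex and the cofree comodule over it. -/

section Cobar

variable {ι : Type*}

/-- The nonzero multi-indices. -/
abbrev NZ (ι : Type*) : Type _ := {s : ι →₀ ℕ // s ≠ 0}

instance : AddSemigroup (NZ ι) where
  add s t := ⟨s.1 + t.1, fun h => s.2 (by simpa using (add_eq_zero.1 h).1)⟩
  add_assoc _ _ _ := Subtype.ext (add_assoc _ _ _)

theorem NZ.coe_add (s t : NZ ι) : (s + t).1 = s.1 + t.1 := rfl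

/-- The multi-index of degree one at a coordinate. -/
def letter (α : ι) : NZ ι := ⟨Finsupp.single α 1, by simp⟩

/-- Degrees add up, and both summands have degree at least one. Consequently a list with a merged
entry never consists of letters only, and `listD` kills functions supported on words of letters. -/
theorem add_ne_letter (s t : NZ ι) (α : ι) : s + t ≠ letter α := fun h => by
  have h1 : s.1 + t.1 = Finsupp.single α 1 := congrArg Subtype.val h
  have h2 := congrArg Finsupp.degree h1
  rw [map_add, Finsupp.degree_single] at h2
  have hs := (Finsupp.degree_eq_zero_iff s.1).not.2 s.2
  have ht := (Finsupp.degree_eq_zero_iff t.1).not.2 t.2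
  omega

variable {K N : Type*} [Field K] [AddCommGroup N] [Module K N] (δ : N →ₗ[K] N)

/-- The cobar differential with coefficients in a complex `N`. -/
def cobarD (Γ : List (NZ ι) → N) (w : List (NZ ι)) : N :=
  listD Γ w + (-1 : K) ^ w.length • δ (Γ w)

/-- The part of the differential of the cofree comodule which involves the multi-index in front. -/
def headD (Γ : (ι →₀ ℕ) → List (NZ ι) → N) (s : ι →₀ ℕ) : List (NZ ι) → N
  | [] => 0
  | b :: w => Γ (s + b.1) w - listD (Γ s) (b :: w)

/-- The differential of the cofree comodule over the cobar complex. -/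
def coresD (Γ : (ι →₀ ℕ) → List (NZ ι) → N) (s : ι →₀ ℕ) (w : List (NZ ι)) : N :=
  headD Γ s w - (-1 : K) ^ w.length • δ (Γ s w)

theorem coresD_nil (Γ : (ι →₀ ℕ) → List (NZ ι) → N) (s : ι →₀ ℕ) :
    coresD δ Γ s [] = -δ (Γ s []) := by
  simp [coresD, headD]

theorem coresD_cons (Γ : (ι →₀ ℕ) → List (NZ ι) → N) (s : ι →₀ ℕ) (b : NZ ι) (w : List (NZ ι)) :
    coresD δ Γ s (b :: w) =
      Γ (s + b.1) w - listD (Γ s) (b :: w) + (-1 : K) ^ w.length • δ (Γ s (b :: w)) := by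
  simp [coresD, headD, pow_succ]

theorem coresD_add (Γ Γ' : (ι →₀ ℕ) → List (NZ ι) → N) :
    coresD δ (Γ + Γ') = coresD δ Γ + coresD δ Γ' := by
  funext s w
  cases w with
  | nil => simp [coresD_nil]; abel
  | cons b w =>
    have h : (Γ + Γ') s = fun v => Γ s v + Γ' s v := rfl
    simp only [coresD_cons, Pi.add_apply, h, listD_add, map_add, smul_add]
    abel

theorem coresD_neg (Γ : (ι →₀ ℕ) → List (NZ ι) → N) : coresD δ (-Γ) = -coresD δ Γ := by
  have h0 : coresD δ (0 : (ι →₀ ℕ) → List (NZ ι) → N) = 0 := by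
    simpa using coresD_add δ (0 : (ι →₀ ℕ) → List (NZ ι) → N) 0
  rw [eq_neg_iff_add_eq_zero, ← coresD_add, neg_add_cancel, h0]

theorem coresD_sub (Γ Γ' : (ι →₀ ℕ) → List (NZ ι) → N) :
    coresD δ (Γ - Γ') = coresD δ Γ - coresD δ Γ' := by
  rw [sub_eq_add_neg, coresD_add, coresD_neg, sub_eq_add_neg]

/-- `headD` is `listD` on the lists `s :: w` whose front entry may be zero, and it squares to zero
for the same reason. -/
theorem headD_headD (Γ : (ι →₀ ℕ) → List (NZ ι) → N) (s : ι →₀ ℕ) (w : List (NZ ι)) :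
    headD (headD Γ) s w = 0 := by
  cases w with
  | nil => rfl
  | cons b w =>
    cases w with
    | nil => simp [headD, listD_singleton]
    | cons c w =>
      have h := listD_listD (Γ s) (b :: c :: w)
      have h' : (fun v => headD Γ s (b :: v)) =
        fun v => Γ (s + b.1) v - listD (Γ s) (b :: v) := rfl
      rw [listD_cons_cons] at h
      simp only [headD]
      rw [listD_cons_cons (headD Γ s), h', listD_sub]
      simp only [headD, NZ.coe_add, add_assoc]
      rw [sub_eq_zero.1 h]
      abel

/-- Both parts square to zero, and the mixed terms cancel because a merging shortens the list by
one, which changes the sign in front of `δ`. -/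
theorem coresD_coresD (hδ : ∀ x, δ (δ x) = 0) (Γ : (ι →₀ ℕ) → List (NZ ι) → N) :
    coresD δ (coresD δ Γ) = 0 := by
  funext s w
  cases w with
  | nil => simp [coresD_nil, hδ]
  | cons b w =>
    have h := headD_headD Γ s (b :: w)
    have h1 : listD (coresD δ Γ s) (b :: w) =
        listD (headD Γ s) (b :: w) - (-1 : K) ^ w.length • δ (listD (Γ s) (b :: w)) := by
      rw [show δ (listD (Γ s) (b :: w)) = _ from map_listD δ.toAddMonoidHom _ _, ← listD_smul,
        ← listD_sub]
      refine listD_congr _ fun p x y q hw => ?_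
      have hl := congrArg List.length hw
      simp only [List.length_cons, List.length_append] at hl
      simp only [coresD, List.length_append, List.length_cons, LinearMap.toAddMonoidHom_coe]
      rw [show p.length + (q.length + 1) = w.length by omega]
    rw [coresD_cons, h1]
    rw [headD] at h
    rw [sub_eq_zero] at h
    simp only [map_sub, map_smul, hδ, coresD, Pi.zero_apply, smul_sub]
    rw [h]
    simp only [headD, map_sub, smul_sub, smul_zero, sub_zero]
    abel

/-- Extension by zero of a cobar cochain to the cofree comodule. -/
def headZero [DecidableEq ι] (Γ : List (NZ ι) → N) (s : ι →₀ ℕ) (w : List (NZ ι)) : N :=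
  if s = 0 then Γ w else 0

/-- Merging a nonzero entry into the front makes the front nonzero. Hence the functions concentrated
at front zero form a subcomplex, which is the cobar complex up to sign. -/
theorem coresD_headZero [DecidableEq ι] (Γ : List (NZ ι) → N) :
    coresD δ (headZero Γ) = -headZero (cobarD δ Γ) := by
  funext s w
  have hs : s ≠ 0 → headZero Γ s = fun _ => 0 := fun h => by funext v; simp [headZero, h]
  have hs' : headZero Γ 0 = Γ := by funext v; simp [headZero]
  cases w with
  | nil =>
    by_cases h : s = 0 <;> simp [coresD_nil, headZero, h, cobarD, listD_nil]
  | cons b w =>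
    have hb : ¬ (s + b.1 = 0) := fun h => b.2 (add_eq_zero.1 h).2
    by_cases h : s = 0
    · subst h
      rw [coresD_cons, hs']
      simp [headZero, b.2, cobarD, pow_succ]
      abel
    · rw [coresD_cons, hs h]
      simp [headZero, hb, h, listD_zero]

end Cobar

/-! ### Reduction of cocycles to decreasing words. -/

section Cocycles

variable {d : ℕ} {K N : Type*} [Field K] [AddCommGroup N] [Module K N] (δ : N →ₗ[K] N)

/-- The words of strictly decreasing letters with indices smaller than `i`. -/
def IsWord (i : ℕ) (w : List (NZ (Fin d))) : Prop :=
  ∃ l : List (Fin d), w = l.map letter ∧ l.Pairwise (· > ·) ∧ ∀ x ∈ l, x.1 < i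

theorem IsWord.listD_eq_zero {i : ℕ} {Γ : List (NZ (Fin d)) → N} (h : ∀ w, ¬ IsWord i w → Γ w = 0)
    (w : List (NZ (Fin d))) : listD Γ w = 0 := by
  refine PolyGS.listD_eq_zero w fun p a b q _ => h _ ?_
  rintro ⟨l, hl, -⟩
  have : a + b ∈ l.map letter := hl ▸ by simp
  obtain ⟨α, -, hα⟩ := List.mem_map.1 this
  exact add_ne_letter a b α hα.symm

/-- Contractibility of the cofree comodule: the homotopy takes a nonzero front `s` and makes it the
first entry of the list behind a zero front. Only the value at zero front and empty list survives.
-/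
theorem coresD_contract {z : (Fin d →₀ ℕ) → List (NZ (Fin d)) → N} (hz : coresD δ z = 0) :
    z = coresD δ (fun s w => if h : s ≠ 0 then z 0 (⟨s, h⟩ :: w) else 0) +
      headZero fun w => if w = [] then z 0 [] else 0 := by
  funext s w
  have h0 : (fun w => if h : (0 : Fin d →₀ ℕ) ≠ 0 then z 0 (⟨0, h⟩ :: w) else 0) =
    fun _ => (0 : N) := by simp
  by_cases hs : s = 0
  · subst hs
    cases w with
    | nil => simp [coresD_nil, headZero]
    | cons b w =>
      simp only [Pi.add_apply, coresD_cons, h0, listD_zero]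
      simp [headZero, b.2]
  · have h1 : (fun w => if h : s ≠ 0 then z 0 (⟨s, h⟩ :: w) else 0) =
      fun w => z 0 (⟨s, hs⟩ :: w) := by funext w; simp [hs]
    -- The cocycle condition at zero front, on the list beginning with `s`, expresses `z s w`
    -- through values at zero front.
    have h2 := congrFun (congrFun hz 0) (⟨s, hs⟩ :: w)
    rw [coresD_cons] at h2
    simp only [zero_add, Pi.zero_apply] at h2
    cases w with
    | nil =>
      simp only [Pi.add_apply, coresD_nil]
      simp only [listD_singleton, List.length_nil, pow_zero, one_smul, sub_zero] at h2
      simp [headZero, hs, eq_neg_of_add_eq_zero_left h2]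
    | cons b w =>
      have hsb : s + b.1 ≠ 0 := fun h => hs (add_eq_zero.1 h).1
      simp only [Pi.add_apply, coresD_cons, h1, dif_pos hsb]
      rw [listD_cons_cons] at h2
      have h3 : (⟨s, hs⟩ + b : NZ (Fin d)) = ⟨s + b.1, hsb⟩ := rfl
      simp only [h3, List.length_cons, pow_succ] at h2
      simp only [headZero, hs, if_false, add_zero, ne_eq, not_false_eq_true, dite_true]
      rw [← sub_eq_zero, ← h2]
      simp only [mul_neg, mul_one, neg_smul]
      abel

/-- The contraction of the multi-index in front with a coordinate. -/
def shiftHead (μ : Fin d) (Γ : (Fin d →₀ ℕ) → List (NZ (Fin d)) → N) :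
    (Fin d →₀ ℕ) → List (NZ (Fin d)) → N := fun s w => Γ (s + Finsupp.single μ 1) w

/-- The front enters the differential only through addition, so a translation of it is a chain map.
-/
theorem coresD_shiftHead (μ : Fin d) (Γ : (Fin d →₀ ℕ) → List (NZ (Fin d)) → N) :
    coresD δ (shiftHead μ Γ) = shiftHead μ (coresD δ Γ) := by
  funext s w
  cases w with
  | nil => rfl
  | cons b w =>
    change _ = coresD δ Γ (s + Finsupp.single μ 1) (b :: w)
    rw [coresD_cons, coresD_cons, shiftHead, add_right_comm]
    rfl

/-- With the front at the coordinate `μ`, the only surviving term merges the letter `μ` into a zero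
front: `listD` and `δ` kill `Ξ`, and a multi-index of degree one is indecomposable. The effect is to
prepend `μ` to the words. -/
theorem coresD_letter (μ : Fin d) {i : ℕ} {Ξ : List (NZ (Fin d)) → N}
    (hΞ : ∀ w, ¬ IsWord i w → Ξ w = 0) (hδ : ∀ w, δ (Ξ w) = 0) :
    coresD δ (fun s w => if s = Finsupp.single μ 1 then Ξ w else 0) =
      headZero fun w => match w with
        | [] => 0
        | b :: w => if b = letter μ then Ξ w else 0 := by
  funext s w
  cases w with
  | nil =>
    by_cases h : s = Finsupp.single μ 1 <;> simp [coresD_nil, headZero, h, hδ]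
  | cons b w =>
    have h1 : listD (fun w => if s = Finsupp.single μ 1 then Ξ w else 0) (b :: w) = 0 := by
      by_cases h : s = Finsupp.single μ 1
      · simpa [h] using IsWord.listD_eq_zero hΞ (b :: w)
      · simp [h, listD_zero]
    have h2 : δ (if s = Finsupp.single μ 1 then Ξ (b :: w) else 0) = 0 := by
      split_ifs <;> simp [hδ]
    rw [coresD_cons, h1, h2]
    simp only [headZero, smul_zero, add_zero, sub_zero]
    by_cases hs : s = 0
    · simp [hs, letter, Subtype.ext_iff]
    · rw [if_neg hs, if_neg]
      intro h
      exact add_ne_letter ⟨s, hs⟩ b μ (Subtype.ext h)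

/-- Let F_i be the functions which vanish when the front involves a coordinate below `i`. F_0 is
everything and is contractible; F_d is concentrated at front zero and is the cobar complex.
Translation of the front by the coordinate number i maps F_i onto F_i with kernel F_{i+1}. So,
passing from F_i to F_{i+1}, the cohomology gains a shifted copy of itself, consisting of the words
to which the letter i is prepended. The proof is the diagram chase along this exact sequence. -/
theorem exists_of_coresD_eq_zero (hδ : ∀ x, δ (δ x) = 0) (i : ℕ) (hi : i ≤ d) :
    ∀ z : (Fin d →₀ ℕ) → List (NZ (Fin d)) → N,
      (∀ s w, (∃ α, α.1 < i ∧ s α ≠ 0) → z s w = 0) → coresD δ z = 0 →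
      ∃ (y : (Fin d →₀ ℕ) → List (NZ (Fin d)) → N) (Ξ : List (NZ (Fin d)) → N),
        (∀ s w, (∃ α, α.1 < i ∧ s α ≠ 0) → y s w = 0) ∧ (∀ w, ¬ IsWord i w → Ξ w = 0) ∧
        (∀ w, δ (Ξ w) = 0) ∧ z = coresD δ y + headZero Ξ := by
  induction i with
  | zero =>
    intro z _ hz
    refine ⟨_, _, ?_, ?_, ?_, coresD_contract δ hz⟩
    · rintro s w ⟨α, hα, -⟩
      omega
    · intro w hw
      rw [if_neg]
      rintro rfl
      exact hw ⟨[], rfl, List.Pairwise.nil, by simp⟩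
    · intro w
      have h := congrFun (congrFun hz 0) []
      rw [coresD_nil] at h
      split_ifs
      · simpa using h
      · simp
  | succ i ih =>
    intro z hzs hz
    let μ : Fin d := ⟨i, hi⟩
    obtain ⟨y, Ξ, hy, hΞ, hΞδ, hzy⟩ := ih (by omega) z
      (fun s w ⟨α, hα, h⟩ => hzs s w ⟨α, by omega, h⟩) hz
    have hsh : ∀ z : (Fin d →₀ ℕ) → List (NZ (Fin d)) → N,
        (∀ s w, (∃ α, α.1 < i ∧ s α ≠ 0) → z s w = 0) →
        ∀ s w, (∃ α, α.1 < i ∧ s α ≠ 0) → shiftHead μ z s w = 0 := by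
      rintro z hz s w ⟨α, hα, h⟩
      exact hz _ _ ⟨α, hα, by simp [h]⟩
    -- The primitive `y` lies only in the larger complex. As `z` and `headZero Ξ` have zero
    -- translate, the translate of `y` is a cocycle, and the induction hypothesis applies to it.
    have hDy : coresD δ (shiftHead μ y) = 0 := by
      rw [coresD_shiftHead]
      funext s w
      have h1 := congrFun (congrFun hzy (s + Finsupp.single μ 1)) w
      rw [hzs _ _ ⟨μ, by simp [μ], by simp⟩] at h1
      have h2 : headZero Ξ (s + Finsupp.single μ 1) w = 0 := by simp [headZero]
      simp only [Pi.add_apply, h2, add_zero] at h1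
      exact h1.symm
    obtain ⟨y', Ξ', hy', hΞ', hΞδ', hyy⟩ := ih (by omega) _ (hsh y hy) hDy
    -- `y''` and `e` are preimages under the translation of `y'` and of `headZero Ξ'`. Subtracting
    -- `coresD δ y''` and `e` brings `y` into the kernel, and `coresD δ e` supplies the words
    -- beginning with `μ`.
    let y'' : (Fin d →₀ ℕ) → List (NZ (Fin d)) → N := fun s w =>
      if s μ = 0 then 0 else y' (s - Finsupp.single μ 1) w
    let e : (Fin d →₀ ℕ) → List (NZ (Fin d)) → N := fun s w =>
      if s = Finsupp.single μ 1 then Ξ' w else 0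
    have hy'' : shiftHead μ y'' = y' := by
      funext s w
      simp [shiftHead, y'']
    have he : shiftHead μ e = headZero Ξ' := by
      funext s w
      simp [shiftHead, e, headZero]
    have hDe := coresD_letter δ μ hΞ' hΞδ'
    have hy1 : ∀ s w, (∃ α, α.1 < i + 1 ∧ s α ≠ 0) → (y - coresD δ y'' - e) s w = 0 := by
      rintro s w ⟨α, hα, hs⟩
      by_cases hsμ : s μ = 0
      · have hαi : α.1 < i := by
          rcases Nat.lt_succ_iff_lt_or_eq.1 hα with h | h
          · exact h
          · exact absurd (by rwa [show α = μ from Fin.ext h] at hs) (not_not.2 hsμ)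
        have hsy : ∀ s, s α ≠ 0 → y'' s = fun _ => 0 := by
          intro s hs
          funext v
          simp only [y'']
          split_ifs
          · rfl
          · refine hy' _ _ ⟨α, hαi, ?_⟩
            have : μ ≠ α := fun h => by simp [μ, ← h] at hαi
            simp [this, hs]
        have h1 : coresD δ y'' s w = 0 := by
          cases w with
          | nil => simp [coresD_nil, hsy s hs]
          | cons b w => simp [coresD_cons, hsy s hs, hsy (s + b.1) (by simp [hs]), listD_zero]
        have h2 : e s w = 0 := by
          simp only [e]
          rw [if_neg]
          rintro rfl
          simp at hsμ
        simp [hy s w ⟨α, hαi, hs⟩, h1, h2]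
      · have h : s = (s - Finsupp.single μ 1) + Finsupp.single μ 1 := by
          ext β
          by_cases hβ : β = μ
          · subst hβ; simp; omega
          · simp [Ne.symm hβ]
        have h1 : shiftHead μ (y - coresD δ y'' - e) = 0 := by
          have : shiftHead μ (y - coresD δ y'' - e) =
            shiftHead μ y - shiftHead μ (coresD δ y'') - shiftHead μ e := rfl
          rw [this, ← coresD_shiftHead, hy'', he, hyy]
          abel
        rw [h]
        exact congrFun (congrFun h1 _) w
    let Ξ'' : List (NZ (Fin d)) → N := fun w => match w with
        | [] => 0
        | b :: w => if b = letter μ then Ξ' w else 0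
    refine ⟨y - coresD δ y'' - e, Ξ + Ξ'', hy1, ?_, ?_, ?_⟩
    · intro w hw
      have h1 : Ξ w = 0 := hΞ w fun ⟨l, hl, hp, hm⟩ => hw ⟨l, hl, hp, fun x hx => by
        have := hm x hx; omega⟩
      have h2 : Ξ'' w = 0 := by
        cases w with
        | nil => rfl
        | cons b w =>
          simp only [Ξ'']
          split_ifs with hb
          · refine hΞ' w ?_
            rintro ⟨l, hl, hp, hm⟩
            refine hw ⟨μ :: l, by rw [hb, hl]; rfl, List.pairwise_cons.2 ⟨fun x hx => hm x hx, hp⟩, ?_⟩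
            intro x hx
            rcases List.mem_cons.1 hx with rfl | hx
            · exact Nat.lt_succ_self i
            · have := hm x hx; omega
          · rfl
      simp [h1, h2]
    · intro w
      have h2 : δ (Ξ'' w) = 0 := by
        cases w with
        | nil => simp [Ξ'']
        | cons b w => simp only [Ξ'']; split_ifs <;> simp [hΞδ']
      simp [hΞδ, h2]
    · have h1 : headZero (Ξ + Ξ'') = headZero Ξ + headZero Ξ'' := by
        funext s w
        by_cases h : s = 0 <;> simp [headZero, h]
      rw [coresD_sub, coresD_sub, coresD_coresD δ hδ, hDe, h1, hzy]
      simp only [Ξ'']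
      abel

/-- Every cocycle of the cobar complex is cohomologous to a combination of words of
decreasing letters. -/
theorem exists_of_cobarD_eq_zero (hδ : ∀ x, δ (δ x) = 0) (z : List (NZ (Fin d)) → N)
    (hz : cobarD δ z = 0) : ∃ y Ξ : List (NZ (Fin d)) → N,
      (∀ w, ¬ IsWord d w → Ξ w = 0) ∧ (∀ w, δ (Ξ w) = 0) ∧ z = cobarD δ y + Ξ := by
  obtain ⟨y, Ξ, hy, hΞ, hΞδ, h⟩ := exists_of_coresD_eq_zero δ hδ d le_rfl (headZero z)
    (by
      rintro s w ⟨α, -, h⟩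
      rw [headZero, if_neg]
      rintro rfl
      simp at h)
    (by
      rw [coresD_headZero, hz]
      funext s w
      simp [headZero])
  -- For `i = d` no coordinate is left for the front, so the primitive itself comes from the cobar
  -- complex.
  have hy0 : y = headZero (y 0) := by
    funext s w
    by_cases hs : s = 0
    · simp [headZero, hs]
    · rw [headZero, if_neg hs]
      obtain ⟨α, hα⟩ := Finsupp.ne_iff.1 hs
      exact hy s w ⟨α, α.2, hα⟩
  have hneg : cobarD δ (-(y 0)) = -cobarD δ (y 0) := by
    funext w
    have := listD_sub (fun _ => 0) (y 0) w
    simp only [zero_sub, listD_zero] at this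
    simp only [cobarD, Pi.neg_apply, map_neg, smul_neg, neg_add]
    rw [← this]
    rfl
  refine ⟨-(y 0), Ξ, hΞ, hΞδ, ?_⟩
  rw [hy0, coresD_headZero] at h
  funext w
  have := congrFun (congrFun h 0) w
  simpa [headZero, hneg] using this

end Cocycles

/-! ### Cocycles in two lists. -/

section TwoSided

variable {d : ℕ} {K : Type*} [Field K]

/-- The total differential of functions of two lists. -/
def totD {S S' : Type*} [Add S] [Add S'] (Γ : List S → List S' → K) (w : List S) (w' : List S') :
    K :=
  listD (fun v => Γ v w') w + (-1 : K) ^ w.length * listD (Γ w) w'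

/-- The one-list result is used twice. With coefficients in the functions of the second list, it
replaces `z` by some `Ξ` supported on words in the first list, every `Ξ w` being a cocycle. Each `Ξ
w` is then reduced separately, with `δ = 0`. -/
theorem exists_of_totD_eq_zero (z : List (NZ (Fin d)) → List (NZ (Fin d)) → K)
    (hz : ∀ w w', totD z w w' = 0) : ∃ y Ξ : List (NZ (Fin d)) → List (NZ (Fin d)) → K,
      (∀ w w', ¬ (IsWord d w ∧ IsWord d w') → Ξ w w' = 0) ∧
      ∀ w w', z w w' = totD y w w' + Ξ w w' := by
  have happ : ∀ (Γ : List (NZ (Fin d)) → List (NZ (Fin d)) → K) w w',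
      listD Γ w w' = listD (fun v => Γ v w') w := fun Γ w w' =>
    map_listD (Pi.evalAddMonoidHom (fun _ : List (NZ (Fin d)) => K) w') Γ w
  have htot : ∀ (Γ : List (NZ (Fin d)) → List (NZ (Fin d)) → K) w w',
      cobarD (listDHom K) Γ w w' = totD Γ w w' := fun Γ w w' => by
    simp only [cobarD, totD, Pi.add_apply, happ, Pi.smul_apply, smul_eq_mul]
    rfl
  obtain ⟨y, Ξ, hΞ, hΞδ, h⟩ := exists_of_cobarD_eq_zero (listDHom K)
    (fun x => funext fun w => listD_listD x w) z
    (by funext w w'; rw [htot]; exact hz w w')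
  have h1 : ∀ w, ∃ y' Ξ' : List (NZ (Fin d)) → K, (∀ w, ¬ IsWord d w → Ξ' w = 0) ∧
      Ξ w = listD y' + Ξ' := fun w => by
    obtain ⟨y', Ξ', h1, -, h2⟩ := exists_of_cobarD_eq_zero (0 : K →ₗ[K] K) (by simp) (Ξ w)
      (by
        funext w'
        simp only [cobarD, LinearMap.zero_apply, smul_zero, add_zero]
        exact congrFun (hΞδ w) w')
    refine ⟨y', Ξ', h1, ?_⟩
    rw [h2]
    funext w'
    simp [cobarD]
  choose y' Ξ' hΞ' hy' using h1
  classical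
  -- The sign compensates the one in `totD`, and the support on words makes the first half of `totD
  -- u` vanish.
  let u : List (NZ (Fin d)) → List (NZ (Fin d)) → K := fun w w' =>
    if IsWord d w then (-1 : K) ^ w.length * y' w w' else 0
  have hu : ∀ w w', totD u w w' = if IsWord d w then listD (y' w) w' else 0 := fun w w' => by
    have h1 : listD (fun v => u v w') w = 0 :=
      IsWord.listD_eq_zero (i := d) (fun v hv => if_neg hv) w
    rw [totD, h1, zero_add]
    by_cases hw : IsWord d w
    · have h2 : u w = fun v => (-1 : K) ^ w.length • y' w v := by funext v; simp [u, hw]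
      rw [h2, listD_smul, if_pos hw, smul_eq_mul, ← mul_assoc, ← pow_add, Even.neg_one_pow ⟨_, rfl⟩,
        one_mul]
    · have h2 : u w = fun v => 0 := by funext v; simp [u, hw]
      rw [h2, listD_zero, mul_zero, if_neg hw]
  refine ⟨fun w w' => y w w' + u w w', fun w w' => if IsWord d w then Ξ' w w' else 0, ?_, ?_⟩
  · intro w w' hw
    by_cases h1 : IsWord d w
    · refine (if_pos h1).trans ?_
      exact hΞ' w w' fun h2 => hw ⟨h1, h2⟩
    · exact if_neg h1
  · intro w w'
    have hadd : totD (fun w w' => y w w' + u w w') w w' = totD y w w' + totD u w w' := by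
      simp only [totD, listD_add]
      ring
    have h3 := congrFun (congrFun h w) w'
    rw [Pi.add_apply, Pi.add_apply, htot] at h3
    rw [h3, hadd, hu]
    by_cases h1 : IsWord d w
    · rw [hy' w]
      simp [h1]
      ring
    · simp [h1, hΞ w h1]

end TwoSided

/-! ### Contents of the blocks of labelled partitions. -/

section Contents

variable {M : Type*} [AddCommMonoid M]

/-- The sums of a family over the fibres of a map. -/
def push {m k : ℕ} (f : Fin m → Fin k) : (Fin m → M) →+ (Fin k → M) where
  toFun s j := ∑ i with f i = j, s i
  map_zero' := by funext j; simp
  map_add' s t := by funext j; simp [Finset.sum_add_distrib]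

theorem push_apply {m k : ℕ} (f : Fin m → Fin k) (s : Fin m → M) (j : Fin k) :
    push f s j = ∑ i with f i = j, s i := rfl

theorem push_push {m k l : ℕ} (f : Fin m → Fin k) (g : Fin k → Fin l) (s : Fin m → M) :
    push g (push f s) = push (g ∘ f) s := by
  funext j
  simp only [push_apply, Finset.sum_filter]
  have h : ∀ i, (if g i = j then ∑ t, if f t = i then s t else 0 else 0) =
      ∑ t, if g i = j then if f t = i then s t else 0 else 0 := fun i => by
    split_ifs <;> simp
  simp only [h]
  rw [Finset.sum_comm]
  refine Finset.sum_congr rfl fun t _ => ?_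
  rw [Finset.sum_eq_single (f t)]
  · simp
  · intro i _ hi
    simp [Ne.symm hi]
  · simp

theorem push_single {m k : ℕ} (f : Fin m → Fin k) (i : Fin m) (x : M) :
    push f (Pi.single i x) = Pi.single (f i) x := by
  funext j
  rw [push_apply, Finset.sum_filter, Finset.sum_eq_single i]
  · by_cases h : f i = j
    · subst h; simp
    · rw [if_neg h, Pi.single_eq_of_ne (Ne.symm h)]
  · intro t _ ht
    simp [ht]
  · simp

theorem push_predAbove_zero {k : ℕ} (a b : M) (s : Fin k → M) :
    push (0 : Fin (k + 1)).predAbove (Fin.cons a (Fin.cons b s)) = Fin.cons (a + b) s := by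
  funext j
  rw [push_apply, Finset.sum_filter, Fin.sum_univ_succ, Fin.sum_univ_succ]
  cases j using Fin.cases with
  | zero => simp [Fin.succ_ne_zero]
  | succ j =>
    simp [Fin.succ_ne_zero, (Fin.succ_ne_zero _).symm]

theorem push_predAbove_succ {k : ℕ} (i : Fin k) (a : M) (s : Fin (k + 1) → M) :
    push i.succ.predAbove (Fin.cons a s) = Fin.cons a (push i.predAbove s) := by
  funext j
  rw [push_apply, Finset.sum_filter, Fin.sum_univ_succ]
  cases j using Fin.cases with
  | zero => simp [Fin.succ_ne_zero]
  | succ j => simp [push_apply, Finset.sum_filter, (Fin.succ_ne_zero _).symm]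

/-- `i.predAbove` identifies the positions `i` and `i + 1`, so pushing forward along it merges these
entries. This links the recursion of `listD` to the face maps in the other differentials. -/
theorem listD_ofFn {N K : Type*} [Ring K] [AddCommGroup N] [Module K N] {k : ℕ} (Γ : List M → N)
    (s : Fin (k + 1) → M) : listD Γ (List.ofFn s) =
      ∑ i : Fin k, (-1 : K) ^ (i : ℕ) • Γ (List.ofFn (push i.predAbove s)) := by
  induction k generalizing Γ with
  | zero => simp [listD_singleton]
  | succ k ih =>
    obtain ⟨a, s, rfl⟩ : ∃ a s', s = Fin.cons a s' := ⟨s 0, Fin.tail s, (Fin.cons_self_tail s).symm⟩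
    obtain ⟨b, s', hs'⟩ : ∃ b s', s = Fin.cons b s' := ⟨s 0, Fin.tail s, (Fin.cons_self_tail s).symm⟩
    have h := ih (fun v => Γ (a :: v)) s
    rw [Fin.sum_univ_succ]
    simp only [push_predAbove_succ, List.ofFn_cons, Fin.val_succ, pow_succ, mul_neg, mul_one,
      neg_smul, Finset.sum_neg_distrib]
    rw [← h, hs', push_predAbove_zero, List.ofFn_cons, List.ofFn_cons, listD_cons_cons]
    simp [sub_eq_add_neg]

variable {ι : Type*}

/-- The multi-indices formed by the labels of the legs in each block. -/
def content {m k : ℕ} (π : Fin m → Fin k) (I : Fin m → ι) : Fin k → (ι →₀ ℕ) :=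
  push π fun t => Finsupp.single (I t) 1

/-- The list of the contents of the blocks of a labelled ordered partition. -/
def cont {m : ℕ} (P : Corolla m) (I : Fin m → ι) : List (ι →₀ ℕ) := List.ofFn (content P.2.1 I)

theorem length_cont {m : ℕ} (P : Corolla m) (I : Fin m → ι) : (cont P I).length = P.1 := by
  simp [cont]

theorem content_apply [DecidableEq ι] {m k : ℕ} (π : Fin m → Fin k) (I : Fin m → ι) (i : Fin k)
    (α : ι) : content π I i α = (Finset.univ.filter fun t => (π t, I t) = (i, α)).card := by
  rw [content, push_apply, Finsupp.finsetSum_apply, Finset.card_eq_sum_ones, Finset.sum_filter,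
    Finset.sum_filter]
  refine Finset.sum_congr rfl fun t _ => ?_
  by_cases h1 : π t = i <;> by_cases h2 : I t = α <;> simp [h1, h2]

theorem content_ne_zero {m k : ℕ} {π : Fin m → Fin k} (hπ : Function.Surjective π) (I : Fin m → ι)
    (i : Fin k) : content π I i ≠ 0 := by
  classical
  obtain ⟨t, rfl⟩ := hπ i
  intro h
  have h1 := content_apply π I (π t) (I t)
  rw [h, Finsupp.zero_apply, eq_comm, Finset.card_eq_zero] at h1
  exact Finset.notMem_empty t (h1 ▸ by simp)

/-- The total degree of a list of multi-indices. -/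
def wdeg (w : List (ι →₀ ℕ)) : ℕ := (w.map Finsupp.degree).sum

theorem wdeg_merge (p : List (ι →₀ ℕ)) (a b : ι →₀ ℕ) (q : List (ι →₀ ℕ)) :
    wdeg (p ++ (a + b) :: q) = wdeg (p ++ a :: b :: q) := by
  simp [wdeg, add_assoc]

theorem sum_degree_content {m k : ℕ} (π : Fin m → Fin k) (I : Fin m → ι) :
    ∑ i, (content π I i).degree = m := by
  simp only [content, push_apply, map_sum, Finsupp.degree_single]
  rw [Finset.sum_fiberwise (s := Finset.univ) (g := π) (f := fun _ => 1)]
  simp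

theorem wdeg_cont {m : ℕ} (P : Corolla m) (I : Fin m → ι) : wdeg (cont P I) = m := by
  rw [wdeg, cont, List.map_ofFn, List.sum_ofFn]
  exact sum_degree_content _ _

theorem cont_relabel {m : ℕ} (σ : Equiv.Perm (Fin m)) (P : Corolla m) (I : Fin m → ι) :
    cont (relabel σ P) I = cont P (I ∘ σ) := by
  classical
  have h : content (P.2.1 ∘ σ.symm) I = content P.2.1 (I ∘ σ) := by
    funext i
    ext α
    rw [content_apply, content_apply]
    refine Finset.card_equiv σ.symm fun t => ?_
    simp
  exact congrArg List.ofFn h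

theorem exists_perm_of_card_fiber {X Y : Type*} [Fintype X] [DecidableEq Y] (f g : X → Y)
    (h : ∀ y, (Finset.univ.filter fun x => f x = y).card =
      (Finset.univ.filter fun x => g x = y).card) : ∃ σ : Equiv.Perm X, ∀ x, g (σ x) = f x := by
  have e : ∀ y, Nonempty ({x // f x = y} ≃ {x // g x = y}) := fun y =>
    ⟨Fintype.equivOfCardEq (by rw [Fintype.card_subtype, Fintype.card_subtype]; exact h y)⟩
  refine ⟨(Equiv.sigmaFiberEquiv f).symm.trans ((Equiv.sigmaCongrRight fun y => (e y).some).trans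
    (Equiv.sigmaFiberEquiv g)), fun x => ?_⟩
  exact ((e (f x)).some ⟨x, rfl⟩).2

/-- The contents record the cardinalities of the fibres of leg ↦ (block, label). Maps with
equinumerous fibres differ by a permutation of the legs. -/
theorem exists_perm_of_cont_eq {m : ℕ} {P P' : Corolla m} {I I' : Fin m → ι}
    (h : cont P I = cont P' I') : ∃ σ : Equiv.Perm (Fin m), P' = relabel σ P ∧ I' = I ∘ σ.symm := by
  classical
  obtain ⟨k, π, hπ⟩ := P
  obtain ⟨k', π', hπ'⟩ := P'
  have hk : k = k' := by simpa [cont] using congrArg List.length h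
  subst hk
  have hc : content π I = content π' I' := List.ofFn_injective h
  obtain ⟨σ, hσ⟩ := exists_perm_of_card_fiber (fun t => (π t, I t)) (fun t => (π' t, I' t))
    fun y => by rw [← content_apply, ← content_apply, hc]
  simp only [Prod.mk.injEq] at hσ
  refine ⟨σ, ?_, ?_⟩
  · have : π' = π ∘ σ.symm := by
      funext t
      simpa using (hσ (σ.symm t)).1
    subst this
    rfl
  · funext t
    simpa using (hσ (σ.symm t)).2

theorem exists_content_eq [Fintype ι] {k m : ℕ} (s : Fin k → (ι →₀ ℕ)) (hm : ∑ i, (s i).degree = m) :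
    ∃ (π : Fin m → Fin k) (I : Fin m → ι), content π I = s := by
  classical
  -- One leg for each unit of each exponent; its block and its label are the first two components.
  let T := Σ i : Fin k, Σ α : ι, Fin (s i α)
  have hT : Fintype.card T = Fintype.card (Fin m) := by
    simp only [T, Fintype.card_sigma, Fintype.card_fin, ← hm, Finsupp.degree_eq_sum]
  let e := Fintype.equivOfCardEq hT
  refine ⟨fun t => (e.symm t).1, fun t => (e.symm t).2.1, ?_⟩
  funext i
  ext α
  rw [content_apply]
  have h1 : (Finset.univ.filter fun t => ((e.symm t).1, (e.symm t).2.1) = (i, α)).card =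
      (Finset.univ.filter fun x : T => (x.1, x.2.1) = (i, α)).card :=
    Finset.card_equiv e.symm (by simp)
  rw [h1]
  have h2 : (Finset.univ.filter fun x : T => (x.1, x.2.1) = (i, α)) =
      Finset.univ.image fun j : Fin (s i α) => (⟨i, α, j⟩ : T) := by
    ext ⟨i', α', j⟩
    simp only [Finset.mem_filter, Finset.mem_univ, true_and, Finset.mem_image, Prod.mk.injEq]
    constructor
    · rintro ⟨rfl, rfl⟩
      exact ⟨j, rfl⟩
    · rintro ⟨j', h⟩
      cases h
      exact ⟨rfl, rfl⟩
  rw [h2, Finset.card_image_of_injective _ fun a b h => by cases h; rfl, Finset.card_univ,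
    Fintype.card_fin]

theorem exists_cont_eq [Fintype ι] {w : List (ι →₀ ℕ)} (hw : (0 : ι →₀ ℕ) ∉ w) :
    ∃ (P : Corolla (wdeg w)) (I : Fin (wdeg w) → ι), cont P I = w := by
  classical
  obtain ⟨π, I, h⟩ := exists_content_eq (m := wdeg w) w.get (by
    rw [← List.sum_ofFn]
    exact congrArg List.sum (List.map_ofFn.symm.trans (by rw [List.ofFn_get])))
  refine ⟨⟨w.length, π, fun i => ?_⟩, I, ?_⟩
  · by_contra hi
    push Not at hi
    refine hw ?_
    have : w.get i = 0 := by
      rw [← h]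
      ext α
      rw [content_apply, Finset.card_eq_zero.2 (Finset.filter_eq_empty_iff.2 fun t _ ht => ?_)]
      · rfl
      · exact hi t (Prod.mk.inj ht).1
    exact this ▸ w.get_mem i
  · exact (congrArg List.ofFn h).trans (List.ofFn_get w)

theorem zero_notMem_cont {m : ℕ} (P : Corolla m) (I : Fin m → ι) : (0 : ι →₀ ℕ) ∉ cont P I := by
  rw [cont, List.mem_ofFn]
  rintro ⟨i, hi⟩
  exact content_ne_zero P.2.2 I i hi

theorem cont_ne_nil {m : ℕ} (P : Corolla (m + 1)) (I : Fin (m + 1) → ι) : cont P I ≠ [] := by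
  intro h
  have := wdeg_cont P I
  rw [h] at this
  simp [wdeg] at this

theorem wdeg_eq_zero {w : List (ι →₀ ℕ)} (hw : (0 : ι →₀ ℕ) ∉ w) (h : wdeg w = 0) : w = [] := by
  cases w with
  | nil => rfl
  | cons a w =>
    simp only [wdeg, List.map_cons, List.sum_cons, Nat.add_eq_zero_iff,
      Finsupp.degree_eq_zero_iff] at h
    exact absurd (by simp [h.1]) hw

theorem exists_cont_eq_succ [Fintype ι] {w : List (ι →₀ ℕ)} (hw : (0 : ι →₀ ℕ) ∉ w) (hw' : w ≠ []) :
    ∃ (m : ℕ) (P : Corolla (m + 1)) (I : Fin (m + 1) → ι), cont P I = w := by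
  have h := exists_cont_eq hw
  obtain ⟨m, hm⟩ := Nat.exists_eq_succ_of_ne_zero fun h => hw' (wdeg_eq_zero hw h)
  rw [hm] at h
  exact ⟨m, h⟩

/-- Merging two blocks adds their contents, so the differential of ordered partitions is `listD`
when seen through contents. -/
theorem linearCombination_deltaCorolla {K N : Type*} [Field K] [AddCommGroup N] [Module K N]
    {m : ℕ} (Γ : List (ι →₀ ℕ) → N) (P : Corolla m) (I : Fin m → ι) :
    Finsupp.linearCombination K (fun P : Corolla m => Γ (cont P I)) (deltaCorolla K P) =
      listD Γ (cont P I) := by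
  obtain ⟨k, π⟩ := P
  cases k with
  | zero => simp [deltaCorolla, cont, listD_nil]
  | succ k =>
    simp only [deltaCorolla, map_sum, map_smul, Finsupp.linearCombination_single, one_smul]
    rw [cont, listD_ofFn (K := K)]
    refine Finset.sum_congr rfl fun i _ => ?_
    rw [content, push_push]
    rfl

end Contents

/-! ### The symbol of a representation. -/

section Symbol

variable {K : Type*} [Field K] {V : Type*} [AddCommGroup V] [Module K V]
variable {ι : Type} [Fintype ι] [DecidableEq ι] (b : Module.Basis ι K V)

theorem toHom_permQ {m n : ℕ} (ρ : RepHom K V m n) (σ : Equiv.Perm (Fin m))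
    (τ : Equiv.Perm (Fin n)) (q : Q K m n) :
    toHom K V m n ρ (permQ K σ τ q) = permV K V σ ∘ₗ toHom K V m n ρ q ∘ₗ permV K V τ :=
  ρ.2 σ τ q

theorem permQ_single {m n : ℕ} (σ : Equiv.Perm (Fin m)) (τ : Equiv.Perm (Fin n)) (P : Corolla m)
    (R : Corolla n) : permQ K σ τ (Finsupp.single P 1 ⊗ₜ Finsupp.single R 1) =
      Finsupp.single (relabel σ P) 1 ⊗ₜ Finsupp.single (relabel τ⁻¹ R) 1 := by
  simp [permQ, permY, Finsupp.mapDomain_single]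

theorem permV_tprod {n : ℕ} (σ : Equiv.Perm (Fin n)) (v : Fin n → V) :
    permV K V σ (PiTensorProduct.tprod K v) = PiTensorProduct.tprod K (v ∘ σ.symm) :=
  PiTensorProduct.reindex_tprod (s := fun _ => V) σ v

theorem coord_permV {n : ℕ} (σ : Equiv.Perm (Fin n)) (I : Fin n → ι) (x : ⨂[K] _ : Fin n, V) :
    (Basis.piTensorProduct fun _ : Fin n => b).coord (I ∘ σ.symm) (permV K V σ x) =
      (Basis.piTensorProduct fun _ : Fin n => b).coord I x := by
  induction x using PiTensorProduct.induction_on with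
  | smul_tprod r v =>
    rw [map_smul, map_smul, map_smul, permV_tprod, Module.Basis.coord_apply,
      Module.Basis.coord_apply, Basis.piTensorProduct_repr_tprod_apply,
      Basis.piTensorProduct_repr_tprod_apply]
    congr 1
    exact Fintype.prod_equiv σ.symm _ _ fun _ => rfl
  | add x y hx hy => simp only [map_add, hx, hy]

theorem coeffΓ_apply {m n : ℕ} (P : Corolla m) (R : Corolla n) (I : Fin m → ι) (J : Fin n → ι)
    (ρ : RepHom K V m n) : coeffΓ K b P R I J ρ =
      (Basis.piTensorProduct fun _ : Fin m => b).coord I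
        (toHom K V m n ρ (Finsupp.single P 1 ⊗ₜ Finsupp.single R 1)
          (PiTensorProduct.tprod K fun s => b (J s))) := rfl

theorem coeffΓ_relabel {m n : ℕ} (σ : Equiv.Perm (Fin m)) (τ : Equiv.Perm (Fin n)) (P : Corolla m)
    (R : Corolla n) (I : Fin m → ι) (J : Fin n → ι) (ρ : RepHom K V m n) :
    coeffΓ K b (relabel σ P) (relabel τ R) (I ∘ σ.symm) (J ∘ τ.symm) ρ =
      coeffΓ K b P R I J ρ := by
  -- The inputs carry a right action, whence the inverse.
  have h := toHom_permQ ρ σ τ⁻¹ (Finsupp.single P 1 ⊗ₜ Finsupp.single R 1)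
  rw [permQ_single, inv_inv] at h
  rw [coeffΓ_apply, coeffΓ_apply, h, LinearMap.comp_apply, LinearMap.comp_apply, coord_permV,
    permV_tprod]
  congr 3
  funext s
  simp [Equiv.Perm.inv_def]

variable (ι) in
/-- A pair of ordered partitions with labelled legs. -/
abbrev Labelled : Type := Σ p : ℕ × ℕ,
  (Corolla (p.1 + 1) × (Fin (p.1 + 1) → ι)) × (Corolla (p.2 + 1) × (Fin (p.2 + 1) → ι))

/-- The contents of the blocks of the two partitions. -/
def contPair (x : Labelled ι) : List (ι →₀ ℕ) × List (ι →₀ ℕ) :=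
  (cont x.2.1.1 x.2.1.2, cont x.2.2.1 x.2.2.2)

/-- The matrix coefficient of a representation at a pair of labelled ordered partitions. -/
def coeffLabelled (ρ : Rep K V) (x : Labelled ι) : K :=
  coeffΓ K b x.2.1.1 x.2.2.1 x.2.1.2 x.2.2.2 (ρ x.1)

/-- The contents determine the arity, as their total degree, and they determine the labelled
partition up to a permutation of the legs. Matrix coefficients of an equivariant map do not change
under such permutations. -/
theorem coeffLabelled_factorsThrough (ρ : Rep K V) :
    Function.FactorsThrough (coeffLabelled b ρ) contPair := by
  rintro ⟨⟨m, n⟩, ⟨P, I⟩, ⟨R, J⟩⟩ ⟨⟨m', n'⟩, ⟨P', I'⟩, ⟨R', J'⟩⟩ h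
  simp only [contPair, Prod.mk.injEq] at h
  obtain ⟨h1, h2⟩ := h
  have hm : m = m' := by
    have := congrArg wdeg h1
    rw [wdeg_cont, wdeg_cont] at this
    exact Nat.succ_injective this
  have hn : n = n' := by
    have := congrArg wdeg h2
    rw [wdeg_cont, wdeg_cont] at this
    exact Nat.succ_injective this
  subst hm hn
  obtain ⟨σ, rfl, rfl⟩ := exists_perm_of_cont_eq h1
  obtain ⟨τ, rfl, rfl⟩ := exists_perm_of_cont_eq h2
  exact (coeffΓ_relabel b σ τ P R I J (ρ (m, n))).symm

/-- The symbol of a representation: its matrix coefficients, as a function of the contents of the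
bunches of outputs and of inputs. -/
def symbol (ρ : Rep K V) (w w' : List (ι →₀ ℕ)) : K :=
  Function.extend contPair (coeffLabelled b ρ) 0 (w, w')

theorem symbol_cont (ρ : Rep K V) {p : ℕ × ℕ} (P : Corolla (p.1 + 1)) (R : Corolla (p.2 + 1))
    (I : Fin (p.1 + 1) → ι) (J : Fin (p.2 + 1) → ι) :
    symbol b ρ (cont P I) (cont R J) = coeffΓ K b P R I J (ρ p) :=
  (coeffLabelled_factorsThrough b ρ).extend_apply 0 (⟨p, ⟨P, I⟩, ⟨R, J⟩⟩ : Labelled ι)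

theorem symbol_eq_zero (ρ : Rep K V) {w w' : List (ι →₀ ℕ)}
    (h : ¬ ((w ≠ [] ∧ 0 ∉ w) ∧ (w' ≠ [] ∧ 0 ∉ w'))) : symbol b ρ w w' = 0 := by
  rw [symbol, Function.extend_apply' _ _ _ ?_]
  · rfl
  · rintro ⟨⟨⟨m, n⟩, ⟨P, I⟩, ⟨R, J⟩⟩, hx⟩
    simp only [contPair, Prod.mk.injEq] at hx
    obtain ⟨rfl, rfl⟩ := hx
    exact h ⟨⟨cont_ne_nil P I, zero_notMem_cont P I⟩, cont_ne_nil R J, zero_notMem_cont R J⟩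

theorem exists_labels {w w' : List (ι →₀ ℕ)} (h : w ≠ [] ∧ 0 ∉ w) (h' : w' ≠ [] ∧ 0 ∉ w') :
    ∃ (p : ℕ × ℕ) (P : Corolla (p.1 + 1)) (R : Corolla (p.2 + 1))
      (I : Fin (p.1 + 1) → ι) (J : Fin (p.2 + 1) → ι), cont P I = w ∧ cont R J = w' := by
  obtain ⟨m, P, I, hI⟩ := exists_cont_eq_succ h.2 h.1
  obtain ⟨n, R, J, hJ⟩ := exists_cont_eq_succ h'.2 h'.1
  exact ⟨(m, n), P, R, I, J, hI, hJ⟩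

theorem symbol_add (ρ ρ' : Rep K V) (w w' : List (ι →₀ ℕ)) :
    symbol b (ρ + ρ') w w' = symbol b ρ w w' + symbol b ρ' w w' := by
  by_cases h : (w ≠ [] ∧ 0 ∉ w) ∧ (w' ≠ [] ∧ 0 ∉ w')
  · obtain ⟨p, P, R, I, J, rfl, rfl⟩ := exists_labels h.1 h.2
    simp only [symbol_cont, DirectSum.add_apply, map_add]
  · simp only [symbol_eq_zero b _ h, add_zero]

theorem symbol_smul (c : K) (ρ : Rep K V) (w w' : List (ι →₀ ℕ)) :
    symbol b (c • ρ) w w' = c * symbol b ρ w w' := by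
  by_cases h : (w ≠ [] ∧ 0 ∉ w) ∧ (w' ≠ [] ∧ 0 ∉ w')
  · obtain ⟨p, P, R, I, J, rfl, rfl⟩ := exists_labels h.1 h.2
    simp only [symbol_cont, DirectSum.smul_apply, map_smul, smul_eq_mul]
  · simp only [symbol_eq_zero b _ h, mul_zero]

/-- The symbol as a linear map. -/
def symbolHom : Rep K V →ₗ[K] (List (ι →₀ ℕ) → List (ι →₀ ℕ) → K) where
  toFun := symbol b
  map_add' ρ ρ' := funext fun w => funext fun w' => symbol_add b ρ ρ' w w'
  map_smul' c ρ := funext fun w => funext fun w' => symbol_smul b c ρ w w'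

theorem symbol_bounded (ρ : Rep K V) : ∃ N, ∀ w w', N < wdeg w ∨ N < wdeg w' →
    symbol b ρ w w' = 0 := by
  classical
  -- An element of a direct sum has finitely many arities, and this number bounds both `p.1 + 1` and
  -- `p.2 + 1` on them.
  refine ⟨(DFinsupp.support ρ).sup (fun p => p.1 + p.2 + 1), fun w w' hN => ?_⟩
  by_cases h : (w ≠ [] ∧ 0 ∉ w) ∧ (w' ≠ [] ∧ 0 ∉ w')
  · obtain ⟨p, P, R, I, J, rfl, rfl⟩ := exists_labels h.1 h.2
    rw [symbol_cont]
    rw [wdeg_cont, wdeg_cont] at hN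
    have hp : ρ p = 0 := by
      by_contra hp
      have := Finset.le_sup (f := fun p : ℕ × ℕ => p.1 + p.2 + 1) (DFinsupp.mem_support_iff.2 hp)
      simp only at this
      omega
    rw [hp, map_zero]
  · exact symbol_eq_zero b _ h

theorem toHom_eq_zero_of_coeffΓ {m n : ℕ} (ρ : RepHom K V m n) (P : Corolla m) (R : Corolla n)
    (h : ∀ I J, coeffΓ K b P R I J ρ = 0) :
    toHom K V m n ρ (Finsupp.single P 1 ⊗ₜ Finsupp.single R 1) = 0 := by
  refine (Basis.piTensorProduct fun _ : Fin n => b).ext fun J => ?_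
  refine (Basis.piTensorProduct fun _ : Fin m => b).ext_elem fun I => ?_
  rw [Basis.piTensorProduct_apply, LinearMap.zero_apply, map_zero, Finsupp.zero_apply]
  exact h I J

theorem symbol_injective : Function.Injective (symbolHom b) := by
  rw [← LinearMap.ker_eq_bot, LinearMap.ker_eq_bot']
  intro ρ hρ
  refine DFinsupp.ext fun p => ?_
  refine Subtype.ext (TensorProduct.ext (Finsupp.lhom_ext' fun P => LinearMap.ext_ring
    (Finsupp.lhom_ext' fun R => LinearMap.ext_ring ?_)))
  refine toHom_eq_zero_of_coeffΓ b (ρ p) P R fun I J => ?_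
  rw [← symbol_cont]
  exact congrFun (congrFun hρ _) _

theorem toHom_dRepHom {m n : ℕ} (ρ : RepHom K V m n) (q : Q K m n) :
    toHom K V m n (dRepHom K V m n ρ) q = toHom K V m n ρ (dQ K q) := rfl

/-- The two terms of `dQ` become the two halves of `totD`. The Koszul sign counts the output blocks,
which are the entries of the first list. -/
theorem symbol_dRep_cont (ρ : Rep K V) {p : ℕ × ℕ} (P : Corolla (p.1 + 1)) (R : Corolla (p.2 + 1))
    (I : Fin (p.1 + 1) → ι) (J : Fin (p.2 + 1) → ι) :
    symbol b (dRep K V ρ) (cont P I) (cont R J) = totD (symbol b ρ) (cont P I) (cont R J) := by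
  let ℓ : Q K (p.1 + 1) (p.2 + 1) →ₗ[K] K := (Basis.piTensorProduct fun _ => b).coord I ∘ₗ
    LinearMap.applyₗ (PiTensorProduct.tprod K fun s => b (J s)) ∘ₗ toHom K V _ _ (ρ p)
  have hℓ : ∀ P R, ℓ (Finsupp.single P 1 ⊗ₜ Finsupp.single R 1) =
      symbol b ρ (cont P I) (cont R J) := fun P R => (symbol_cont b ρ P R I J).symm
  have h1 : ∀ y R, ℓ (y ⊗ₜ Finsupp.single R 1) =
      Finsupp.linearCombination K (fun P => symbol b ρ (cont P I) (cont R J)) y := fun y R => by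
    induction y using Finsupp.induction_linear with
    | zero => simp
    | add f g hf hg => rw [TensorProduct.add_tmul, map_add, map_add, hf, hg]
    | single P c =>
      rw [← mul_one c, ← smul_eq_mul, ← Finsupp.smul_single, ← TensorProduct.smul_tmul', map_smul,
        map_smul, hℓ]
      simp
  have h2 : ∀ P z, ℓ (Finsupp.single P 1 ⊗ₜ z) =
      Finsupp.linearCombination K (fun R => symbol b ρ (cont P I) (cont R J)) z := fun P z => by
    induction z using Finsupp.induction_linear with
    | zero => simp
    | add f g hf hg => rw [TensorProduct.tmul_add, map_add, map_add, hf, hg]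
    | single R c =>
      rw [← mul_one c, ← smul_eq_mul, ← Finsupp.smul_single, TensorProduct.tmul_smul, map_smul,
        map_smul, hℓ]
      simp
  have h3 : symbol b (dRep K V ρ) (cont P I) (cont R J) =
      ℓ (dQ K (Finsupp.single P 1 ⊗ₜ Finsupp.single R 1)) := by
    rw [symbol_cont, coeffΓ_apply]
    have : dRep K V ρ p = dRepHom K V _ _ (ρ p) := DirectSum.lmap_apply ..
    rw [this, toHom_dRepHom]
    rfl
  rw [h3]
  simp only [dQ, LinearMap.add_apply, TensorProduct.map_tmul, delta, parity, LinearMap.id_apply,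
    Finsupp.linearCombination_single, one_smul, map_add]
  rw [h1, linearCombination_deltaCorolla (fun w => symbol b ρ w (cont R J)),
    ← TensorProduct.smul_tmul', map_smul, h2,
    linearCombination_deltaCorolla (fun w => symbol b ρ (cont P I) w), totD, length_cont,
    smul_eq_mul]

theorem symbol_dRep (ρ : Rep K V) {w w' : List (ι →₀ ℕ)} (h : w ≠ [] ∧ 0 ∉ w)
    (h' : w' ≠ [] ∧ 0 ∉ w') : symbol b (dRep K V ρ) w w' = totD (symbol b ρ) w w' := by
  obtain ⟨p, P, R, I, J, rfl, rfl⟩ := exists_labels h h'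
  exact symbol_dRep_cont b ρ P R I J

/-- The value on a generator of the representation with a given symbol. -/
def ofSymbolBase (Γ : List (ι →₀ ℕ) → List (ι →₀ ℕ) → K) {m n : ℕ} (P : Corolla m) (R : Corolla n) :
    EndV K V m n :=
  (Basis.piTensorProduct fun _ : Fin n => b).constr K fun J =>
    ∑ I : Fin m → ι, Γ (cont P I) (cont R J) • PiTensorProduct.tprod K fun t => b (I t)

theorem ofSymbolBase_tprod (Γ : List (ι →₀ ℕ) → List (ι →₀ ℕ) → K) {m n : ℕ} (P : Corolla m)
    (R : Corolla n) (J : Fin n → ι) :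
    ofSymbolBase b Γ P R (PiTensorProduct.tprod K fun s => b (J s)) =
      ∑ I : Fin m → ι, Γ (cont P I) (cont R J) • PiTensorProduct.tprod K fun t => b (I t) := by
  have h := (Basis.piTensorProduct fun _ : Fin n => b).constr_basis K (fun J =>
    ∑ I : Fin m → ι, Γ (cont P I) (cont R J) • PiTensorProduct.tprod K fun t => b (I t)) J
  rwa [Basis.piTensorProduct_apply] at h

theorem ofSymbolBase_relabel (Γ : List (ι →₀ ℕ) → List (ι →₀ ℕ) → K) {m n : ℕ} (P : Corolla m)
    (R : Corolla n) (σ : Equiv.Perm (Fin m)) (τ : Equiv.Perm (Fin n)) :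
    ofSymbolBase b Γ (relabel σ P) (relabel τ⁻¹ R) =
      permV K V σ ∘ₗ ofSymbolBase b Γ P R ∘ₗ permV K V τ := by
  refine (Basis.piTensorProduct fun _ : Fin n => b).ext fun J => ?_
  rw [Basis.piTensorProduct_apply, ofSymbolBase_tprod, LinearMap.comp_apply, LinearMap.comp_apply,
    permV_tprod]
  have h := ofSymbolBase_tprod b Γ P R (J ∘ τ.symm)
  have h' : (fun i => b (J i)) ∘ τ.symm = fun s => b ((J ∘ τ.symm) s) := rfl
  rw [h', h, map_sum]
  refine Fintype.sum_equiv (Equiv.arrowCongr σ.symm (Equiv.refl ι)) _ _ fun I => ?_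
  rw [map_smul, permV_tprod, cont_relabel, cont_relabel]
  congr 2
  funext t
  simp

/-- The representation with a given symbol, in a fixed arity. -/
def ofSymbolHom (Γ : List (ι →₀ ℕ) → List (ι →₀ ℕ) → K) (m n : ℕ) : RepHom K V m n :=
  show HomS K V m n from
  ⟨TensorProduct.lift (Finsupp.linearCombination K fun P =>
    Finsupp.linearCombination K fun R => ofSymbolBase b Γ P R), fun σ τ q => by
    have h : ∀ q, TensorProduct.lift (Finsupp.linearCombination K fun P =>
        Finsupp.linearCombination K fun R => ofSymbolBase b Γ P R) (permQ K σ τ q) =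
        (LinearMap.llcomp K _ _ _ (permV K V σ) ∘ₗ LinearMap.lcomp K _ (permV K V τ) ∘ₗ
          TensorProduct.lift (Finsupp.linearCombination K fun P =>
          Finsupp.linearCombination K fun R => ofSymbolBase b Γ P R)) q := by
      intro q
      rw [← LinearMap.comp_apply]
      refine LinearMap.congr_fun (TensorProduct.ext (Finsupp.lhom_ext' fun P => LinearMap.ext_ring
        (Finsupp.lhom_ext' fun R => LinearMap.ext_ring ?_))) q
      have := ofSymbolBase_relabel b Γ P R σ τ
      simp only [LinearMap.compr₂ₛₗ_apply, LinearMap.comp_apply, TensorProduct.mk_apply,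
        Finsupp.lsingle_apply, permQ_single, TensorProduct.lift.tmul,
        Finsupp.linearCombination_single, one_smul, this]
      rfl
    exact h q⟩

theorem coeffΓ_ofSymbolHom (Γ : List (ι →₀ ℕ) → List (ι →₀ ℕ) → K) {m n : ℕ} (P : Corolla m)
    (R : Corolla n) (I : Fin m → ι) (J : Fin n → ι) :
    coeffΓ K b P R I J (ofSymbolHom b Γ m n) = Γ (cont P I) (cont R J) := by
  have h : toHom K V m n (ofSymbolHom b Γ m n) (Finsupp.single P 1 ⊗ₜ Finsupp.single R 1) =
      ofSymbolBase b Γ P R := by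
    change TensorProduct.lift _ _ = _
    simp [TensorProduct.lift.tmul]
  rw [coeffΓ_apply, h, ofSymbolBase_tprod, map_sum, Finset.sum_eq_single I]
  · rw [map_smul, ← Basis.piTensorProduct_apply (fun _ => b) I, Module.Basis.coord_apply,
      Module.Basis.repr_self, Finsupp.single_eq_same, smul_eq_mul, mul_one]
  · intro I' _ hI
    rw [map_smul, ← Basis.piTensorProduct_apply (fun _ => b) I', Module.Basis.coord_apply,
      Module.Basis.repr_self, Finsupp.single_eq_of_ne hI.symm, smul_zero]
  · simp

/-- Coefficients prescribed through contents are automatically equivariant, and the degree bound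
leaves finitely many arities, as a direct sum requires. -/
theorem exists_symbol_eq (Γ : List (ι →₀ ℕ) → List (ι →₀ ℕ) → K)
    (hΓ : ∀ w w', ¬ ((w ≠ [] ∧ 0 ∉ w) ∧ (w' ≠ [] ∧ 0 ∉ w')) → Γ w w' = 0)
    {N : ℕ} (hN : ∀ w w', N < wdeg w ∨ N < wdeg w' → Γ w w' = 0) :
    ∃ ρ : Rep K V, symbol b ρ = Γ := by
  classical
  let s : Finset (ℕ × ℕ) := Finset.range N ×ˢ Finset.range N
  refine ⟨DirectSum.mk _ s fun p => ofSymbolHom b Γ (p.1.1 + 1) (p.1.2 + 1), ?_⟩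
  funext w w'
  by_cases h : (w ≠ [] ∧ 0 ∉ w) ∧ (w' ≠ [] ∧ 0 ∉ w')
  · obtain ⟨p, P, R, I, J, rfl, rfl⟩ := exists_labels h.1 h.2
    rw [symbol_cont]
    by_cases hp : p ∈ s
    · rw [DirectSum.mk_apply_of_mem hp, coeffΓ_ofSymbolHom]
    · rw [DirectSum.mk_apply_of_notMem hp, map_zero, hN]
      rw [wdeg_cont, wdeg_cont]
      simp only [s, Finset.mem_product, Finset.mem_range, not_and_or] at hp
      omega
  · rw [symbol_eq_zero b _ h, hΓ _ _ h]

theorem mem_RepDeg_iff (r : ℕ) (ρ : Rep K V) : ρ ∈ RepDeg K V r ↔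
    ∀ w w', w.length + w'.length ≠ r + 2 → symbol b ρ w w' = 0 := by
  constructor
  · intro h w w' hr
    by_cases hw : (w ≠ [] ∧ 0 ∉ w) ∧ (w' ≠ [] ∧ 0 ∉ w')
    · obtain ⟨p, P, R, I, J, rfl, rfl⟩ := exists_labels hw.1 hw.2
      rw [length_cont, length_cont] at hr
      rw [symbol_cont, coeffΓ_apply, h p P R hr]
      simp
    · exact symbol_eq_zero b _ hw
  · intro h p P R hr
    refine toHom_eq_zero_of_coeffΓ b (ρ p) P R fun I J => ?_
    rw [← symbol_cont]
    exact h _ _ (by rwa [length_cont, length_cont])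

end Symbol

/-! ### The structure maps of tensor powers as algebra homomorphisms. -/

section TensorPowers

variable {K : Type*} [Field K] {A : Type*} [CommRing A] [Bialgebra K A]

theorem glue_tprod {n : ℕ} {B : Type*} [CommRing B] [Algebra K B] (g : Fin n → A →ₗ[K] B)
    (f : Fin n → A) : glue g (PiTensorProduct.tprod K f) = ∏ i, g i (f i) := by
  simp [glue]

theorem at'_apply {n : ℕ} (i : Fin n) (f : A) :
    at' K A i f = PiTensorProduct.tprod K (Pi.mulSingle i f) := rfl

/-- `f ↦ 1 ⊗ … ⊗ f ⊗ … ⊗ 1` as a homomorphism of algebras. -/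
def atAlg (K A : Type*) [Field K] [CommRing A] [Bialgebra K A] {n : ℕ} (i : Fin n) :
    A →ₐ[K] TPow K A n := PiTensorProduct.singleAlgHom (R := K) (A := fun _ : Fin n => A) i

theorem atAlg_apply {n : ℕ} (i : Fin n) (f : A) : atAlg K A i f = at' K A i f := rfl

theorem tprod_eq_prod_at' {n : ℕ} (f : Fin n → A) :
    PiTensorProduct.tprod K f = ∏ i, at' K A i (f i) := by
  simp only [at'_apply, ← PiTensorProduct.tprod_prod]
  congr 1
  exact (Finset.univ_prod_mulSingle f).symm

/-- `glue` for homomorphisms of algebras. -/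
def glueAlg {n : ℕ} {B : Type*} [CommRing B] [Algebra K B] (g : Fin n → A →ₐ[K] B) :
    TPow K A n →ₐ[K] B :=
  PiTensorProduct.liftAlgHom
    ((MultilinearMap.mkPiAlgebra K (Fin n) B).compLinearMap fun i => (g i).toLinearMap)
    (by simp) (by simp [Finset.prod_mul_distrib])

theorem glueAlg_apply {n : ℕ} {B : Type*} [CommRing B] [Algebra K B] (g : Fin n → A →ₐ[K] B)
    (x : TPow K A n) : glueAlg g x = glue (fun i => (g i).toLinearMap) x := rfl

theorem glueAlg_tprod {n : ℕ} {B : Type*} [CommRing B] [Algebra K B] (g : Fin n → A →ₐ[K] B)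
    (f : Fin n → A) : glueAlg g (PiTensorProduct.tprod K f) = ∏ i, g i (f i) :=
  glue_tprod _ f

theorem glueAlg_at' {n : ℕ} {B : Type*} [CommRing B] [Algebra K B] (g : Fin n → A →ₐ[K] B)
    (i : Fin n) (f : A) : glueAlg g (at' K A i f) = g i f := by
  rw [at'_apply, glueAlg_tprod, Finset.prod_eq_single i]
  · simp
  · intro j _ hj
    simp [Pi.mulSingle_eq_of_ne hj]
  · simp

theorem tpow_algHom_ext {n : ℕ} {B : Type*} [CommRing B] [Algebra K B] {f g : TPow K A n →ₐ[K] B}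
    (h : ∀ i a, f (at' K A i a) = g (at' K A i a)) : f = g :=
  PiTensorProduct.algHom_ext fun i => AlgHom.ext fun a => h i a

/-- `mulAt` as a homomorphism of algebras. -/
def mulAtAlg (K A : Type*) [Field K] [CommRing A] [Bialgebra K A] {n : ℕ} (i : Fin n) :
    TPow K A (n + 1) →ₐ[K] TPow K A n :=
  glueAlg fun j => atAlg K A (i.predAbove j)

theorem mulAtAlg_apply {n : ℕ} (i : Fin n) (x : TPow K A (n + 1)) :
    mulAtAlg K A i x = mulAt K A i x := rfl

/-- The comultiplication followed by the inclusions in two tensor factors. -/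
def comulPairAlg (K A : Type*) [Field K] [CommRing A] [Bialgebra K A] {n : ℕ} (i j : Fin n) :
    A →ₐ[K] TPow K A n :=
  (Algebra.TensorProduct.lmul' K).comp
    ((Algebra.TensorProduct.map (atAlg K A i) (atAlg K A j)).comp (Bialgebra.comulAlgHom K A))

/-- `comulAt` as a homomorphism of algebras. -/
def comulAtAlg (K A : Type*) [Field K] [CommRing A] [Bialgebra K A] {n : ℕ} (i : Fin n) :
    TPow K A n →ₐ[K] TPow K A (n + 1) :=
  glueAlg fun j =>
    if j < i then atAlg K A j.castSucc
    else if i < j then atAlg K A j.succ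
    else comulPairAlg K A j.castSucc j.succ

theorem comulAtAlg_apply {n : ℕ} (i : Fin n) (x : TPow K A n) :
    comulAtAlg K A i x = comulAt K A i x := by
  rw [comulAtAlg, comulAt, glueAlg_apply]
  congr 2
  funext j
  split_ifs <;> rfl

/-- The factor `i` is split into the positions `i` and `i + 1`; every other factor skips the new
position `i.succ`. -/
theorem comulAtAlg_at' {n : ℕ} (i j : Fin n) (a : A) : comulAtAlg K A i (at' K A j a) =
    if j = i then comulPairAlg K A i.castSucc i.succ a else at' K A (i.succ.succAbove j) a := by
  rw [comulAtAlg, glueAlg_at']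
  rcases lt_trichotomy j i with h | h | h
  · rw [if_pos h, if_neg h.ne, Fin.succAbove_of_castSucc_lt _ _ (by
      simp only [Fin.lt_def, Fin.val_castSucc, Fin.val_succ] at *; omega)]
    rfl
  · subst h
    simp
  · rw [if_neg h.not_gt, if_pos h, if_neg h.ne', Fin.succAbove_of_le_castSucc _ _ (by
      simp only [Fin.lt_def, Fin.le_def, Fin.val_castSucc, Fin.val_succ] at *; omega)]
    rfl

/-- `iterComul` as a homomorphism of algebras. -/
def iterComulAlg (K A : Type*) [Field K] [CommRing A] [Bialgebra K A] : (n : ℕ) →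
    A →ₐ[K] TPow K A (n + 1)
  | 0 => atAlg K A 0
  | n + 1 => (comulAtAlg K A 0).comp (iterComulAlg K A n)

theorem iterComulAlg_apply (n : ℕ) (x : A) : iterComulAlg K A n x = iterComul K A n x := by
  induction n with
  | zero => rfl
  | succ n ih => rw [iterComulAlg, AlgHom.comp_apply, ih, comulAtAlg_apply]; rfl

theorem headTail_tprod {n : ℕ} (f : Fin (n + 1) → A) : headTail K A n (PiTensorProduct.tprod K f) =
    f 0 ⊗ₜ PiTensorProduct.tprod K (Fin.tail f) := by
  rw [headTail, glue_tprod, Fin.prod_univ_succ]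
  have h : (∏ i : Fin n, (Fin.cons (α := fun _ => A →ₗ[K] A ⊗[K] TPow K A n)
      (Algebra.TensorProduct.includeLeft (R := K) (S := K)).toLinearMap
      (fun j : Fin n => (Algebra.TensorProduct.includeRight (R := K)).toLinearMap ∘ₗ at' K A j)
      i.succ) (f i.succ) : A ⊗[K] TPow K A n) =
      Algebra.TensorProduct.includeRight (R := K) (PiTensorProduct.tprod K (Fin.tail f)) := by
    rw [tprod_eq_prod_at', map_prod]
    rfl
  rw [h]
  simp

theorem initLast_tprod {n : ℕ} (f : Fin (n + 1) → A) : initLast K A n (PiTensorProduct.tprod K f) =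
    PiTensorProduct.tprod K (Fin.init f) ⊗ₜ f (Fin.last n) := by
  rw [initLast, glue_tprod, Fin.prod_univ_castSucc]
  have h : (∏ i : Fin n, (Fin.snoc (α := fun _ => A →ₗ[K] TPow K A n ⊗[K] A)
      (fun j : Fin n => (Algebra.TensorProduct.includeLeft (R := K) (S := K)).toLinearMap ∘ₗ
        at' K A j) (Algebra.TensorProduct.includeRight (R := K)).toLinearMap i.castSucc)
      (f i.castSucc) : TPow K A n ⊗[K] A) =
      Algebra.TensorProduct.includeLeft (R := K) (S := K)
        (PiTensorProduct.tprod K (Fin.init f)) := by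
    rw [tprod_eq_prod_at', map_prod]
    refine Finset.prod_congr rfl fun i _ => ?_
    rw [Fin.snoc_castSucc]
    rfl
  rw [h, Fin.snoc_last]
  simp

/-- Insertion of a unit in front. -/
def unitFront (K A : Type*) [Field K] [CommRing A] [Bialgebra K A] (n : ℕ) :
    TPow K A n →ₐ[K] TPow K A (n + 1) := glueAlg fun j => atAlg K A j.succ

/-- Insertion of a unit at the end. -/
def unitBack (K A : Type*) [Field K] [CommRing A] [Bialgebra K A] (n : ℕ) :
    TPow K A n →ₐ[K] TPow K A (n + 1) := glueAlg fun j => atAlg K A j.castSucc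

theorem consMap_tmul {n : ℕ} (a : A) (x : TPow K A n) :
    consMap K A n (a ⊗ₜ x) = at' K A 0 a * unitFront K A n x := rfl

theorem snocMap_tmul {n : ℕ} (x : TPow K A n) (a : A) :
    snocMap K A n (x ⊗ₜ a) = unitBack K A n x * at' K A (Fin.last n) a := rfl

/-- `coactLeft` as a homomorphism of algebras. -/
def coactLeftAlg (K A : Type*) [Field K] [CommRing A] [Bialgebra K A] (n : ℕ) :
    TPow K A n →ₐ[K] A ⊗[K] TPow K A n :=
  glueAlg fun i => (Algebra.TensorProduct.map (AlgHom.id K A) (atAlg K A i)).comp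
    (Bialgebra.comulAlgHom K A)

/-- `coactRight` as a homomorphism of algebras. -/
def coactRightAlg (K A : Type*) [Field K] [CommRing A] [Bialgebra K A] (n : ℕ) :
    TPow K A n →ₐ[K] TPow K A n ⊗[K] A :=
  glueAlg fun i => (Algebra.TensorProduct.map (atAlg K A i) (AlgHom.id K A)).comp
    (Bialgebra.comulAlgHom K A)

end TensorPowers

/-! ### Linear functions as primitive generators. -/

section SymmetricComul

variable {K : Type*} [Field K] {V : Type*} [AddCommGroup V] [Module K V]
variable {A : Type*} [CommRing A] [Bialgebra K A] (e : O K V ≃ₐc[K] A)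

/-- The linear functions inside a bialgebra identified with the polynomial functions. -/
def gen : Module.Dual K V →ₗ[K] A :=
  (e : O K V →ₐ[K] A).toLinearMap ∘ₗ SymmetricAlgebra.ι K (Module.Dual K V)

/-- The homomorphism of algebras with given values on the linear functions. -/
def liftGen {B : Type*} [CommRing B] [Algebra K B] (f : Module.Dual K V →ₗ[K] B) : A →ₐ[K] B :=
  (SymmetricAlgebra.lift f).comp ((e : O K V ≃ₐ[K] A).symm : A →ₐ[K] O K V)

theorem liftGen_gen {B : Type*} [CommRing B] [Algebra K B] (f : Module.Dual K V →ₗ[K] B)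
    (ξ : Module.Dual K V) : liftGen e f (gen e ξ) = f ξ := by
  have h : (e : O K V ≃ₐ[K] A).symm (gen e ξ) = SymmetricAlgebra.ι K (Module.Dual K V) ξ :=
    (e : O K V ≃ₐ[K] A).symm_apply_apply _
  rw [liftGen, AlgHom.comp_apply]
  exact (congrArg _ h).trans (SymmetricAlgebra.lift_ι_apply _ ξ)

variable {e} in
-- The linear functions generate the algebra. The identities between jets and structure maps below
-- are verified on them only.
theorem algHom_ext_gen {B : Type*} [CommRing B] [Algebra K B] {f g : A →ₐ[K] B}
    (h : ∀ ξ, f (gen e ξ) = g (gen e ξ)) : f = g := by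
  have h' : f.comp (e : O K V →ₐ[K] A) = g.comp (e : O K V →ₐ[K] A) :=
    SymmetricAlgebra.algHom_ext (LinearMap.ext fun ξ => h ξ)
  refine AlgHom.ext fun a => ?_
  obtain ⟨x, rfl⟩ := e.surjective a
  exact AlgHom.congr_fun h' x

theorem gen_induction {P : A → Prop} (halg : ∀ r, P (algebraMap K A r)) (hgen : ∀ ξ, P (gen e ξ))
    (hadd : ∀ f g, P f → P g → P (f + g)) (hmul : ∀ f g, P f → P g → P (f * g)) (f : A) : P f := by
  have h : ∀ x : O K V, P (e x) := fun x => by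
    induction x using SymmetricAlgebra.induction with
    | algebraMap r => exact (congrArg P ((e : O K V →ₐ[K] A).commutes r)).mpr (halg r)
    | ι ξ => exact hgen ξ
    | add x y hx hy =>
      exact (congrArg P (map_add (e : O K V →ₐ[K] A) x y)).mpr (hadd _ _ hx hy)
    | mul x y hx hy =>
      exact (congrArg P (map_mul (e : O K V →ₐ[K] A) x y)).mpr (hmul _ _ hx hy)
  obtain ⟨x, hx⟩ := e.surjective f
  exact (congrArg P hx).mp (h x)

theorem comul_gen (ξ : Module.Dual K V) :
    Coalgebra.comul (R := K) (gen e ξ) = gen e ξ ⊗ₜ 1 + 1 ⊗ₜ gen e ξ := by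
  have h := CoalgHomClass.map_comp_comul_apply e (SymmetricAlgebra.ι K (Module.Dual K V) ξ)
  rw [SymmetricAlgebra.comul_ι, map_add, TensorProduct.map_tmul, TensorProduct.map_tmul] at h
  have h1 : e 1 = 1 := map_one (e : O K V →ₐ[K] A)
  exact h.symm.trans (congrArg₂ (· + ·) (congrArg _ h1) (congrArg (· ⊗ₜ[K] gen e ξ) h1))

theorem counit_gen (ξ : Module.Dual K V) : Coalgebra.counit (R := K) (gen e ξ) = 0 :=
  (CoalgHomClass.counit_comp_apply e _).trans (by simp)

theorem comulPairAlg_gen {n : ℕ} (i j : Fin n) (ξ : Module.Dual K V) :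
    comulPairAlg K A i j (gen e ξ) = at' K A i (gen e ξ) + at' K A j (gen e ξ) := by
  simp [comulPairAlg, comul_gen, ← atAlg_apply]

/-- A linear function is primitive, so splitting a factor of the sum of all its copies replaces one
summand by two. This gives the iterated comultiplication of a linear function as the sum of its
copies. -/
theorem comulAtAlg_sum {n : ℕ} (i : Fin n) (ξ : Module.Dual K V) :
    comulAtAlg K A i (∑ j, at' K A j (gen e ξ)) = ∑ j, at' K A j (gen e ξ) := by
  rw [map_sum, Fin.sum_univ_succAbove _ i.succ]
  simp only [comulAtAlg_at']
  rw [← Finset.add_sum_erase _ _ (Finset.mem_univ i), if_pos rfl, comulPairAlg_gen,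
    ← Finset.add_sum_erase (a := i) Finset.univ
      (fun j => at' K A (i.succ.succAbove j) (gen e ξ)) (Finset.mem_univ i)]
  have h : i.succ.succAbove i = i.castSucc := by simp
  rw [h, ← add_assoc, add_comm (at' K A i.succ _)]
  congr 1
  refine Finset.sum_congr rfl fun j hj => ?_
  rw [if_neg (Finset.ne_of_mem_erase hj)]

theorem iterComulAlg_gen (n : ℕ) (ξ : Module.Dual K V) :
    iterComulAlg K A n (gen e ξ) = ∑ j, at' K A j (gen e ξ) := by
  induction n with
  | zero => simp [iterComulAlg, atAlg_apply]
  | succ n ih => rw [iterComulAlg, AlgHom.comp_apply, ih, comulAtAlg_sum]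

end SymmetricComul

/-! ### The outer terms of the first differential on pure tensors. -/

section Differentials

variable {K : Type*} [Field K] {A : Type*} [CommRing A] [Bialgebra K A]

theorem d1_apply {m n : ℕ} (Φ : TPow K A m →ₗ[K] TPow K A (n + 1)) : d1 K A m n Φ =
    -(LinearMap.mul' K _ ∘ₗ TensorProduct.map (iterComul K A n) Φ ∘ₗ headTail K A m)
    + ∑ i : Fin m, (-1 : K) ^ (i : ℕ) • (Φ ∘ₗ mulAt K A i)
    + (-1 : K) ^ m •
      (LinearMap.mul' K _ ∘ₗ TensorProduct.map Φ (iterComul K A n) ∘ₗ initLast K A m) := rfl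

theorem d2_apply {m n : ℕ} (Φ : TPow K A m →ₗ[K] TPow K A n) : d2 K A m n Φ =
    -(consMap K A n ∘ₗ TensorProduct.map LinearMap.id Φ ∘ₗ coactLeft K A m)
    + ∑ i : Fin n, (-1 : K) ^ (i : ℕ) • (comulAt K A i ∘ₗ Φ)
    + (-1 : K) ^ n • (snocMap K A n ∘ₗ TensorProduct.map Φ LinearMap.id ∘ₗ coactRight K A m) :=
  rfl

theorem mul_map_headTail_tprod {m n : ℕ} (c : A →ₐ[K] TPow K A (n + 1))
    (Φ : TPow K A m →ₗ[K] TPow K A (n + 1)) (f : Fin (m + 1) → A) :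
    (LinearMap.mul' K _ ∘ₗ TensorProduct.map c.toLinearMap Φ ∘ₗ headTail K A m)
      (PiTensorProduct.tprod K f) =
      c (f 0) * Φ (PiTensorProduct.tprod K fun j => f ((0 : Fin (m + 1)).succAbove j)) := by
  simp only [LinearMap.comp_apply, headTail_tprod, TensorProduct.map_tmul, LinearMap.mul'_apply,
    Fin.succAbove_zero]
  rfl

theorem mul_map_initLast_tprod {m n : ℕ} (c : A →ₐ[K] TPow K A (n + 1))
    (Φ : TPow K A m →ₗ[K] TPow K A (n + 1)) (f : Fin (m + 1) → A) :
    (LinearMap.mul' K _ ∘ₗ TensorProduct.map Φ c.toLinearMap ∘ₗ initLast K A m)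
      (PiTensorProduct.tprod K f) =
      c (f (Fin.last m)) * Φ (PiTensorProduct.tprod K fun j => f ((Fin.last m).succAbove j)) := by
  simp only [LinearMap.comp_apply, initLast_tprod, TensorProduct.map_tmul, LinearMap.mul'_apply,
    Fin.succAbove_last]
  exact mul_comm _ _

theorem iterComulAlg_toLinearMap (n : ℕ) : (iterComulAlg K A n).toLinearMap = iterComul K A n :=
  LinearMap.ext fun x => iterComulAlg_apply n x

end Differentials

/-! ### Operators as pairings with jets; the first differential on coefficients. -/

section Jets

variable {K : Type*} [Field K] {V : Type*} [AddCommGroup V] [Module K V]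
variable {A : Type*} [CommRing A] [Bialgebra K A] (e : O K V ≃ₐc[K] A)
variable {ι : Type} [Fintype ι] [DecidableEq ι] (b : Module.Basis ι K V)
variable {B : Type*} [CommRing B] [Algebra K B]

/-- The Taylor expansion of a polynomial function in the variables number `j`, with coefficients
mapped to `B`. -/
def taylorAt (c : A →ₐ[K] B) {m : ℕ} (j : Fin m) :
    A →ₐ[K] AddMonoidAlgebra B (Fin m → (ι →₀ ℕ)) :=
  liftGen e
    { toFun := fun ξ => AddMonoidAlgebra.single 0 (c (gen e ξ)) +
        ∑ α, AddMonoidAlgebra.single (Pi.single j (Finsupp.single α 1)) (algebraMap K B (ξ (b α)))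
      map_add' := fun ξ η => by
        simp only [map_add, AddMonoidAlgebra.single_add, LinearMap.add_apply,
          Finset.sum_add_distrib]
        abel
      map_smul' := fun r ξ => by
        simp only [map_smul, smul_add, Finset.smul_sum, AddMonoidAlgebra.smul_single,
          LinearMap.smul_apply, smul_eq_mul, map_mul, RingHom.id_apply]
        simp only [Algebra.smul_def] }

theorem taylorAt_gen (c : A →ₐ[K] B) {m : ℕ} (j : Fin m) (ξ : Module.Dual K V) :
    taylorAt e b c j (gen e ξ) = AddMonoidAlgebra.single 0 (c (gen e ξ)) +
        ∑ α, AddMonoidAlgebra.single (Pi.single j (Finsupp.single α 1))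
          (algebraMap K B (ξ (b α))) :=
  liftGen_gen e _ ξ

/-- The product of the Taylor expansions of `m` polynomial functions. -/
def jet (c : A →ₐ[K] B) (m : ℕ) :
    TPow K A m →ₐ[K] AddMonoidAlgebra B (Fin m → (ι →₀ ℕ)) :=
  glueAlg (taylorAt e b c)

theorem jet_at' (c : A →ₐ[K] B) {m : ℕ} (j : Fin m) (f : A) :
    jet e b c m (at' K A j f) = taylorAt e b c j f := glueAlg_at' _ j f

theorem jet_tprod (c : A →ₐ[K] B) {m : ℕ} (f : Fin m → A) :
    jet e b c m (PiTensorProduct.tprod K f) = ∏ j, taylorAt e b c j (f j) := glueAlg_tprod _ f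

variable {e} in
theorem tpow_algHom_ext_gen {n : ℕ} {f g : TPow K A n →ₐ[K] B}
    (h : ∀ i ξ, f (at' K A i (gen e ξ)) = g (at' K A i (gen e ξ))) : f = g :=
  tpow_algHom_ext fun i a => by
    have : f.comp (atAlg K A i) = g.comp (atAlg K A i) := algHom_ext_gen fun ξ => h i ξ
    exact AlgHom.congr_fun this a

/-- The pairing of a family of coefficients with a jet. -/
def jetPairing {X : Type*} (γ : X → B) : AddMonoidAlgebra B X →ₗ[K] B :=
  Finsupp.lsum K (fun s => LinearMap.mulLeft K (γ s)) ∘ₗ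
    (AddMonoidAlgebra.coeffLinearEquiv K).toLinearMap

theorem jetPairing_single {X : Type*} (γ : X → B) (s : X) (a : B) :
    jetPairing (K := K) γ (AddMonoidAlgebra.single s a) = γ s * a := by
  simp [jetPairing, AddMonoidAlgebra.coeffLinearEquiv]

theorem linearMap_ext_single {X N : Type*} [AddCommGroup N] [Module K N]
    {f g : AddMonoidAlgebra B X →ₗ[K] N}
    (h : ∀ s a, f (AddMonoidAlgebra.single s a) = g (AddMonoidAlgebra.single s a)) : f = g :=
  AddMonoidAlgebra.lhom_ext' fun s => LinearMap.ext fun a => h s a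

/-- The differential operators with a given family of coefficients. -/
def jetOp (c : A →ₐ[K] B) (m : ℕ) :
    ((Fin m → (ι →₀ ℕ)) → B) →ₗ[K] (TPow K A m →ₗ[K] B) where
  toFun γ := jetPairing γ ∘ₗ (jet e b c m).toLinearMap
  map_add' γ γ' := by
    rw [← LinearMap.add_comp]
    congr 1
    exact linearMap_ext_single fun s a => by
      simp [jetPairing_single, add_mul]
  map_smul' r γ := by
    rw [RingHom.id_apply, ← LinearMap.smul_comp]
    congr 1
    exact linearMap_ext_single fun s a => by
      simp [jetPairing_single]

theorem jetOp_apply (c : A →ₐ[K] B) (m : ℕ) (γ : (Fin m → (ι →₀ ℕ)) → B)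
    (x : TPow K A m) : jetOp e b c m γ x = jetPairing (K := K) γ (jet e b c m x) := rfl

/-- In a product `f_i f_{i+1}` both factors are expanded with the same increments, so the jet of the
product arises by identifying the increments number `i` and `i + 1`. This is the Leibniz rule, free
of binomial coefficients because Taylor coefficients are divided derivatives. -/
theorem jet_mulAtAlg (c : A →ₐ[K] B) {m : ℕ} (i : Fin m) (x : TPow K A (m + 1)) :
    jet e b c m (mulAtAlg K A i x) =
      AddMonoidAlgebra.mapDomainAlgHom K B (push i.predAbove) (jet e b c (m + 1) x) := by
  have h : (jet e b c m).comp (mulAtAlg K A i) =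
      (AddMonoidAlgebra.mapDomainAlgHom K B (push i.predAbove)).comp (jet e b c (m + 1)) := by
    refine tpow_algHom_ext_gen (e := e) fun j ξ => ?_
    rw [AlgHom.comp_apply, AlgHom.comp_apply, mulAtAlg, glueAlg_at', atAlg_apply, jet_at', jet_at',
      taylorAt_gen, taylorAt_gen, map_add, map_sum]
    simp [push_single]
  exact AlgHom.congr_fun h x

theorem jetOp_mulAt (c : A →ₐ[K] B) {m : ℕ} (i : Fin m) (γ : (Fin m → (ι →₀ ℕ)) → B) :
    jetOp e b c m γ ∘ₗ mulAt K A i = jetOp e b c (m + 1) fun s => γ (push i.predAbove s) := by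
  have h : jetPairing (K := K) γ ∘ₗ
      (AddMonoidAlgebra.mapDomainAlgHom K B (push i.predAbove)).toLinearMap =
      jetPairing (K := K) fun s => γ (push i.predAbove s) :=
    linearMap_ext_single fun s a => by simp [jetPairing_single]
  refine LinearMap.ext fun x => ?_
  rw [LinearMap.comp_apply, jetOp_apply, ← mulAtAlg_apply, jet_mulAtAlg, jetOp_apply, ← h]
  rfl

/-- Setting the variables number `p` to zero. -/
def killAt {m : ℕ} (p : Fin (m + 1)) :
    AddMonoidAlgebra B (Fin (m + 1) → (ι →₀ ℕ)) →ₐ[B] AddMonoidAlgebra B (Fin m → (ι →₀ ℕ)) :=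
  AddMonoidAlgebra.lift B _ _
    { toFun := fun s => if s.toAdd p = 0 then
        AddMonoidAlgebra.single (fun j => s.toAdd (p.succAbove j)) 1 else 0
      map_one' := by
        exact (if_pos (by simp)).trans rfl
      map_mul' := fun s t => by
        by_cases hs : s.toAdd p = 0 <;> by_cases ht : t.toAdd p = 0 <;>
          simp [hs, ht, AddMonoidAlgebra.single_mul_single]
        rfl }

theorem killAt_single {m : ℕ} (p : Fin (m + 1)) (s : Fin (m + 1) → (ι →₀ ℕ)) (a : B) :
    killAt p (AddMonoidAlgebra.single s a) =
      if s p = 0 then AddMonoidAlgebra.single (fun j => s (p.succAbove j)) a else 0 := by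
  rw [killAt, AddMonoidAlgebra.lift_single]
  by_cases h : s p = 0 <;> simp [h]

/-- The coefficients of the operator obtained by adding one argument which is not differentiated. -/
def insertCoeff {m : ℕ} (p : Fin (m + 1)) (γ : (Fin m → (ι →₀ ℕ)) → B)
    (s : Fin (m + 1) → (ι →₀ ℕ)) : B :=
  if s p = 0 then γ fun j => s (p.succAbove j) else 0

theorem killAt_taylorAt_self (c : A →ₐ[K] B) {m : ℕ} (p : Fin (m + 1)) (f : A) :
    killAt p (taylorAt e b c p f) = AddMonoidAlgebra.single 0 (c f) := by
  have h : ((killAt p).restrictScalars K).comp (taylorAt e b c p) =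
      (AddMonoidAlgebra.singleZeroAlgHom (M := Fin m → (ι →₀ ℕ))).comp c := by
    refine algHom_ext_gen (e := e) fun ξ => ?_
    change killAt p (taylorAt e b c p (gen e ξ)) = AddMonoidAlgebra.single 0 (c (gen e ξ))
    rw [taylorAt_gen, map_add, map_sum]
    simp only [killAt_single]
    simp
    rfl
  exact AlgHom.congr_fun h f

theorem killAt_taylorAt_succAbove (c : A →ₐ[K] B) {m : ℕ} (p : Fin (m + 1)) (j : Fin m)
    (f : A) : killAt p (taylorAt e b c (p.succAbove j) f) = taylorAt e b c j f := by
  have h : ((killAt p).restrictScalars K).comp (taylorAt e b c (p.succAbove j)) =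
      taylorAt e b c j := by
    refine algHom_ext_gen (e := e) fun ξ => ?_
    change killAt p (taylorAt e b c (p.succAbove j) (gen e ξ)) = taylorAt e b c j (gen e ξ)
    rw [taylorAt_gen, taylorAt_gen, map_add, map_sum]
    simp only [killAt_single]
    have h1 : ∀ α : ι, (fun i => (Pi.single (p.succAbove j) (Finsupp.single α 1) :
        Fin (m + 1) → (ι →₀ ℕ)) (p.succAbove i)) = Pi.single j (Finsupp.single α 1) := fun α => by
      funext i
      by_cases hi : i = j
      · subst hi; simp
      · rw [Pi.single_eq_of_ne hi, Pi.single_eq_of_ne fun h => hi (Fin.succAbove_right_injective h)]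
    have h2 : ∀ α : ι, (Pi.single (p.succAbove j) (Finsupp.single α 1) :
        Fin (m + 1) → (ι →₀ ℕ)) p = 0 := fun α =>
      Pi.single_eq_of_ne (Fin.succAbove_ne p j).symm _
    simp only [h1, h2, if_true, Pi.zero_apply]
    rfl
  exact AlgHom.congr_fun h f

/-- `insertCoeff` is the transpose of `killAt`: with the increments of the argument `p` set to zero,
its expansion reduces to `c (f p)`, which comes out as a factor. -/
theorem jetOp_insertCoeff (c : A →ₐ[K] B) {m : ℕ} (p : Fin (m + 1))
    (γ : (Fin m → (ι →₀ ℕ)) → B) (f : Fin (m + 1) → A) :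
    jetOp e b c (m + 1) (insertCoeff p γ) (PiTensorProduct.tprod K f) =
      c (f p) * jetOp e b c m γ (PiTensorProduct.tprod K fun j => f (p.succAbove j)) := by
  have h : jetPairing (K := K) (insertCoeff p γ) =
      jetPairing (K := K) γ ∘ₗ ((killAt p).restrictScalars K).toLinearMap :=
    linearMap_ext_single fun s a => by
      rw [jetPairing_single, LinearMap.comp_apply, AlgHom.toLinearMap_apply,
        AlgHom.restrictScalars_apply, killAt_single, insertCoeff]
      split_ifs <;> simp [jetPairing_single]
  have h' : ∀ (a : B) (x : AddMonoidAlgebra B (Fin m → (ι →₀ ℕ))),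
      jetPairing (K := K) γ (AddMonoidAlgebra.single 0 a * x) = a * jetPairing (K := K) γ x := by
    intro a x
    have : jetPairing (K := K) γ ∘ₗ LinearMap.mulLeft K (AddMonoidAlgebra.single 0 a) =
        LinearMap.mulLeft K a ∘ₗ jetPairing (K := K) γ :=
      linearMap_ext_single fun s a' => by
        simp [jetPairing_single, AddMonoidAlgebra.single_mul_single]
        ring
    exact LinearMap.congr_fun this x
  rw [jetOp_apply, h, LinearMap.comp_apply, AlgHom.toLinearMap_apply, AlgHom.restrictScalars_apply,
    jet_tprod, map_prod, Fin.prod_univ_succAbove _ p, killAt_taylorAt_self]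
  simp only [killAt_taylorAt_succAbove]
  rw [h', jetOp_apply, jet_tprod]

/-- The first Gerstenhaber–Schack differential on coefficients. -/
def coeffD1 {m : ℕ} (γ : (Fin m → (ι →₀ ℕ)) → B) : (Fin (m + 1) → (ι →₀ ℕ)) → B :=
  -insertCoeff 0 γ + ∑ i : Fin m, (-1 : K) ^ (i : ℕ) • (fun s => γ (push i.predAbove s)) +
    (-1 : K) ^ m • insertCoeff (Fin.last m) γ

theorem d1_jetOp {m n : ℕ} (γ : (Fin m → (ι →₀ ℕ)) → TPow K A (n + 1)) :
    d1 K A m n (jetOp e b (iterComulAlg K A n) m γ) =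
      jetOp e b (iterComulAlg K A n) (m + 1) (coeffD1 (K := K) γ) := by
  have h1 : LinearMap.mul' K _ ∘ₗ TensorProduct.map (iterComulAlg K A n).toLinearMap
      (jetOp e b (iterComulAlg K A n) m γ) ∘ₗ headTail K A m =
      jetOp e b (iterComulAlg K A n) (m + 1) (insertCoeff 0 γ) :=
    PiTensorProduct.ext (MultilinearMap.ext fun f =>
      (mul_map_headTail_tprod _ _ f).trans (jetOp_insertCoeff e b _ 0 γ f).symm)
  have h2 : LinearMap.mul' K _ ∘ₗ TensorProduct.map (jetOp e b (iterComulAlg K A n) m γ)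
      (iterComulAlg K A n).toLinearMap ∘ₗ initLast K A m =
      jetOp e b (iterComulAlg K A n) (m + 1) (insertCoeff (Fin.last m) γ) :=
    PiTensorProduct.ext (MultilinearMap.ext fun f =>
      (mul_map_initLast_tprod _ _ f).trans (jetOp_insertCoeff e b _ (Fin.last m) γ f).symm)
  rw [d1_apply, ← iterComulAlg_toLinearMap, h1, h2, coeffD1, map_add, map_add, map_neg, map_sum, map_smul]
  simp only [map_smul, jetOp_mulAt]

end Jets

/-! ### The second differential on coefficients. -/

section JetsTarget

variable {K : Type*} [Field K] {V : Type*} [AddCommGroup V] [Module K V]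
variable {A : Type*} [CommRing A] [Bialgebra K A] (e : O K V ≃ₐc[K] A)
variable {ι : Type} [Fintype ι] [DecidableEq ι] (b : Module.Basis ι K V)

/-- `Δ_i` is an algebra homomorphism, and composed with Δ^n it gives Δ^{n+1}, as one sees on
generators. So it acts on the coefficients only. -/
theorem comulAt_jetOp {m n : ℕ} (i : Fin (n + 1))
    (γ : (Fin m → (ι →₀ ℕ)) → TPow K A (n + 1)) :
    comulAt K A i ∘ₗ jetOp e b (iterComulAlg K A n) m γ =
      jetOp e b (iterComulAlg K A (n + 1)) m fun s => comulAt K A i (γ s) := by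
  have h1 : (AddMonoidAlgebra.mapAlgHom (Fin m → (ι →₀ ℕ)) (comulAtAlg K A i)).comp
      (jet e b (iterComulAlg K A n) m) = jet e b (iterComulAlg K A (n + 1)) m := by
    refine tpow_algHom_ext_gen (e := e) fun j ξ => ?_
    rw [AlgHom.comp_apply, jet_at', jet_at', taylorAt_gen, taylorAt_gen, map_add, map_sum,
      iterComulAlg_gen, iterComulAlg_gen, ← comulAtAlg_sum e i]
    simp [AddMonoidAlgebra.mapAlgHom]
  have h2 : (comulAtAlg K A i).toLinearMap ∘ₗ jetPairing (K := K) γ =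
      jetPairing (K := K) (fun s => comulAt K A i (γ s)) ∘ₗ
        (AddMonoidAlgebra.mapAlgHom (Fin m → (ι →₀ ℕ)) (comulAtAlg K A i)).toLinearMap :=
    linearMap_ext_single fun s a => by
      simp [jetPairing_single, AddMonoidAlgebra.mapAlgHom,
        ← comulAtAlg_apply]
  refine LinearMap.ext fun x => ?_
  rw [LinearMap.comp_apply, ← comulAtAlg_apply, jetOp_apply, jetOp_apply, ← h1]
  exact LinearMap.congr_fun h2 _

theorem at'_one {n : ℕ} (i : Fin n) :
    at' K A i 1 = 1 := map_one (atAlg K A i)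

/-- `consMap` with coefficients in a monoid algebra. -/
def consJet (K A X : Type*) [Field K] [CommRing A] [Bialgebra K A] [AddCommMonoid X] (n : ℕ) :
    A ⊗[K] AddMonoidAlgebra (TPow K A n) X →ₐ[K] AddMonoidAlgebra (TPow K A (n + 1)) X :=
  Algebra.TensorProduct.lift ((AddMonoidAlgebra.singleZeroAlgHom (M := X)).comp (atAlg K A 0))
    (AddMonoidAlgebra.mapAlgHom X (unitFront K A n)) fun _ _ => Commute.all _ _

theorem consJet_tmul_single {X : Type*} [AddCommMonoid X] {n : ℕ}
    (a : A) (s : X) (y : TPow K A n) : consJet K A X n (a ⊗ₜ AddMonoidAlgebra.single s y) =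
      AddMonoidAlgebra.single s (at' K A 0 a * unitFront K A n y) := by
  have h : consJet K A X n (a ⊗ₜ AddMonoidAlgebra.single s y) =
      AddMonoidAlgebra.single (0 : X) (at' K A 0 a) *
        AddMonoidAlgebra.single s (unitFront K A n y) := by
    rw [consJet, Algebra.TensorProduct.lift_tmul]
    congr 1
    simp [AddMonoidAlgebra.mapAlgHom]
  rw [h, AddMonoidAlgebra.single_mul_single, zero_add]

/-- `snocMap` with coefficients in a monoid algebra. -/
def snocJet (K A X : Type*) [Field K] [CommRing A] [Bialgebra K A] [AddCommMonoid X] (n : ℕ) :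
    AddMonoidAlgebra (TPow K A n) X ⊗[K] A →ₐ[K] AddMonoidAlgebra (TPow K A (n + 1)) X :=
  Algebra.TensorProduct.lift (AddMonoidAlgebra.mapAlgHom X (unitBack K A n))
    ((AddMonoidAlgebra.singleZeroAlgHom (M := X)).comp (atAlg K A (Fin.last n)))
    fun _ _ => Commute.all _ _

theorem snocJet_single_tmul {X : Type*} [AddCommMonoid X] {n : ℕ}
    (a : A) (s : X) (y : TPow K A n) : snocJet K A X n (AddMonoidAlgebra.single s y ⊗ₜ a) =
      AddMonoidAlgebra.single s (unitBack K A n y * at' K A (Fin.last n) a) := by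
  have h : snocJet K A X n (AddMonoidAlgebra.single s y ⊗ₜ a) =
      AddMonoidAlgebra.single s (unitBack K A n y) *
        AddMonoidAlgebra.single (0 : X) (at' K A (Fin.last n) a) := by
    rw [snocJet, Algebra.TensorProduct.lift_tmul]
    congr 1
    simp [AddMonoidAlgebra.mapAlgHom]
  rw [h, AddMonoidAlgebra.single_mul_single, add_zero]

/-- The coaction splits `x` into its copy in the new factor and its copy in the old argument. Only
the latter is expanded by `T`, and the increments have scalar coefficients, so they pass unchanged.
-/
theorem consJet_of_primitive {X : Type*} [AddCommMonoid X] {m n : ℕ}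
    (T : TPow K A m →ₐ[K] AddMonoidAlgebra (TPow K A n) X) (j : Fin m)
    {x : A} (hx : Coalgebra.comul (R := K) x = x ⊗ₜ 1 + 1 ⊗ₜ x) (u : TPow K A n) (s : ι → X)
    (r : ι → K) (hT : T (at' K A j x) = AddMonoidAlgebra.single 0 u +
      ∑ α, AddMonoidAlgebra.single (s α) (algebraMap K (TPow K A n) (r α))) :
    consJet K A X n (Algebra.TensorProduct.map (AlgHom.id K A) T
      (coactLeftAlg K A m (at' K A j x))) =
      AddMonoidAlgebra.single 0 (at' K A 0 x + unitFront K A n u) +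
      ∑ α, AddMonoidAlgebra.single (s α) (algebraMap K (TPow K A (n + 1)) (r α)) := by
  have h : coactLeftAlg K A m (at' K A j x) = x ⊗ₜ 1 + 1 ⊗ₜ at' K A j x := by
    rw [coactLeftAlg, glueAlg_at', AlgHom.comp_apply, Bialgebra.comulAlgHom_apply, hx, map_add,
      Algebra.TensorProduct.map_tmul, Algebra.TensorProduct.map_tmul, map_one, map_one]
    rfl
  rw [h, map_add, map_add, Algebra.TensorProduct.map_tmul, Algebra.TensorProduct.map_tmul, hT,
    map_one T, AddMonoidAlgebra.one_def, TensorProduct.tmul_add, map_add, TensorProduct.tmul_sum,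
    map_sum]
  simp only [consJet_tmul_single, AlgHom.id_apply, at'_one, map_one, mul_one, one_mul,
    AlgHom.commutes, AddMonoidAlgebra.single_add]
  abel

theorem snocJet_of_primitive {X : Type*} [AddCommMonoid X] {m n : ℕ}
    (T : TPow K A m →ₐ[K] AddMonoidAlgebra (TPow K A n) X) (j : Fin m)
    {x : A} (hx : Coalgebra.comul (R := K) x = x ⊗ₜ 1 + 1 ⊗ₜ x) (u : TPow K A n) (s : ι → X)
    (r : ι → K) (hT : T (at' K A j x) = AddMonoidAlgebra.single 0 u +
      ∑ α, AddMonoidAlgebra.single (s α) (algebraMap K (TPow K A n) (r α))) :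
    snocJet K A X n (Algebra.TensorProduct.map T (AlgHom.id K A)
      (coactRightAlg K A m (at' K A j x))) =
      AddMonoidAlgebra.single 0 (unitBack K A n u + at' K A (Fin.last n) x) +
      ∑ α, AddMonoidAlgebra.single (s α) (algebraMap K (TPow K A (n + 1)) (r α)) := by
  have h : coactRightAlg K A m (at' K A j x) = at' K A j x ⊗ₜ 1 + 1 ⊗ₜ x := by
    rw [coactRightAlg, glueAlg_at', AlgHom.comp_apply, Bialgebra.comulAlgHom_apply, hx, map_add,
      Algebra.TensorProduct.map_tmul, Algebra.TensorProduct.map_tmul, map_one, map_one]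
    rfl
  rw [h, map_add, map_add, Algebra.TensorProduct.map_tmul, Algebra.TensorProduct.map_tmul, hT,
    map_one T, AddMonoidAlgebra.one_def, TensorProduct.add_tmul, map_add, TensorProduct.sum_tmul,
    map_sum]
  simp only [snocJet_single_tmul, AlgHom.id_apply, at'_one, map_one, mul_one, one_mul,
    AlgHom.commutes, AddMonoidAlgebra.single_add]
  abel

theorem consMap_jetPairing {X : Type*} [AddCommMonoid X] {m n : ℕ}
    (T : TPow K A m →ₐ[K] AddMonoidAlgebra (TPow K A n) X)
    (γ : X → TPow K A n) : consMap K A n ∘ₗ TensorProduct.map LinearMap.id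
      (jetPairing (K := K) γ ∘ₗ T.toLinearMap) =
      jetPairing (K := K) (fun s => unitFront K A n (γ s)) ∘ₗ (consJet K A X n).toLinearMap ∘ₗ
        (Algebra.TensorProduct.map (AlgHom.id K A) T).toLinearMap := by
  refine TensorProduct.ext' fun a x => ?_
  have h : (consMap K A n ∘ₗ TensorProduct.mk K _ _ a) ∘ₗ jetPairing (K := K) γ =
      (jetPairing (K := K) (fun s => unitFront K A n (γ s)) ∘ₗ
        (consJet K A X n).toLinearMap) ∘ₗ TensorProduct.mk K _ _ a := by
    refine linearMap_ext_single fun s y => ?_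
    simp only [LinearMap.comp_apply, TensorProduct.mk_apply, AlgHom.toLinearMap_apply,
      jetPairing_single, consJet_tmul_single, consMap_tmul, map_mul]
    ring
  exact LinearMap.congr_fun h (T x)

theorem snocMap_jetPairing {X : Type*} [AddCommMonoid X] {m n : ℕ}
    (T : TPow K A m →ₐ[K] AddMonoidAlgebra (TPow K A n) X)
    (γ : X → TPow K A n) : snocMap K A n ∘ₗ TensorProduct.map
      (jetPairing (K := K) γ ∘ₗ T.toLinearMap) LinearMap.id =
      jetPairing (K := K) (fun s => unitBack K A n (γ s)) ∘ₗ (snocJet K A X n).toLinearMap ∘ₗ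
        (Algebra.TensorProduct.map T (AlgHom.id K A)).toLinearMap := by
  refine TensorProduct.ext' fun x a => ?_
  have h : (snocMap K A n ∘ₗ (TensorProduct.mk K _ _).flip a) ∘ₗ jetPairing (K := K) γ =
      (jetPairing (K := K) (fun s => unitBack K A n (γ s)) ∘ₗ
        (snocJet K A X n).toLinearMap) ∘ₗ (TensorProduct.mk K _ _).flip a := by
    refine linearMap_ext_single fun s y => ?_
    simp only [LinearMap.comp_apply, LinearMap.flip_apply, TensorProduct.mk_apply,
      AlgHom.toLinearMap_apply, jetPairing_single, snocJet_single_tmul, snocMap_tmul, map_mul]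
    ring
  exact LinearMap.congr_fun h (T x)

/-- The sum of the f' ⊗ Δ^n(f'') is Δ^{n+1}(f), and this remains true after expansion in increments.
Thus the left coaction only replaces the coefficient γ(s) by 1 ⊗ γ(s). -/
theorem consMap_jetOp {m n : ℕ} (γ : (Fin m → (ι →₀ ℕ)) → TPow K A (n + 1)) :
    consMap K A (n + 1) ∘ₗ TensorProduct.map LinearMap.id
      (jetOp e b (iterComulAlg K A n) m γ) ∘ₗ coactLeft K A m =
      jetOp e b (iterComulAlg K A (n + 1)) m fun s => unitFront K A (n + 1) (γ s) := by
  have h1 : ((consJet K A (Fin m → (ι →₀ ℕ)) (n + 1)).comp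
      (Algebra.TensorProduct.map (AlgHom.id K _)
      (jet e b (iterComulAlg K A n) m))).comp (coactLeftAlg K A m) =
      jet e b (iterComulAlg K A (n + 1)) m :=
    tpow_algHom_ext_gen (e := e) fun j ξ => (consJet_of_primitive _ j (comul_gen e ξ) _ _ _
      ((jet_at' e b _ j _).trans (taylorAt_gen e b _ j ξ))).trans (by
        rw [jet_at', taylorAt_gen, iterComulAlg_gen, iterComulAlg_gen, map_sum,
          Fin.sum_univ_succ fun i : Fin (n + 1 + 1) => at' K A i (gen e ξ)]
        simp only [unitFront, glueAlg_at', atAlg_apply])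
  have h2 := consMap_jetPairing (jet e b (iterComulAlg K A n) m) γ
  refine LinearMap.ext fun x => ?_
  rw [jetOp_apply, ← h1]
  exact LinearMap.congr_fun h2 (coactLeft K A m x)

theorem snocMap_jetOp {m n : ℕ} (γ : (Fin m → (ι →₀ ℕ)) → TPow K A (n + 1)) :
    snocMap K A (n + 1) ∘ₗ TensorProduct.map 
      (jetOp e b (iterComulAlg K A n) m γ) LinearMap.id ∘ₗ coactRight K A m =
      jetOp e b (iterComulAlg K A (n + 1)) m fun s => unitBack K A (n + 1) (γ s) := by
  have h1 : ((snocJet K A (Fin m → (ι →₀ ℕ)) (n + 1)).comp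
      (Algebra.TensorProduct.map
      (jet e b (iterComulAlg K A n) m) (AlgHom.id K _))).comp (coactRightAlg K A m) =
      jet e b (iterComulAlg K A (n + 1)) m :=
    tpow_algHom_ext_gen (e := e) fun j ξ => (snocJet_of_primitive _ j (comul_gen e ξ) _ _ _
      ((jet_at' e b _ j _).trans (taylorAt_gen e b _ j ξ))).trans (by
        rw [jet_at', taylorAt_gen, iterComulAlg_gen, iterComulAlg_gen, map_sum,
          Fin.sum_univ_castSucc fun i : Fin (n + 1 + 1) => at' K A i (gen e ξ)]
        simp only [unitBack, glueAlg_at', atAlg_apply])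
  have h2 := snocMap_jetPairing (jet e b (iterComulAlg K A n) m) γ
  refine LinearMap.ext fun x => ?_
  rw [jetOp_apply, ← h1]
  exact LinearMap.congr_fun h2 (coactRight K A m x)

/-- The second Gerstenhaber–Schack differential on coefficients. -/
def coeffD2 {n : ℕ} (a : TPow K A (n + 1)) : TPow K A (n + 1 + 1) :=
  -unitFront K A (n + 1) a + ∑ i : Fin (n + 1), (-1 : K) ^ (i : ℕ) • comulAt K A i a +
    (-1 : K) ^ (n + 1) • unitBack K A (n + 1) a

theorem d2_jetOp {m n : ℕ} (γ : (Fin m → (ι →₀ ℕ)) → TPow K A (n + 1)) :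
    d2 K A m (n + 1) (jetOp e b (iterComulAlg K A n) m γ) =
      jetOp e b (iterComulAlg K A (n + 1)) m fun s => coeffD2 (γ s) := by
  have h' : (fun s => coeffD2 (γ s)) = -(fun s => unitFront K A (n + 1) (γ s)) +
      ∑ i : Fin (n + 1), (-1 : K) ^ (i : ℕ) • (fun s => comulAt K A i (γ s)) +
      (-1 : K) ^ (n + 1) • (fun s => unitBack K A (n + 1) (γ s)) := by
    funext s
    simp [coeffD2]
  rw [d2_apply, h', consMap_jetOp, snocMap_jetOp, map_add, map_add, map_neg, map_sum, map_smul]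
  simp only [map_smul, comulAt_jetOp]

end JetsTarget

/-! ### Taylor coefficients and uniqueness of the coefficients of an operator. -/

section TaylorCoefficients

variable {K : Type*} [Field K] {V : Type*} [AddCommGroup V] [Module K V]
variable {A : Type*} [CommRing A] [Bialgebra K A] (e : O K V ≃ₐc[K] A)
variable {ι : Type} [Fintype ι] [DecidableEq ι] (b : Module.Basis ι K V)
variable {B : Type*} [CommRing B] [Algebra K B]

/-- The Taylor expansion of a polynomial function. -/
def tay : A →ₐ[K] MvPolynomial ι A :=
  liftGen e ((IsScalarTower.toAlgHom K A (MvPolynomial ι A)).toLinearMap ∘ₗ gen e +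
    ∑ α, (Module.Dual.eval K V (b α)).smulRight (MvPolynomial.X α : MvPolynomial ι A))

theorem tay_gen (ξ : Module.Dual K V) : tay e b (gen e ξ) =
    MvPolynomial.C (gen e ξ) + ∑ α, ξ (b α) • (MvPolynomial.X α : MvPolynomial ι A) := by
  rw [tay, liftGen_gen, LinearMap.add_apply, LinearMap.sum_apply]
  rfl

/-- The divided partial derivative `∂^u / u!`. -/
def divD (u : ι →₀ ℕ) : A →ₗ[K] A :=
  (MvPolynomial.lcoeff (R := A) u).restrictScalars K ∘ₗ (tay e b).toLinearMap

theorem divD_apply (u : ι →₀ ℕ) (f : A) : divD e b u f = MvPolynomial.coeff u (tay e b f) := rfl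

theorem divD_zero (f : A) : divD e b 0 f = f := by
  have h : ((MvPolynomial.aeval (R := A) (0 : ι → A)).restrictScalars K).comp (tay e b) =
      AlgHom.id K A := by
    refine algHom_ext_gen (e := e) fun ξ => ?_
    rw [AlgHom.comp_apply, tay_gen, AlgHom.restrictScalars_apply, map_add, map_sum,
      MvPolynomial.aeval_C]
    simp only [Algebra.smul_def ( _ : K), MvPolynomial.algebraMap_apply, map_mul,
      MvPolynomial.aeval_X]
    simp
  have h' := AlgHom.congr_fun h f
  rw [divD_apply]
  simpa [MvPolynomial.aeval_zero, MvPolynomial.constantCoeff_eq] using h'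

theorem divD_algebraMap (u : ι →₀ ℕ) (hu : u ≠ 0) (r : K) :
    divD e b u (algebraMap K A r) = 0 := by
  rw [divD_apply, AlgHom.commutes, MvPolynomial.algebraMap_apply, MvPolynomial.coeff_C,
    if_neg hu.symm]

theorem divD_gen (α : ι) (ξ : Module.Dual K V) :
    divD e b (Finsupp.single α 1) (gen e ξ) = algebraMap K A (ξ (b α)) := by
  rw [divD_apply, tay_gen, MvPolynomial.coeff_add, MvPolynomial.coeff_C, MvPolynomial.coeff_sum]
  simp only [MvPolynomial.coeff_smul, MvPolynomial.coeff_X]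
  rw [Finset.sum_eq_single α]
  · simp [Algebra.algebraMap_eq_smul_one, eq_comm]
  · intro β _ hβ
    rw [if_neg fun h => hβ ((Finsupp.single_left_inj one_ne_zero).1 h), smul_zero]
  · simp

/-- This form lets the Leibniz rule for the linear Taylor coefficient be read off from the one for
`pderiv`. -/
theorem coeff_single_eq_coeff_pderiv (α : ι) (p : MvPolynomial ι A) :
    MvPolynomial.coeff (Finsupp.single α 1) p =
      MvPolynomial.coeff 0 (MvPolynomial.pderiv α p) := by
  simp [MvPolynomial.coeff_pderiv]

theorem divD_single_mul (α : ι) (f g : A) : divD e b (Finsupp.single α 1) (f * g) =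
    divD e b (Finsupp.single α 1) f * g + f * divD e b (Finsupp.single α 1) g := by
  have h0 : ∀ f, MvPolynomial.coeff 0 (tay e b f) = f := divD_zero e b
  simp only [divD_apply, coeff_single_eq_coeff_pderiv, map_mul, Derivation.leibniz, smul_eq_mul,
    MvPolynomial.coeff_add]
  simp only [← MvPolynomial.constantCoeff_eq, map_mul]
  simp only [MvPolynomial.constantCoeff_eq, h0]
  ring

/-- Differentiating f(x + ε) with respect to ε or to x gives the same. Both sides obey the Leibniz
rule, so linear functions suffice. -/
theorem pderiv_tay (α : ι) (f : A) :
    MvPolynomial.pderiv α (tay e b f) = tay e b (divD e b (Finsupp.single α 1) f) := by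
  induction f using gen_induction e with
  | halg r =>
    rw [divD_algebraMap _ _ _ (by simp), AlgHom.commutes, MvPolynomial.algebraMap_apply,
      MvPolynomial.pderiv_C, map_zero]
  | hgen ξ =>
    rw [divD_gen, tay_gen, map_add, MvPolynomial.pderiv_C, zero_add, map_sum, AlgHom.commutes]
    simp only [Algebra.smul_def (_ : K), MvPolynomial.algebraMap_apply, MvPolynomial.pderiv_C_mul,
      MvPolynomial.pderiv_X]
    rw [Finset.sum_eq_single α]
    · simp
    · intro β _ hβ
      rw [Pi.single_eq_of_ne hβ, mul_zero]
    · simp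
  | hadd f g hf hg => rw [map_add, map_add, hf, hg, map_add, map_add]
  | hmul f g hf hg =>
    rw [divD_single_mul, map_mul, Derivation.leibniz, hf, hg, map_add, map_mul, map_mul]
    simp only [smul_eq_mul]
    ring

theorem divD_divD_single (u : ι →₀ ℕ) (α : ι) (f : A) :
    divD e b u (divD e b (Finsupp.single α 1) f) =
      ((u α : K) + 1) • divD e b (u + Finsupp.single α 1) f := by
  rw [divD_apply, ← pderiv_tay, MvPolynomial.coeff_pderiv, divD_apply, mul_comm,
    Algebra.smul_def]
  simp

/-- The set `S` may exceed the support, so that the expansions of different functions can be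
compared over a common index set. -/
theorem taylorAt_eq_sum (c : A →ₐ[K] B) {m : ℕ} (j : Fin m) (f : A) (S : Finset (ι →₀ ℕ))
    (hS : (tay e b f).support ⊆ S) : taylorAt e b c j f =
      ∑ u ∈ S, AddMonoidAlgebra.single (Pi.single j u) (c (divD e b u f)) := by
  have h : (taylorAt e b c j : A →ₐ[K] AddMonoidAlgebra B (Fin m → (ι →₀ ℕ))) =
      (AddMonoidAlgebra.mapDomainAlgHom K B (AddMonoidHom.single (fun _ => ι →₀ ℕ) j)).comp
        ((AddMonoidAlgebra.mapAlgHom (ι →₀ ℕ) c).comp (tay e b)) := by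
    refine algHom_ext_gen (e := e) fun ξ => ?_
    rw [taylorAt_gen, AlgHom.comp_apply, AlgHom.comp_apply, tay_gen, map_add, map_add, map_sum,
      map_sum]
    congr 1
    · rw [MvPolynomial.C_apply, MvPolynomial.monomial, ]
      simp
    · refine Finset.sum_congr rfl fun α _ => ?_
      rw [MvPolynomial.X, MvPolynomial.smul_monomial]
      simp [MvPolynomial.monomial, Algebra.algebraMap_eq_smul_one]
  have h' : tay e b f = ∑ u ∈ S, AddMonoidAlgebra.single u (divD e b u f) := by
    conv_lhs => rw [(tay e b f).as_sum]
    refine Finset.sum_subset hS fun u _ hu => ?_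
    rw [MvPolynomial.notMem_support_iff.1 hu]
    exact map_zero (MvPolynomial.monomial u)
  rw [h, AlgHom.comp_apply, AlgHom.comp_apply, h', map_sum, map_sum]
  simp

theorem jetOp_tprod (c : A →ₐ[K] B) {m : ℕ} (γ : (Fin m → (ι →₀ ℕ)) → B) (f : Fin m → A)
    (S : Fin m → Finset (ι →₀ ℕ)) (hS : ∀ j, (tay e b (f j)).support ⊆ S j) :
    jetOp e b c m γ (PiTensorProduct.tprod K f) =
      ∑ s ∈ Fintype.piFinset S, γ s * ∏ j, c (divD e b (s j) (f j)) := by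
  have h : ∀ s : Fin m → (ι →₀ ℕ), ∏ j, (AddMonoidAlgebra.single
      (Pi.single j (s j) : Fin m → (ι →₀ ℕ)) (c (divD e b (s j) (f j)))) =
      AddMonoidAlgebra.single s (∏ j, c (divD e b (s j) (f j))) := fun s => by
    rw [AddMonoidAlgebra.prod_single, Finset.univ_sum_single]
  rw [jetOp_apply, jet_tprod, Finset.prod_congr rfl fun j _ => taylorAt_eq_sum e b c j _ _ (hS j),
    Finset.prod_univ_sum, map_sum]
  simp only [h, jetPairing_single]

theorem jetOp_of_expansion (c : A →ₐ[K] B) {m : ℕ} (D : Fin m → A →ₗ[K] A)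
    (a : Fin m → ((ι →₀ ℕ) →₀ K)) (hD : ∀ i f, D i f = (a i).sum fun u r => r • divD e b u f)
    (y : B) : LinearMap.mulLeft K y ∘ₗ glue (fun i => c.toLinearMap ∘ₗ D i) =
      jetOp e b c m fun s => (∏ i, a i (s i)) • y := by
  refine PiTensorProduct.ext (MultilinearMap.ext fun f => ?_)
  simp only [LinearMap.compMultilinearMap_apply, LinearMap.comp_apply, glue_tprod,
    LinearMap.mulLeft_apply, AlgHom.toLinearMap_apply]
  rw [jetOp_tprod e b c _ f (fun j => (tay e b (f j)).support ∪ (a j).support)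
    fun j => Finset.subset_union_left]
  have h : ∀ i, c (D i (f i)) = ∑ u ∈ (tay e b (f i)).support ∪ (a i).support,
      a i u • c (divD e b u (f i)) := fun i => by
    rw [hD, Finsupp.sum, map_sum]
    simp only [map_smul]
    refine Finset.sum_subset Finset.subset_union_right fun u _ hu => ?_
    rw [Finsupp.notMem_support_iff.1 hu, zero_smul]
  simp only [h]
  rw [Finset.prod_univ_sum, Finset.mul_sum]
  refine Finset.sum_congr rfl fun s _ => ?_
  rw [Finset.prod_smul, smul_mul_assoc, mul_smul_comm]

theorem exists_list_sum_eq {m : ℕ} (s : Fin m → (ι →₀ ℕ)) : ∃ w : List (Fin m × ι),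
    (w.map fun p => (Pi.single p.1 (Finsupp.single p.2 1) : Fin m → (ι →₀ ℕ))).sum = s := by
  let P : (Fin m → (ι →₀ ℕ)) → Prop := fun s => ∃ w : List (Fin m × ι),
    (w.map fun p => (Pi.single p.1 (Finsupp.single p.2 1) : Fin m → (ι →₀ ℕ))).sum = s
  have h0 : P 0 := ⟨[], rfl⟩
  have hadd : ∀ s t, P s → P t → P (s + t) := by
    rintro _ _ ⟨w, rfl⟩ ⟨w', rfl⟩
    exact ⟨w ++ w', by rw [List.map_append, List.sum_append]⟩
  have hsingle : ∀ j u, P (Pi.single j u) := by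
    intro j u
    induction u using Finsupp.induction_linear with
    | zero => rw [Pi.single_zero]; exact h0
    | add u v hu hv => rw [Pi.single_add]; exact hadd _ _ hu hv
    | single α k => exact ⟨List.replicate k (j, α), by simp [← Pi.single_smul]⟩
  rw [← Finset.univ_sum_single s]
  exact Finset.sum_induction _ P hadd h0 fun j _ => hsingle j _

/-- An increment is the jet of a coordinate function minus its undifferentiated part. So, by
induction on the monomial, the pairing of `γ` with any monomial in the increments times any jet
vanishes; for the jet 1 this gives γ(s) = 0. -/
theorem jetOp_injective (c : A →ₐ[K] B) (m : ℕ) : Function.Injective (jetOp e b c m) := by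
  rw [← LinearMap.ker_eq_bot, LinearMap.ker_eq_bot']
  intro γ hγ
  have key : ∀ (w : List (Fin m × ι)) x, jetPairing (K := K) γ
      (AddMonoidAlgebra.single (w.map fun p => (Pi.single p.1 (Finsupp.single p.2 1) : Fin m → (ι →₀ ℕ))).sum 1 *
        jet e b c m x) = 0 := by
    intro w
    induction w with
    | nil =>
      intro x
      rw [List.map_nil, List.sum_nil, ← AddMonoidAlgebra.one_def, one_mul, ← jetOp_apply, hγ,
        LinearMap.zero_apply]
    | cons p w ih =>
      intro x
      have h1 : (AddMonoidAlgebra.single (Pi.single p.1 (Finsupp.single p.2 1)) 1 :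
          AddMonoidAlgebra B (Fin m → (ι →₀ ℕ))) =
          jet e b c m (at' K A p.1 (gen e (b.coord p.2))) -
            AddMonoidAlgebra.single 0 (c (gen e (b.coord p.2))) := by
        rw [jet_at', taylorAt_gen, add_sub_cancel_left, Finset.sum_eq_single p.2]
        · simp
        · intro β _ hβ
          simp [Finsupp.single_eq_of_ne hβ.symm]
        · simp
      have h2 : ∀ (r : B) (y : AddMonoidAlgebra B (Fin m → (ι →₀ ℕ))),
          jetPairing (K := K) γ (AddMonoidAlgebra.single 0 r * y) = r * jetPairing (K := K) γ y := by
        intro r y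
        have : jetPairing (K := K) γ ∘ₗ LinearMap.mulLeft K (AddMonoidAlgebra.single 0 r) =
            LinearMap.mulLeft K r ∘ₗ jetPairing (K := K) γ :=
          linearMap_ext_single fun s a' => by
            simp [jetPairing_single, AddMonoidAlgebra.single_mul_single]
            ring
        exact LinearMap.congr_fun this y
      rw [List.map_cons, List.sum_cons, ← one_mul (1 : B), ← AddMonoidAlgebra.single_mul_single, h1,
        sub_mul, sub_mul, map_sub, mul_assoc, mul_assoc, h2, ih, mul_zero, sub_zero,
        mul_left_comm, ← map_mul, ih]
  funext s
  obtain ⟨w, rfl⟩ := exists_list_sum_eq s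
  simpa [jetPairing_single] using key w 1

end TaylorCoefficients

/-! ### Derivatives at the origin and linear substitutions. -/

section PolynomialFunctionals

variable {K : Type*} [Field K] {ι : Type} [Fintype ι] [DecidableEq ι] {n n' : ℕ}

/-- The exponent of a monomial in `n` groups of variables. -/
def idx : (Fin n → (ι →₀ ℕ)) →+ (Fin n × ι →₀ ℕ) where
  toFun t := Finsupp.equivFunOnFinite.symm fun p => t p.1 p.2
  map_zero' := by ext; simp
  map_add' s t := by ext; simp

theorem idx_apply (t : Fin n → (ι →₀ ℕ)) (p : Fin n × ι) : idx t p = t p.1 p.2 := rfl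

theorem idx_injective : Function.Injective (idx (n := n) (ι := ι)) := fun s t h => by
  funext j
  ext α
  exact DFunLike.congr_fun h (j, α)

theorem idx_surjective : Function.Surjective (idx (n := n) (ι := ι)) := fun u =>
  ⟨fun j => Finsupp.equivFunOnFinite.symm fun α => u (j, α), by ext; simp [idx_apply]⟩

theorem idx_single (j : Fin n) (α : ι) (k : ℕ) :
    idx (Pi.single j (Finsupp.single α k)) = Finsupp.single (j, α) k := by
  ext ⟨i, β⟩
  rw [idx_apply]
  by_cases hi : i = j
  · subst hi
    by_cases hβ : β = α
    · subst hβ; simp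
    · simp [Ne.symm hβ]
  · simp [hi]

/-- The product of the factorials of the exponents. -/
def exponentFactorial (t : Fin n → (ι →₀ ℕ)) : ℕ := ∏ p : Fin n × ι, (t p.1 p.2).factorial

theorem exponentFactorial_ne_zero [CharZero K] (t : Fin n → (ι →₀ ℕ)) :
    (exponentFactorial t : K) ≠ 0 :=
  Nat.cast_ne_zero.2 (Finset.prod_ne_zero_iff.2 fun _ _ => Nat.factorial_ne_zero _)

theorem exponentFactorial_add_single (t : Fin n → (ι →₀ ℕ)) (j : Fin n) (α : ι) :
    exponentFactorial (t + Pi.single j (Finsupp.single α 1)) =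
      exponentFactorial t * (t j α + 1) := by
  rw [exponentFactorial, exponentFactorial, ← Finset.mul_prod_erase _ _ (Finset.mem_univ (j, α)),
    ← Finset.mul_prod_erase _ (fun p : Fin n × ι => (t p.1 p.2).factorial)
      (Finset.mem_univ (j, α))]
  have h : ∀ p ∈ Finset.univ.erase (j, α),
      ((t + Pi.single j (Finsupp.single α 1) : Fin n → (ι →₀ ℕ)) p.1 p.2).factorial = (t p.1 p.2).factorial := by
    intro p hp
    have h1 : idx (Pi.single j (Finsupp.single α 1)) p = 0 := by
      rw [idx_single, Finsupp.single_apply, if_neg (Finset.ne_of_mem_erase hp).symm]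
    rw [idx_apply] at h1
    rw [Pi.add_apply, Finsupp.add_apply, h1, add_zero]
  rw [Finset.prod_congr rfl h, Pi.add_apply, Pi.single_eq_same, Finsupp.add_apply,
    Finsupp.single_eq_same, Nat.factorial_succ]
  ring

/-- The value at the origin of the iterated partial derivative with given exponents. -/
def derivAtZero (t : Fin n → (ι →₀ ℕ)) : MvPolynomial (Fin n × ι) K →ₗ[K] K :=
  (exponentFactorial t : K) • MvPolynomial.lcoeff (R := K) (idx t)

theorem derivAtZero_apply (t : Fin n → (ι →₀ ℕ)) (p : MvPolynomial (Fin n × ι) K) :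
    derivAtZero t p = (exponentFactorial t : K) * MvPolynomial.coeff (idx t) p := rfl

theorem derivAtZero_add_single (t : Fin n → (ι →₀ ℕ)) (j : Fin n) (α : ι)
    (p : MvPolynomial (Fin n × ι) K) :
    derivAtZero (t + Pi.single j (Finsupp.single α 1)) p =
      derivAtZero t (MvPolynomial.pderiv (j, α) p) := by
  rw [derivAtZero_apply, derivAtZero_apply, exponentFactorial_add_single, map_add, idx_single,
    MvPolynomial.coeff_pderiv, idx_apply]
  push_cast
  ring

/-- The transfer of exponents along a partially defined map. -/
def pushOption (r : Fin n' → Option (Fin n)) (t : Fin n' → (ι →₀ ℕ)) (j : Fin n) : ι →₀ ℕ :=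
  ∑ j', if r j' = some j then t j' else 0

theorem pushOption_add (r : Fin n' → Option (Fin n)) (s t : Fin n' → (ι →₀ ℕ)) :
    pushOption r (s + t) = pushOption r s + pushOption r t := by
  funext j
  simp only [pushOption, Pi.add_apply, ← Finset.sum_add_distrib]
  exact Finset.sum_congr rfl fun j' _ => by split_ifs <;> simp

theorem pushOption_single (r : Fin n' → Option (Fin n)) (j' : Fin n') (u : ι →₀ ℕ) (j : Fin n)
    (h : r j' = some j) : pushOption r (Pi.single j' u) = Pi.single j u := by
  funext i
  rw [pushOption, Finset.sum_eq_single j']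
  · rw [h, Pi.single_eq_same]
    by_cases hi : i = j
    · subst hi; simp
    · rw [if_neg fun h => hi (Option.some_injective _ h).symm, Pi.single_eq_of_ne hi]
  · intro k _ hk
    rw [Pi.single_eq_of_ne hk, ite_self]
  · simp

/-- The change of variables which splits each variable into a sum of new ones. -/
def splitVars (r : Fin n' → Option (Fin n)) :
    MvPolynomial (Fin n × ι) K →ₐ[K] MvPolynomial (Fin n' × ι) K :=
  MvPolynomial.aeval fun q => ∑ j', if r j' = some q.1 then MvPolynomial.X (j', q.2) else 0

theorem pderiv_splitVars (r : Fin n' → Option (Fin n)) (j' : Fin n') (α : ι)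
    (p : MvPolynomial (Fin n × ι) K) :
    MvPolynomial.pderiv (j', α) (splitVars r p) =
      (r j').elim 0 fun j => splitVars r (MvPolynomial.pderiv (j, α) p) := by
  induction p using MvPolynomial.induction_on with
  | C a =>
    rw [splitVars, MvPolynomial.aeval_C, MvPolynomial.algebraMap_eq, MvPolynomial.pderiv_C]
    cases r j' <;> simp
  | add p q hp hq =>
    rw [map_add, map_add, hp, hq]
    cases r j' <;> simp
  | mul_X p q hp =>
    have h : MvPolynomial.pderiv (j', α) (splitVars (K := K) r (MvPolynomial.X q)) =
        (r j').elim 0 fun j => splitVars (K := K) r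
          (MvPolynomial.pderiv (j, α) (MvPolynomial.X q)) := by
      rw [splitVars, MvPolynomial.aeval_X, map_sum, Finset.sum_eq_single j']
      · cases h : r j' with
        | none => simp
        | some j =>
          simp only [Option.some.injEq, Option.elim_some, MvPolynomial.pderiv_X]
          by_cases hj : j = q.1
          · subst hj
            by_cases hα : q.2 = α
            · subst hα
              simp
            · have h1 : (j', q.2) ≠ (j', α) := fun h => hα (congrArg Prod.snd h)
              have h2 : q ≠ (q.1, α) := fun h => hα (congrArg Prod.snd h)
              rw [if_pos rfl, MvPolynomial.pderiv_X_of_ne h1, Pi.single_eq_of_ne h2, map_zero]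
          · have h2 : q ≠ (j, α) := fun h => hj (congrArg Prod.fst h).symm
            rw [if_neg hj, Pi.single_eq_of_ne h2, map_zero, map_zero]
      · intro k _ hk
        split_ifs
        · exact MvPolynomial.pderiv_X_of_ne fun h => hk (congrArg Prod.fst h)
        · exact map_zero _
      · simp
    rw [map_mul, Derivation.leibniz, hp, h]
    cases r j' <;> simp [Derivation.leibniz]

theorem constantCoeff_splitVars (r : Fin n' → Option (Fin n)) (p : MvPolynomial (Fin n × ι) K) :
    MvPolynomial.constantCoeff (splitVars r p) = MvPolynomial.constantCoeff p := by
  induction p using MvPolynomial.induction_on with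
  | C a => rw [splitVars, MvPolynomial.aeval_C, MvPolynomial.algebraMap_eq]; simp
  | add p q hp hq => rw [map_add, map_add, hp, hq, map_add]
  | mul_X p q hp =>
    rw [map_mul, map_mul, hp, splitVars, MvPolynomial.aeval_X, map_mul, map_sum,
      Finset.sum_eq_zero, MvPolynomial.constantCoeff_X]
    intro k _
    split_ifs <;> simp

/-- Chain rule: a new variable in group `j'` enters through the old group `r j'` with coefficient
one, or not at all. Since `derivAtZero` is not divided by factorials, the exponents are simply
transported, without multinomial factors. -/
theorem derivAtZero_splitVars (r : Fin n' → Option (Fin n)) (t : Fin n' → (ι →₀ ℕ))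
    (p : MvPolynomial (Fin n × ι) K) : derivAtZero t (splitVars r p) =
      if ∀ j', r j' = none → t j' = 0 then derivAtZero (pushOption r t) p else 0 := by
  obtain ⟨w, rfl⟩ := exists_list_sum_eq t
  induction w generalizing p with
  | nil =>
    have h : pushOption r (0 : Fin n' → (ι →₀ ℕ)) = 0 := by
      funext j
      simp [pushOption]
    rw [List.map_nil, List.sum_nil, h]
    refine Eq.trans ?_ (if_pos fun _ _ => rfl).symm
    rw [derivAtZero_apply, derivAtZero_apply,
      map_zero, map_zero, ← MvPolynomial.constantCoeff_eq, ← MvPolynomial.constantCoeff_eq,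
      constantCoeff_splitVars]
    simp [exponentFactorial]
  | cons q w ih =>
    obtain ⟨j', α⟩ := q
    rw [List.map_cons, List.sum_cons, add_comm, derivAtZero_add_single, pderiv_splitVars]
    cases h : r j' with
    | none =>
      rw [Option.elim_none, map_zero, if_neg]
      intro hh
      have := DFunLike.congr_fun (hh j' h) α
      simp at this
    | some j =>
      have hiff : ∀ t : Fin n' → (ι →₀ ℕ), (∀ k, r k = none →
          (t + Pi.single j' (Finsupp.single α 1) : Fin n' → (ι →₀ ℕ)) k = 0) ↔
          ∀ k, r k = none → t k = 0 := by
        intro t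
        refine forall_congr' fun k => forall_congr' fun hk => ?_
        have hne : k ≠ j' := fun hkj => by
          rw [← hkj, hk] at h
          exact Option.some_ne_none _ h.symm
        rw [Pi.add_apply, Pi.single_eq_of_ne hne, add_zero]
      rw [Option.elim_some, ih, pushOption_add, pushOption_single r j' _ j h,
        derivAtZero_add_single]
      exact if_congr (hiff _).symm rfl rfl

end PolynomialFunctionals

/-! ### Functionals separating the elements of tensor powers. -/

section TensorFunctionals

variable {K : Type*} [Field K] {V : Type*} [AddCommGroup V] [Module K V]
variable {A : Type*} [CommRing A] [Bialgebra K A] (e : O K V ≃ₐc[K] A)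
variable {ι : Type} [Fintype ι] [DecidableEq ι] (b : Module.Basis ι K V)

/-- Tensors of polynomial functions as polynomials in several groups of variables. -/
def ev (n : ℕ) : TPow K A n →ₐ[K] MvPolynomial (Fin n × ι) K :=
  glueAlg fun j => liftGen e
    (∑ α, (Module.Dual.eval K V (b α)).smulRight (MvPolynomial.X (j, α) : MvPolynomial _ K))

theorem ev_at'_gen {n : ℕ} (j : Fin n) (ξ : Module.Dual K V) :
    ev e b n (at' K A j (gen e ξ)) = ∑ α, ξ (b α) • MvPolynomial.X (j, α) := by
  rw [ev, glueAlg_at', liftGen_gen, LinearMap.sum_apply]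
  rfl

theorem ev_injective (n : ℕ) : Function.Injective (ev e b n) := by
  have h : (MvPolynomial.aeval fun q : Fin n × ι => at' K A q.1 (gen e (b.coord q.2))).comp
      (ev e b n) = AlgHom.id K (TPow K A n) := by
    refine tpow_algHom_ext_gen (e := e) fun j ξ => ?_
    rw [AlgHom.comp_apply, ev_at'_gen, map_sum]
    simp only [map_smul, MvPolynomial.aeval_X, AlgHom.id_apply]
    simp only [← map_smul, ← map_sum]
    congr 2
    refine b.ext fun α => ?_
    simp
  exact Function.LeftInverse.injective (g := MvPolynomial.aeval fun q : Fin n × ι =>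
    at' K A q.1 (gen e (b.coord q.2))) fun x => AlgHom.congr_fun h x

theorem ev_algHom {n n' : ℕ} (r : Fin n' → Option (Fin n)) (Ψ : TPow K A n →ₐ[K] TPow K A n')
    (h : ∀ j ξ, Ψ (at' K A j (gen e ξ)) =
      ∑ j', if r j' = some j then at' K A j' (gen e ξ) else 0) (x : TPow K A n) :
    ev e b n' (Ψ x) = splitVars r (ev e b n x) := by
  have h' : (ev e b n').comp Ψ = (splitVars r).comp (ev e b n) := by
    refine tpow_algHom_ext_gen (e := e) fun j ξ => ?_
    rw [AlgHom.comp_apply, AlgHom.comp_apply, h, ev_at'_gen, map_sum, map_sum]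
    simp only [map_smul, splitVars, MvPolynomial.aeval_X, Finset.smul_sum]
    rw [Finset.sum_comm]
    refine Finset.sum_congr rfl fun j' _ => ?_
    split_ifs
    · exact ev_at'_gen e b j' ξ
    · simp
  exact AlgHom.congr_fun h' x

/-- The value at the origin of the iterated partial derivative of a tensor of functions. -/
def dualC {n : ℕ} (t : Fin n → (ι →₀ ℕ)) : TPow K A n →ₗ[K] K :=
  derivAtZero t ∘ₗ (ev e b n).toLinearMap

theorem dualC_apply {n : ℕ} (t : Fin n → (ι →₀ ℕ)) (x : TPow K A n) :
    dualC e b t x = derivAtZero t (ev e b n x) := rfl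

/-- The derivatives at the origin are the coefficients of the polynomial times factorials, and these
are invertible. -/
theorem dualC_ext [CharZero K] {n : ℕ} {x y : TPow K A n}
    (h : ∀ t, dualC e b t x = dualC e b t y) : x = y := by
  refine ev_injective e b n (MvPolynomial.ext _ _ fun u => ?_)
  obtain ⟨t, rfl⟩ := idx_surjective u
  exact mul_left_cancel₀ (exponentFactorial_ne_zero t) (h t)

/-- Common form of the transposes below: `r j'` is the old factor whose linear functions are copied
into the factor `j'`, and `none` marks a factor which receives nothing. -/
theorem dualC_algHom {n n' : ℕ} (r : Fin n' → Option (Fin n)) (Ψ : TPow K A n →ₐ[K] TPow K A n')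
    (h : ∀ j ξ, Ψ (at' K A j (gen e ξ)) =
      ∑ j', if r j' = some j then at' K A j' (gen e ξ) else 0) (t : Fin n' → (ι →₀ ℕ))
    (x : TPow K A n) : dualC e b t (Ψ x) =
      if ∀ j', r j' = none → t j' = 0 then dualC e b (pushOption r t) x else 0 := by
  rw [dualC_apply, ev_algHom e b r Ψ h, derivAtZero_splitVars, dualC_apply]

/-- The comultiplication is the substitution x ↦ x' + x'', so its transpose adds the exponents of
two neighbouring groups. This is the mirror image of `jetOp_mulAt`. -/
theorem dualC_comulAt {n : ℕ} (i : Fin n) (t : Fin (n + 1) → (ι →₀ ℕ)) (x : TPow K A n) :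
    dualC e b t (comulAt K A i x) = dualC e b (push i.predAbove t) x := by
  have h1 : i.predAbove i.succ = i := by simp
  have h2 : ∀ j, i.predAbove (i.succ.succAbove j) = j := fun j => by
    rcases lt_or_ge j.castSucc i.succ with h | h
    · rw [Fin.succAbove_of_castSucc_lt _ _ h, Fin.predAbove_of_le_castSucc, Fin.castPred_castSucc]
      simp only [Fin.lt_def, Fin.le_def, Fin.val_castSucc, Fin.val_succ] at *
      omega
    · rw [Fin.succAbove_of_le_castSucc _ _ h, Fin.predAbove_of_castSucc_lt, Fin.pred_succ]
      simp only [Fin.lt_def, Fin.le_def, Fin.val_castSucc, Fin.val_succ] at *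
      omega
  rw [← comulAtAlg_apply, dualC_algHom e b (fun j' => some (i.predAbove j')),
    if_pos fun j' hj' => absurd hj' (Option.some_ne_none _)]
  · congr 2
    funext j
    rw [pushOption, push_apply, Finset.sum_filter]
    simp only [Option.some.injEq]
  · intro j ξ
    rw [comulAtAlg_at', Fin.sum_univ_succAbove _ i.succ]
    simp only [Option.some.injEq, h1, h2]
    rw [Finset.sum_ite_eq' Finset.univ j, if_pos (Finset.mem_univ j)]
    by_cases hj : j = i
    · subst hj
      rw [if_pos rfl, if_pos rfl, comulPairAlg_gen, add_comm (at' K A j.castSucc _),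
        show j.succ.succAbove j = j.castSucc by simp]
    · rw [if_neg hj, if_neg (Ne.symm hj), zero_add]

theorem dualC_unitFront {n : ℕ} (t : Fin (n + 1) → (ι →₀ ℕ)) (x : TPow K A n) :
    dualC e b t (unitFront K A n x) =
      if t 0 = 0 then dualC e b (fun j => t j.succ) x else 0 := by
  rw [dualC_algHom e b (Fin.cons none fun j => some j)]
  · refine if_congr ⟨fun h => h 0 rfl, fun h j' => ?_⟩ ?_ rfl
    · cases j' using Fin.cases with
      | zero => exact fun _ => h
      | succ j => exact fun h => absurd h (Option.some_ne_none _)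
    · congr 2
      funext j
      rw [pushOption, Fin.sum_univ_succ]
      simp
  · intro j ξ
    rw [unitFront, glueAlg_at', Fin.sum_univ_succ]
    simp [atAlg_apply]

theorem dualC_unitBack {n : ℕ} (t : Fin (n + 1) → (ι →₀ ℕ)) (x : TPow K A n) :
    dualC e b t (unitBack K A n x) =
      if t (Fin.last n) = 0 then dualC e b (fun j => t j.castSucc) x else 0 := by
  rw [dualC_algHom e b (Fin.snoc (α := fun _ => Option (Fin n)) (fun j => some j) none)]
  · refine if_congr ⟨fun h => h (Fin.last n) (Fin.snoc_last _ _), fun h j' => ?_⟩ ?_ rfl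
    · cases j' using Fin.lastCases with
      | last => exact fun _ => h
      | cast j =>
        rw [Fin.snoc_castSucc]
        exact fun h => absurd h (Option.some_ne_none _)
    · congr 2
      funext j
      rw [pushOption, Fin.sum_univ_castSucc]
      simp
  · intro j ξ
    rw [unitBack, glueAlg_at', Fin.sum_univ_castSucc]
    simp [atAlg_apply]

/-- `ev` is the jet at the origin, that is, the jet with the counit for `c`, read as a polynomial.
Its coefficients on a pure tensor are products of Taylor coefficients at the origin. -/
theorem dualC_tprod {n : ℕ} (t : Fin n → (ι →₀ ℕ)) (f : Fin n → A) :
    dualC e b t (PiTensorProduct.tprod K f) =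
      exponentFactorial t * ∏ j, Coalgebra.counit (R := K) (divD e b (t j) (f j)) := by
  have h : ev e b n = (AddMonoidAlgebra.mapDomainAlgHom K K (idx (n := n) (ι := ι))).comp
      (jet e b (Bialgebra.counitAlgHom K A) n) := by
    refine tpow_algHom_ext_gen (e := e) fun j ξ => ?_
    rw [ev_at'_gen, AlgHom.comp_apply, jet_at', taylorAt_gen, Bialgebra.counitAlgHom_apply,
      counit_gen, AddMonoidAlgebra.single_zero, zero_add, map_sum]
    refine Finset.sum_congr rfl fun α _ => ?_
    rw [MvPolynomial.X, MvPolynomial.smul_monomial]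
    simp [MvPolynomial.monomial, idx_single]
  have h2 : MvPolynomial.lcoeff (R := K) (idx t) ∘ₗ
      (AddMonoidAlgebra.mapDomainAlgHom K K (idx (n := n) (ι := ι))).toLinearMap =
      jetPairing (K := K) (Pi.single t 1) :=
    linearMap_ext_single fun s a => by
      rw [jetPairing_single]
      by_cases hs : s = t
      · subst hs
        simp [MvPolynomial.lcoeff, MvPolynomial.coeff]
      · have hs' : idx s ≠ idx t := fun h => hs (idx_injective h)
        simp [MvPolynomial.lcoeff, MvPolynomial.coeff, hs, hs']
  have h3 : MvPolynomial.coeff (idx t) (ev e b n (PiTensorProduct.tprod K f)) =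
      jetOp e b (Bialgebra.counitAlgHom K A) n (Pi.single t 1) (PiTensorProduct.tprod K f) := by
    rw [h, jetOp_apply, ← h2]
    rfl
  rw [dualC_apply, derivAtZero_apply, h3, jetOp_tprod e b _ _ f
    (fun j => (tay e b (f j)).support ∪ {t j}) fun j => Finset.subset_union_left,
    Finset.sum_eq_single t]
  · simp
  · intro s _ hs
    rw [Pi.single_eq_of_ne hs, zero_mul]
  · intro ht
    exact absurd (Fintype.mem_piFinset.2 fun j =>
      Finset.mem_union_right _ (Finset.mem_singleton_self _)) ht

end TensorFunctionals

/-! ### Cancellation of faces for normalized functions. -/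

section Faces

variable {K : Type*} [Field K] {M : Type*} [AddCommMonoid M] [DecidableEq M]

/-- The alternating sum of the faces of a tuple, the first and the last face being the removal of
a zero entry. -/
def faceSum {m : ℕ} (g : (Fin m → M) → K) (s : Fin (m + 1) → M) : K :=
  -(if s 0 = 0 then g (fun j => s j.succ) else 0) +
    ∑ i : Fin m, (-1 : K) ^ (i : ℕ) * g (push i.predAbove s) +
    (-1 : K) ^ m * (if s (Fin.last m) = 0 then g (fun j => s j.castSucc) else 0)

theorem val_predAbove {m : ℕ} (i : Fin m) (q : Fin (m + 1)) :
    (i.predAbove q : ℕ) = if (i : ℕ) < q then (q : ℕ) - 1 else q := by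
  by_cases h : i.castSucc < q
  · rw [Fin.predAbove_of_castSucc_lt _ _ h, if_pos (show (i : ℕ) < q from h), Fin.val_pred]
  · rw [Fin.predAbove_of_le_castSucc _ _ (not_lt.1 h), if_neg (show ¬(i : ℕ) < q from h)]
    rfl

theorem predAbove_succAbove_of_eq {m : ℕ} (i : Fin m) (p : Fin (m + 1))
    (h : p = i.castSucc ∨ p = i.succ) (j : Fin m) : i.predAbove (p.succAbove j) = j := by
  have hp : (p : ℕ) = i ∨ (p : ℕ) = i + 1 := h.imp (congrArg Fin.val) (congrArg Fin.val)
  refine Fin.ext ?_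
  rw [val_predAbove]
  rcases lt_or_ge j.castSucc p with hj | hj
  · rw [Fin.succAbove_of_castSucc_lt _ _ hj, Fin.val_castSucc]
    have hj' : (j : ℕ) < p := hj
    rw [if_neg (by omega)]
  · rw [Fin.succAbove_of_le_castSucc _ _ hj, Fin.val_succ]
    have hj' : (p : ℕ) ≤ j := hj
    rw [if_pos (by omega), Nat.add_sub_cancel]

theorem push_predAbove_of_eq_zero {m : ℕ} (i : Fin m) (p : Fin (m + 1))
    (h : p = i.castSucc ∨ p = i.succ) (s : Fin (m + 1) → M) (hs : s p = 0) :
    push i.predAbove s = fun j => s (p.succAbove j) := by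
  funext j
  rw [push_apply, Finset.sum_filter, Fin.sum_univ_succAbove _ p, hs, ite_self, zero_add]
  simp only [predAbove_succAbove_of_eq i p h]
  rw [Finset.sum_ite_eq' Finset.univ j, if_pos (Finset.mem_univ j)]

theorem push_predAbove_apply_of_ne {m : ℕ} (i : Fin m) (p : Fin (m + 1))
    (h : p ≠ i.castSucc) (h' : p ≠ i.succ) (s : Fin (m + 1) → M) :
    push i.predAbove s (i.predAbove p) = s p := by
  rw [push_apply, Finset.sum_filter, Finset.sum_eq_single p]
  · rw [if_pos rfl]
  · intro q _ hq
    rw [if_neg]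
    intro hqp
    have h1 : (p : ℕ) ≠ i := fun hh => h (Fin.ext hh)
    have h2 : (p : ℕ) ≠ i + 1 := fun hh => h' (Fin.ext hh)
    have h3 : (q : ℕ) ≠ p := fun hh => hq (Fin.ext hh)
    have h4 := congrArg Fin.val hqp
    rw [val_predAbove, val_predAbove] at h4
    split_ifs at h4 <;> omega
  · simp

/-- If the entry `p` of `s` is zero, every face keeping this entry vanishes. The other faces remove
it: the mergings with its two neighbours, one of them replaced by an outer face if `p` is at an end.
They have the same value and opposite signs. If no entry is zero, the outer faces are absent and the
mergings remain. -/
theorem faceSum_of_normalized {m : ℕ} (g : (Fin m → M) → K) (hg : ∀ s, (∃ i, s i = 0) → g s = 0)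
    (s : Fin (m + 1) → M) : faceSum g s =
      if ∃ i, s i = 0 then 0 else ∑ i : Fin m, (-1 : K) ^ (i : ℕ) * g (push i.predAbove s) := by
  by_cases hs : ∃ i, s i = 0
  · rw [if_pos hs]
    obtain ⟨p, hp⟩ := hs
    let R : K := g fun j => s (p.succAbove j)
    have h0 : (if s 0 = 0 then g (fun j => s j.succ) else 0) = if p = 0 then R else 0 := by
      by_cases hp0 : p = 0
      · subst hp0
        rw [if_pos hp, if_pos rfl]
        simp only [R, Fin.succAbove_zero]
      · rw [if_neg hp0, hg _ ⟨p.pred hp0, by rw [Fin.succ_pred, hp]⟩, ite_self]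
    have h1 : (if s (Fin.last m) = 0 then g (fun j => s j.castSucc) else 0) =
        if p = Fin.last m then R else 0 := by
      by_cases hp0 : p = Fin.last m
      · subst hp0
        rw [if_pos hp, if_pos rfl]
        simp only [R, Fin.succAbove_last]
      · rw [if_neg hp0, hg _ ⟨p.castPred hp0, by rw [Fin.castSucc_castPred, hp]⟩, ite_self]
    have h2 : ∀ i : Fin m, (-1 : K) ^ (i : ℕ) * g (push i.predAbove s) =
        (if (i : ℕ) = p then (-1 : K) ^ (i : ℕ) * R else 0) +
          if (i : ℕ) + 1 = p then (-1 : K) ^ (i : ℕ) * R else 0 := by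
      intro i
      by_cases hi : p = i.castSucc
      · have e1 : (i : ℕ) = p := by rw [hi]; rfl
        rw [if_pos e1, if_neg (by omega), add_zero, push_predAbove_of_eq_zero i p (Or.inl hi) s hp]
      · by_cases hi' : p = i.succ
        · have e1 : (i : ℕ) + 1 = p := by rw [hi']; rfl
          rw [if_pos e1, if_neg (by omega), zero_add,
            push_predAbove_of_eq_zero i p (Or.inr hi') s hp]
        · rw [hg _ ⟨i.predAbove p, by rw [push_predAbove_apply_of_ne i p hi hi', hp]⟩, if_neg,
            if_neg, mul_zero, add_zero]
          · exact fun h => hi' (Fin.ext (by simp [← h]))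
          · exact fun h => hi (Fin.ext (by simp [← h]))
    have h3 : ∑ i : Fin m, (if (i : ℕ) = p then (-1 : K) ^ (i : ℕ) * R else 0) =
        if p = Fin.last m then 0 else (-1 : K) ^ (p : ℕ) * R := by
      split_ifs with h
      · refine Finset.sum_eq_zero fun i _ => if_neg ?_
        rw [h, Fin.val_last]
        exact i.2.ne
      · rw [Finset.sum_eq_single (p.castPred h)]
        · simp
        · intro i _ hi
          exact if_neg fun h' => hi (Fin.ext (by simpa using h'))
        · simp
    have h4 : ∑ i : Fin m, (if (i : ℕ) + 1 = p then (-1 : K) ^ (i : ℕ) * R else 0) =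
        if p = 0 then 0 else -((-1 : K) ^ (p : ℕ) * R) := by
      split_ifs with h
      · refine Finset.sum_eq_zero fun i _ => if_neg ?_
        rw [h]
        exact Nat.succ_ne_zero _
      · obtain ⟨q, rfl⟩ := Fin.exists_succ_eq.2 h
        rw [Finset.sum_eq_single q]
        · rw [if_pos (by simp), Fin.val_succ, pow_succ]
          ring
        · intro i _ hi
          exact if_neg fun h' => hi (Fin.ext (by simpa using h'))
        · simp
    rw [faceSum, h0, h1, Finset.sum_congr rfl fun i _ => h2 i, Finset.sum_add_distrib, h3, h4]
    by_cases hp0 : p = 0 <;> by_cases hpl : p = Fin.last m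
    · rw [if_pos hp0, if_pos hp0, if_pos hpl, if_pos hpl]
      -- The zero entry is both the first and the last one, and the two outer faces cancel each
      -- other.
      have : m = 0 := by
        have := congrArg Fin.val (hp0.symm.trans hpl)
        simpa using this.symm
      subst this
      ring
    · rw [if_pos hp0, if_pos hp0, if_neg hpl, if_neg hpl, hp0]
      simp
    · rw [if_neg hp0, if_neg hp0, if_pos hpl, if_pos hpl, hpl]
      simp
    · rw [if_neg hp0, if_neg hp0, if_neg hpl, if_neg hpl]
      ring
  · rw [if_neg hs, faceSum, if_neg fun h => hs ⟨0, h⟩, if_neg fun h => hs ⟨_, h⟩]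
    ring

end Faces

/-! ### Symbols of operators, and restriction to the augmentation ideal. -/

section Symbols

variable {K : Type*} [Field K] {V : Type*} [AddCommGroup V] [Module K V]
variable {A : Type*} [CommRing A] [Bialgebra K A] (e : O K V ≃ₐc[K] A)
variable {ι : Type} [Fintype ι] [DecidableEq ι] (b : Module.Basis ι K V) {m n : ℕ}

/-- The operator `Φ` is a polydifferential operator with symbol `Γ`. -/
def HasSymbol (Φ : TPow K A m →ₗ[K] TPow K A (n + 1))
    (Γ : (Fin m → (ι →₀ ℕ)) → (Fin (n + 1) → (ι →₀ ℕ)) → K) : Prop :=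
  ∃ γ, Φ = jetOp e b (iterComulAlg K A n) m γ ∧ ∀ s t, dualC e b t (γ s) = Γ s t

variable {e b}

theorem HasSymbol.zero : HasSymbol e b (0 : TPow K A m →ₗ[K] TPow K A (n + 1)) 0 :=
  ⟨0, (map_zero _).symm, fun _ _ => map_zero _⟩

theorem HasSymbol.add {Φ Ψ : TPow K A m →ₗ[K] TPow K A (n + 1)} {Γ Γ'} (h : HasSymbol e b Φ Γ)
    (h' : HasSymbol e b Ψ Γ') : HasSymbol e b (Φ + Ψ) (Γ + Γ') := by
  obtain ⟨γ, rfl, hγ⟩ := h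
  obtain ⟨γ', rfl, hγ'⟩ := h'
  exact ⟨γ + γ', (map_add _ _ _).symm, fun s t => by
    rw [Pi.add_apply, map_add, hγ, hγ']; rfl⟩

theorem HasSymbol.smul (r : K) {Φ : TPow K A m →ₗ[K] TPow K A (n + 1)} {Γ}
    (h : HasSymbol e b Φ Γ) : HasSymbol e b (r • Φ) (r • Γ) := by
  obtain ⟨γ, rfl, hγ⟩ := h
  exact ⟨r • γ, (map_smul _ _ _).symm, fun s t => by
    rw [Pi.smul_apply, map_smul, hγ]; rfl⟩

theorem HasSymbol.op_unique [CharZero K] {Φ Ψ : TPow K A m →ₗ[K] TPow K A (n + 1)} {Γ}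
    (h : HasSymbol e b Φ Γ) (h' : HasSymbol e b Ψ Γ) : Φ = Ψ := by
  obtain ⟨γ, rfl, hγ⟩ := h
  obtain ⟨γ', rfl, hγ'⟩ := h'
  congr 1
  funext s
  exact dualC_ext e b fun t => by rw [hγ, hγ']

theorem HasSymbol.symbol_unique {Φ : TPow K A m →ₗ[K] TPow K A (n + 1)} {Γ Γ'}
    (h : HasSymbol e b Φ Γ) (h' : HasSymbol e b Φ Γ') : Γ = Γ' := by
  obtain ⟨γ, rfl, hγ⟩ := h
  obtain ⟨γ', hh, hγ'⟩ := h'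
  obtain rfl := jetOp_injective e b _ _ hh
  funext s t
  rw [← hγ, ← hγ']

theorem HasSymbol.d1 {Φ : TPow K A m →ₗ[K] TPow K A (n + 1)} {Γ} (h : HasSymbol e b Φ Γ) :
    HasSymbol e b (d1 K A m n Φ) fun s t => faceSum (fun s => Γ s t) s := by
  obtain ⟨γ, rfl, hγ⟩ := h
  refine ⟨_, d1_jetOp e b γ, fun s t => ?_⟩
  have h1 : ∀ p, dualC e b t (insertCoeff p γ s) =
      if s p = 0 then Γ (fun j => s (p.succAbove j)) t else 0 := fun p => by
    rw [insertCoeff, apply_ite (dualC e b t), hγ, map_zero]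
  simp only [coeffD1, Pi.add_apply, Pi.neg_apply, Finset.sum_apply, Pi.smul_apply, map_add,
    map_neg, map_sum, map_smul, h1, hγ, smul_eq_mul, faceSum, Fin.succAbove_zero,
    Fin.succAbove_last]

/-- On functionals, `Δ_i` becomes a merging and the insertion of a unit becomes the removal of a
zero entry, so d² takes the shape of d¹ in the second variable. -/
theorem HasSymbol.d2 {Φ : TPow K A m →ₗ[K] TPow K A (n + 1)} {Γ} (h : HasSymbol e b Φ Γ) :
    HasSymbol e b (d2 K A m (n + 1) Φ) fun s t => faceSum (Γ s) t := by
  obtain ⟨γ, rfl, hγ⟩ := h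
  refine ⟨_, d2_jetOp e b γ, fun s t => ?_⟩
  simp only [coeffD2, map_add, map_neg, map_sum, map_smul, dualC_comulAt, dualC_unitFront,
    dualC_unitBack, hγ, smul_eq_mul, faceSum]

theorem projAug_inclAug (f : Aug K A) : projAug K A (inclAug K A f) = f := by
  refine Subtype.ext ?_
  change f.1 - algebraMap K A (Coalgebra.counit (R := K) f.1) = f.1
  rw [show Coalgebra.counit (R := K) f.1 = 0 from f.2, map_zero, sub_zero]

theorem inclPow_projPow_tprod (f : Fin n → A) :
    inclPow K A n (projPow K A n (PiTensorProduct.tprod K f)) =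
      PiTensorProduct.tprod K fun j => f j - algebraMap K A (Coalgebra.counit (R := K) (f j)) := by
  rw [inclPow, projPow, PiTensorProduct.map_tprod, PiTensorProduct.map_tprod]
  rfl

theorem projPow_inclPow (x : TPowAug K A n) : projPow K A n (inclPow K A n x) = x := by
  have h : projPow K A n ∘ₗ inclPow K A n = LinearMap.id := by
    rw [projPow, inclPow, ← PiTensorProduct.map_comp]
    have : (projAug K A ∘ₗ inclAug K A) = LinearMap.id := LinearMap.ext projAug_inclAug
    rw [this]
    exact PiTensorProduct.map_id
  exact LinearMap.congr_fun h x

theorem resHom_extHom (Φ : Cochain K A m n) : resHom K A m n (extHom K A m n Φ) = Φ := by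
  let Φ' : TPowAug K A m →ₗ[K] TPowAug K A n := Φ
  refine LinearMap.ext (f := (resHom K A m n (extHom K A m n Φ) :
    TPowAug K A m →ₗ[K] TPowAug K A n)) (g := Φ') fun x => ?_
  change projPow K A n (inclPow K A n (Φ' (projPow K A m (inclPow K A m x)))) = Φ' x
  rw [projPow_inclPow, projPow_inclPow]

variable (e b) in
theorem divD_sub_counit (u : ι →₀ ℕ) (hu : u ≠ 0) (f : A) :
    divD e b u (f - algebraMap K A (Coalgebra.counit (R := K) f)) = divD e b u f := by
  rw [map_sub, divD_algebraMap e b u hu, sub_zero]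

-- In each factor the projection subtracts the constant term. So it annihilates exactly the
-- derivatives with some exponent zero and preserves the others.
variable (e b) in
theorem dualC_inclPow_projPow (t : Fin n → (ι →₀ ℕ)) (x : TPow K A n) :
    dualC e b t (inclPow K A n (projPow K A n x)) =
      if ∃ j, t j = 0 then 0 else dualC e b t x := by
  have h : dualC e b t ∘ₗ inclPow K A n ∘ₗ projPow K A n =
      if ∃ j, t j = 0 then 0 else dualC e b t := by
    refine PiTensorProduct.ext (MultilinearMap.ext fun f => ?_)
    simp only [LinearMap.compMultilinearMap_apply, LinearMap.comp_apply, inclPow_projPow_tprod,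
      dualC_tprod]
    split_ifs with ht
    · obtain ⟨j, hj⟩ := ht
      rw [Finset.prod_eq_zero (Finset.mem_univ j), mul_zero, LinearMap.zero_apply]
      rw [hj, divD_zero, map_sub]
      exact sub_eq_zero.2 ((Bialgebra.counitAlgHom K A).commutes _).symm
    · rw [dualC_tprod]
      congr 1
      refine Finset.prod_congr rfl fun j _ => ?_
      rw [divD_sub_counit e b _ fun hj => ht ⟨j, hj⟩]
  have h' := LinearMap.congr_fun h x
  rw [LinearMap.comp_apply, LinearMap.comp_apply] at h'
  rw [h']
  split_ifs <;> rfl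

/-- Restriction of the functions to the locus where the variables number `j` vanish. -/
def restrictZero (K A : Type*) [Field K] [CommRing A] [Bialgebra K A] {n : ℕ} (j : Fin n) :
    TPow K A n →ₐ[K] TPow K A n :=
  glueAlg fun i => if i = j then (Algebra.ofId K _).comp (Bialgebra.counitAlgHom K A)
    else atAlg K A i

variable (e b) in
theorem dualC_restrictZero (j : Fin n) (t : Fin n → (ι →₀ ℕ)) (x : TPow K A n) :
    dualC e b t (restrictZero K A j x) = if t j = 0 then dualC e b t x else 0 := by
  rw [dualC_algHom e b fun i => if i = j then none else some i]
  · have h : (∀ i, (if i = j then none else some i) = none → t i = 0) ↔ t j = 0 :=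
      ⟨fun h => h j (if_pos rfl), fun h i hi => by
        by_cases hij : i = j
        · rw [hij, h]
        · rw [if_neg hij] at hi
          exact absurd hi (Option.some_ne_none _)⟩
    simp only [h]
    split_ifs with ht
    · congr 2
      funext i
      rw [pushOption, Finset.sum_eq_single i]
      · by_cases hij : i = j
        · rw [hij, ht, ite_self]
        · rw [if_neg hij, if_pos rfl]
      · intro k _ hk
        refine if_neg fun h => ?_
        split_ifs at h
        exact hk (Option.some_injective _ h)
      · simp
    · rfl
  · intro i ξ
    rw [restrictZero, glueAlg_at', Finset.sum_eq_single i]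
    · by_cases hij : i = j
      · rw [if_pos hij, if_pos hij, if_neg (Option.some_ne_none i).symm, AlgHom.comp_apply,
          Bialgebra.counitAlgHom_apply, counit_gen, map_zero]
      · rw [if_neg hij, if_neg hij, if_pos rfl, atAlg_apply]
    · intro k _ hk
      refine if_neg fun h => ?_
      split_ifs at h
      exact hk (Option.some_injective _ h)
    · simp

/-- The hypothesis says that `y` restricts to zero wherever one of the groups of variables vanishes.
Such elements form an ideal, so the same holds for `y * x`. -/
theorem inclPow_projPow_mul [CharZero K] {y : TPow K A n}
    (hy : ∀ t, (∃ j, t j = 0) → dualC e b t y = 0) (x : TPow K A n) :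
    inclPow K A n (projPow K A n (y * x)) = y * x := by
  refine dualC_ext e b fun t => ?_
  rw [dualC_inclPow_projPow]
  split_ifs with ht
  · obtain ⟨j, hj⟩ := ht
    have h0 : restrictZero K A j y = 0 := dualC_ext e b fun t => by
      rw [dualC_restrictZero, map_zero]
      split_ifs with h
      · exact hy t ⟨j, h⟩
      · rfl
    have h1 := dualC_restrictZero e b j t (y * x)
    rw [map_mul, h0, zero_mul, map_zero, if_pos hj] at h1
    exact h1
  · rfl

/-- When every argument is differentiated, constants in the arguments are not seen. When the
coefficients vanish with each group of variables, so do the values. Hence the passage to the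
augmentation ideal loses nothing. -/
theorem HasSymbol.extHom_resHom [CharZero K] {Φ : TPow K A m →ₗ[K] TPow K A (n + 1)} {Γ}
    (h : HasSymbol e b Φ Γ) (hΓ : ∀ s t, (∃ i, s i = 0) ∨ (∃ j, t j = 0) → Γ s t = 0) :
    extHom K A m (n + 1) (resHom K A m (n + 1) Φ) = Φ := by
  obtain ⟨γ, rfl, hγ⟩ := h
  have h1 : ∀ s x, inclPow K A (n + 1) (projPow K A (n + 1) (γ s * x)) = γ s * x := fun s x =>
    inclPow_projPow_mul (e := e) (b := b) (fun t ht => by rw [hγ, hΓ s t (Or.inr ht)]) x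
  have h2 : ∀ s, (∃ i, s i = 0) → γ s = 0 := fun s hs =>
    dualC_ext e b fun t => by rw [hγ, hΓ s t (Or.inl hs), map_zero]
  refine PiTensorProduct.ext (MultilinearMap.ext fun f => ?_)
  change inclPow K A (n + 1) (projPow K A (n + 1) (jetOp e b (iterComulAlg K A n) m γ
    (inclPow K A m (projPow K A m (PiTensorProduct.tprod K f))))) =
    jetOp e b (iterComulAlg K A n) m γ (PiTensorProduct.tprod K f)
  rw [inclPow_projPow_tprod]
  let S : Fin m → Finset (ι →₀ ℕ) := fun j => (tay e b (f j)).support ∪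
    (tay e b (f j - algebraMap K A (Coalgebra.counit (R := K) (f j)))).support
  rw [jetOp_tprod e b _ γ f S fun j => Finset.subset_union_left, jetOp_tprod e b _ γ _ S
    fun j => Finset.subset_union_right, map_sum, map_sum]
  refine Finset.sum_congr rfl fun s _ => ?_
  rw [h1]
  by_cases hs : ∃ i, s i = 0
  · rw [h2 s hs, zero_mul, zero_mul]
  · congr 1
    refine Finset.prod_congr rfl fun j _ => ?_
    rw [divD_sub_counit e b _ fun hj => hs ⟨j, hj⟩]

end Symbols

/-! ### Expansion of iterated derivatives and of monomials. -/

section Monomials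

variable {K : Type*} [Field K] {V : Type*} [AddCommGroup V] [Module K V]
variable {A : Type*} [CommRing A] [Bialgebra K A] (e : O K V ≃ₐc[K] A)
variable {ι : Type} [Fintype ι] [DecidableEq ι] (b : Module.Basis ι K V) {m n : ℕ}

/-- The product of the factorials of the exponents of a monomial. -/
def expFactorial (u : ι →₀ ℕ) : ℕ := ∏ α, (u α).factorial

theorem exponentFactorial_eq_prod (t : Fin n → (ι →₀ ℕ)) :
    exponentFactorial t = ∏ j, expFactorial (t j) := Fintype.prod_prod_type _

theorem expFactorial_add_single (u : ι →₀ ℕ) (α : ι) :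
    expFactorial (u + Finsupp.single α 1) = expFactorial u * (u α + 1) := by
  have h := exponentFactorial_add_single (n := 1) (fun _ => u) 0 α
  simpa [exponentFactorial_eq_prod] using h

/-- The exponent of the monomial given by a word in the coordinates. -/
def wordExp (w : List ι) : ι →₀ ℕ := (w.map fun α => Finsupp.single α 1).sum

theorem wordExp_cons (α : ι) (w : List ι) : wordExp (α :: w) = wordExp w + Finsupp.single α 1 := by
  rw [wordExp, List.map_cons, List.sum_cons, add_comm]; rfl

/-- Polynomial functions as polynomials in the coordinates. -/
def coordPoly : A →ₐ[K] MvPolynomial ι K :=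
  (MvPolynomial.mapAlgHom (Bialgebra.counitAlgHom K A)).comp (tay e b)

theorem coeff_coordPoly (u : ι →₀ ℕ) (f : A) : MvPolynomial.coeff u (coordPoly e b f) =
    Coalgebra.counit (R := K) (divD e b u f) :=
  MvPolynomial.coeff_map _ _ _

theorem coordPoly_coord (α : ι) : coordPoly e b (gen e (b.coord α)) = MvPolynomial.X α := by
  rw [coordPoly, AlgHom.comp_apply, tay_gen, map_add, map_sum, Finset.sum_eq_single α]
  · rw [Module.Basis.coord_apply, Module.Basis.repr_self, Finsupp.single_eq_same, one_smul,
      MvPolynomial.mapAlgHom_apply, MvPolynomial.mapAlgHom_apply]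
    refine (congrArg₂ (· + ·) (MvPolynomial.map_C _ _) (MvPolynomial.map_X _ _)).trans ?_
    rw [show (Bialgebra.counitAlgHom K A : A →+* K) (gen e (b.coord α)) = 0 from counit_gen e _,
      MvPolynomial.C_0, zero_add]
  · intro β _ hβ
    simp [hβ]
  · simp

theorem counit_divD_prod (w : List ι) (u : ι →₀ ℕ) :
    Coalgebra.counit (R := K) (divD e b u (w.map fun α => gen e (b.coord α)).prod) =
      if u = wordExp w then 1 else 0 := by
  have h : coordPoly e b (w.map fun α => gen e (b.coord α)).prod =
      MvPolynomial.monomial (wordExp w) 1 := by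
    induction w with
    | nil => simp [wordExp]
    | cons α w ih =>
      rw [List.map_cons, List.prod_cons, map_mul, ih, coordPoly_coord, MvPolynomial.X,
        MvPolynomial.monomial_mul, one_mul, wordExp_cons, add_comm]
  rw [← coeff_coordPoly, h, MvPolynomial.coeff_monomial]
  simp only [eq_comm]

theorem counit_prod_gen (J : List (Module.Dual K V)) (hJ : J ≠ []) :
    Coalgebra.counit (R := K) (J.map fun ξ => gen e ξ).prod = 0 := by
  obtain ⟨ξ, J, rfl⟩ := List.exists_cons_of_ne_nil hJ
  rw [List.map_cons, List.prod_cons, ← Bialgebra.counitAlgHom_apply, map_mul,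
    Bialgebra.counitAlgHom_apply, counit_gen, zero_mul]

theorem hasSymbol_of_expansion (D : Fin m → A →ₗ[K] A) (a : Fin m → ((ι →₀ ℕ) →₀ K))
    (hD : ∀ i f, D i f = (a i).sum fun u r => r • divD e b u f) (y : Fin (n + 1) → A) :
    HasSymbol e b (LinearMap.mulLeft K (PiTensorProduct.tprod K y) ∘ₗ
        glue fun i => iterComul K A n ∘ₗ D i)
      fun s t => (∏ i, a i (s i)) *
        ∏ j, (expFactorial (t j) * Coalgebra.counit (R := K) (divD e b (t j) (y j))) := by
  rw [← iterComulAlg_toLinearMap]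
  refine ⟨_, jetOp_of_expansion e b (iterComulAlg K A n) D a hD _, fun s t => ?_⟩
  rw [map_smul, dualC_tprod, exponentFactorial_eq_prod, smul_eq_mul]
  simp only [Finset.prod_mul_distrib, Nat.cast_prod]

/-- The derivative along a vector. -/
def dirD (v : V) : A →ₗ[K] A := ∑ α, b.coord α v • divD e b (Finsupp.single α 1)

/-- The iterated derivative along a list of vectors. -/
def dirOp (I : List V) : Module.End K A := (I.map fun v => (dirD e b v : Module.End K A)).prod

theorem dirOp_cons (v : V) (I : List V) (f : A) :
    dirOp e b (v :: I) f = dirD e b v (dirOp e b I f) := by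
  rw [dirOp, List.map_cons, List.prod_cons]; rfl

theorem dirOp_concat (I : List V) (v : V) (f : A) :
    dirOp e b (I ++ [v]) f = dirOp e b I (dirD e b v f) := by
  rw [dirOp, List.map_append, List.prod_append, List.map_singleton, List.prod_singleton]; rfl

/-- Each derivative raises the exponents by `divD_divD_single`. After at least one derivative the
exponent zero is absent, which yields the normalization in the arguments. -/
theorem exists_dirOp_expansion (I : List V) : ∃ a : (ι →₀ ℕ) →₀ K,
    (∀ f, dirOp e b I f = a.sum fun u r => r • divD e b u f) ∧ (I ≠ [] → a 0 = 0) := by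
  induction I using List.reverseRecOn with
  | nil =>
    refine ⟨Finsupp.single 0 1, fun f => ?_, fun h => absurd rfl h⟩
    refine Eq.trans ?_ (Finsupp.sum_single_index (h := fun u r => r • divD e b u f)
      (zero_smul K _)).symm
    rw [divD_zero, one_smul]
    rfl
  | append_singleton I v ih =>
    obtain ⟨a, ha, -⟩ := ih
    refine ⟨∑ u ∈ a.support, ∑ α, Finsupp.single (u + Finsupp.single α 1)
      (a u * (b.coord α v * ((u α : K) + 1))), fun f => ?_, fun _ => ?_⟩
    · rw [dirOp_concat, ha]
      refine Eq.trans ?_ (Finsupp.sum_finsetSum_index (h := fun u r => r • divD e b u f)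
        (fun _ => zero_smul K _) (fun _ _ _ => add_smul _ _ _))
      rw [Finsupp.sum]
      refine Finset.sum_congr rfl fun u _ => ?_
      refine Eq.trans ?_ (Finsupp.sum_finsetSum_index (h := fun u r => r • divD e b u f)
        (fun _ => zero_smul K _) (fun _ _ _ => add_smul _ _ _))
      rw [dirD, LinearMap.sum_apply, map_sum, Finset.smul_sum]
      refine Finset.sum_congr rfl fun α _ => ?_
      refine Eq.trans ?_ (Finsupp.sum_single_index (h := fun u r => r • divD e b u f)
        (zero_smul K _)).symm
      rw [LinearMap.smul_apply, map_smul, divD_divD_single, mul_smul, mul_smul]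
    · rw [Finsupp.finsetSum_apply]
      refine Finset.sum_eq_zero fun u _ => ?_
      rw [Finsupp.finsetSum_apply]
      refine Finset.sum_eq_zero fun α _ => Finsupp.single_eq_of_ne fun h => ?_
      have := DFunLike.congr_fun h α
      simp at this

theorem dirOp_basis (w : List ι) (f : A) : dirOp e b (w.map b) f =
    (expFactorial (wordExp w) : K) • divD e b (wordExp w) f := by
  induction w using List.reverseRecOn generalizing f with
  | nil =>
    have h : wordExp ([] : List ι) = 0 := rfl
    rw [h, divD_zero]
    simp [dirOp, expFactorial]
  | append_singleton w α ih =>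
    have h : wordExp (w ++ [α]) = wordExp w + Finsupp.single α 1 := by
      simp [wordExp]
    rw [List.map_append, List.map_singleton, dirOp_concat, ih, h, expFactorial_add_single, dirD,
      LinearMap.sum_apply, Finset.sum_eq_single α]
    · rw [LinearMap.smul_apply, map_smul, divD_divD_single]
      simp [smul_smul]
    · intro β _ hβ
      simp [hβ]
    · simp

end Monomials

/-! ### The symbol of an explicit operator. -/

section Operators

universe u v

variable {K : Type u} [Field K] {V : Type v} [AddCommGroup V] [Module K V]
variable {ι : Type} [Fintype ι] [DecidableEq ι] (b : Module.Basis ι K V) {m n : ℕ}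

/-- The algebra of polynomial functions, identified with itself. -/
abbrev eO (K V : Type*) [Field K] [AddCommGroup V] [Module K V] : O K V ≃ₐc[K] O K V :=
  BialgEquiv.refl K (O K V)

/-- Both sides satisfy the Leibniz rule, so they agree once they agree on linear functions. -/
theorem partialD_eq_dirD (v : V) (f : O K V) : partialD K v f = dirD (eO K V) b v f := by
  rw [dirD, LinearMap.sum_apply]
  simp only [LinearMap.smul_apply]
  induction f using gen_induction (eO K V) with
  | halg r =>
    refine ((partialD K v).map_algebraMap r).trans (Finset.sum_eq_zero fun α _ => ?_).symm
    rw [divD_algebraMap _ _ _ (by simp), smul_zero]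
  | hgen ξ =>
    simp only [divD_gen]
    refine (partialD_ι K v ξ).trans ?_
    conv_lhs => rw [← b.sum_repr v, map_sum, map_sum]
    refine Finset.sum_congr rfl fun α _ => ?_
    rw [map_smul, smul_eq_mul, map_mul, Algebra.smul_def]
    rfl
  | hadd f g hf hg => simp only [map_add, hf, hg, smul_add, Finset.sum_add_distrib]
  | hmul f g hf hg =>
    rw [Derivation.leibniz, hf, hg]
    simp only [divD_single_mul, smul_eq_mul, Finset.mul_sum, smul_add, Finset.sum_add_distrib]
    rw [add_comm]
    congr 1
    · refine Finset.sum_congr rfl fun α _ => ?_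
      rw [mul_smul_comm, mul_comm]
    · refine Finset.sum_congr rfl fun α _ => ?_
      rw [mul_smul_comm]

theorem diffOp_eq_dirOp (I : List V) (f : O K V) : diffOp K I f = dirOp (eO K V) b I f := by
  induction I with
  | nil => rfl
  | cons v I ih =>
    rw [dirOp_cons, ← ih, ← partialD_eq_dirD]
    rfl

theorem hasSymbol_polyOpFull (I : Fin m → List V) (J : Fin (n + 1) → List (Module.Dual K V))
    (a : Fin m → ((ι →₀ ℕ) →₀ K))
    (ha : ∀ i f, dirOp (eO K V) b (I i) f = (a i).sum fun u r => r • divD (eO K V) b u f) :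
    HasSymbol.{u, v, max v u} (eO K V) b (polyOpFull K I J) fun s t => (∏ i, a i (s i)) *
        ∏ j, (expFactorial (t j) * Coalgebra.counit (R := K)
          (divD (eO K V) b (t j) ((J j).map fun ξ => gen (eO K V) ξ).prod)) := by
  exact hasSymbol_of_expansion (eO K V) b (fun i => diffOp K (I i)) a
    (fun i f => (diffOp_eq_dirOp b (I i) f).trans (ha i f))
    fun j => ((J j).map fun ξ => gen (eO K V) ξ).prod

end Operators

/-! ### Multinomial counting of labelled partitions. -/

section Counting

theorem card_perm_fixing {X Y : Type*} [Fintype X] [DecidableEq X] [Fintype Y] [DecidableEq Y]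
    (f : X → Y) : (Finset.univ.filter fun σ : Equiv.Perm X => f ∘ σ = f).card =
      ∏ y, (Finset.univ.filter fun x => f x = y).card.factorial := by
  rw [← Fintype.card_subtype, DomMulAct.stabilizer_card f]
  simp only [Fintype.card_subtype]

/-- The functions with the same joint fibres with `f` as `g` are counted by the multinomial
coefficients of the fibres. -/
theorem card_joint_fibers {X Y Z : Type*} [Fintype X] [DecidableEq X] [Fintype Y] [DecidableEq Y]
    [Fintype Z] [DecidableEq Z] (f : X → Y) (g : X → Z) :
    (Finset.univ.filter fun h : X → Z => ∀ p : Y × Z,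
        (Finset.univ.filter fun x => (f x, h x) = p).card =
          (Finset.univ.filter fun x => (f x, g x) = p).card).card *
      ∏ p : Y × Z, (Finset.univ.filter fun x => (f x, g x) = p).card.factorial =
    ∏ y, (Finset.univ.filter fun x => f x = y).card.factorial := by
  rw [← card_perm_fixing f, ← card_perm_fixing fun x => (f x, g x)]
  -- Orbit and stabilizer: the permutations preserving `f` are sorted according to `g ∘ σ`, and each
  -- class is a coset of the group preserving both `f` and `g`.
  rw [Finset.card_eq_sum_card_fiberwise (f := fun σ : Equiv.Perm X => g ∘ σ)
    (s := Finset.univ.filter fun σ : Equiv.Perm X => f ∘ σ = f)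
    (t := Finset.univ.filter fun h : X → Z => ∀ p : Y × Z,
        (Finset.univ.filter fun x => (f x, h x) = p).card =
          (Finset.univ.filter fun x => (f x, g x) = p).card),
    Finset.sum_const_nat (m := (Finset.univ.filter fun σ : Equiv.Perm X =>
      (fun x => (f x, g x)) ∘ σ = fun x => (f x, g x)).card)]
  · intro h hh
    obtain ⟨σ, hσ⟩ := exists_perm_of_card_fiber (fun x => (f x, h x)) (fun x => (f x, g x))
      (Finset.mem_filter.1 hh).2
    simp only [Prod.mk.injEq, forall_and] at hσ
    refine (Finset.card_bij (fun ρ _ => ρ * σ) ?_ (fun _ _ _ _ h => mul_right_cancel h) ?_).symm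
    · intro ρ hρ
      simp only [Finset.mem_filter, Finset.mem_univ, true_and, funext_iff, Function.comp_apply,
        Prod.mk.injEq, forall_and, Equiv.Perm.mul_apply] at hρ ⊢
      exact ⟨fun x => by rw [hρ.1, hσ.1], fun x => by rw [hρ.2, hσ.2]⟩
    · intro τ hτ
      simp only [Finset.mem_filter, Finset.mem_univ, true_and, funext_iff, Function.comp_apply]
        at hτ
      refine ⟨τ * σ.symm, ?_, inv_mul_cancel_right _ _⟩
      simp only [Finset.mem_filter, Finset.mem_univ, true_and, funext_iff, Function.comp_apply,
        Prod.mk.injEq, forall_and, Equiv.Perm.mul_apply]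
      refine ⟨fun x => ?_, fun x => ?_⟩
      · rw [hτ.1, ← hσ.1, Equiv.apply_symm_apply]
      · rw [hτ.2, ← hσ.2, Equiv.apply_symm_apply]
  · intro σ hσ
    simp only [Finset.coe_filter, Finset.mem_univ, true_and, Set.mem_ofPred_eq, funext_iff,
      Function.comp_apply] at hσ ⊢
    intro p
    refine Finset.card_bij (fun x _ => σ x) (fun x hx => ?_) (fun _ _ _ _ h => σ.injective h)
      fun y hy => ⟨σ.symm y, ?_, σ.apply_symm_apply y⟩
    · simpa [hσ] using hx
    · simpa [← hσ (σ.symm y)] using hy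

variable {ι : Type} [Fintype ι] [DecidableEq ι]

/-- To have given contents is to have prescribed joint fibres with `π`, whose cardinalities are the
exponents; `card_joint_fibers` then applies. -/
theorem sum_content_eq {m k : ℕ} (π : Fin m → Fin k) (I : Fin m → ι) :
    (Finset.univ.filter fun J : Fin m → ι => content π J = content π I).card *
      ∏ i, expFactorial (content π I i) =
    ∏ i, (Finset.univ.filter fun t => π t = i).card.factorial := by
  rw [← card_joint_fibers π I, Fintype.prod_prod_type]
  congr 2
  · ext J
    simp only [Finset.mem_filter, Finset.mem_univ, true_and, funext_iff, Finsupp.ext_iff,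
      content_apply, Prod.forall]
  · simp only [expFactorial, content_apply]

theorem length_block {m k : ℕ} (π : OrdPart m k) (i : Fin k) :
    (block π i).length = (Finset.univ.filter fun t => π.1 t = i).card := by
  rw [block, ← List.toFinset_card_of_nodup ((List.nodup_finRange m).filter _)]
  congr 1
  ext t
  simp

theorem wordExp_block {m k : ℕ} (π : OrdPart m k) (I : Fin m → ι) (i : Fin k) :
    wordExp ((block π i).map I) = content π.1 I i := by
  rw [wordExp, List.map_map, content, push_apply, block,
    ← List.sum_toFinset _ ((List.nodup_finRange m).filter _)]
  refine Finset.sum_congr ?_ fun _ _ => rfl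
  ext t
  simp

theorem block_ne_nil {m k : ℕ} (π : OrdPart m k) (i : Fin k) : block π i ≠ [] := by
  obtain ⟨t, ht⟩ := π.2 i
  exact List.ne_nil_of_mem (a := t) (by simp [block, ht])

theorem degree_content {m k : ℕ} (π : Fin m → Fin k) (I : Fin m → ι) (i : Fin k) :
    (content π I i).degree = (Finset.univ.filter fun t => π t = i).card := by
  simp [content, push_apply, map_sum, Finsupp.degree_single]

theorem mem_stdPart {m k : ℕ} (π : OrdPart m k) : π ∈ stdPart m k ↔ Monotone π.1 := by
  simp [stdPart]

/-- Consecutive blocks are determined by their contents. -/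
theorem eq_of_content_eq {m k : ℕ} {π π' : Fin m → Fin k} (hπ : Monotone π) (hπ' : Monotone π')
    {I I' : Fin m → ι} (h : content π I = content π' I') : π = π' := by
  obtain ⟨σ, hσ⟩ := exists_perm_of_card_fiber π π' fun i => by
    rw [← degree_content π I, h, degree_content]
  have h1 : π' ∘ σ = π := funext hσ
  -- Equal contents give equal block sizes, so the two maps are rearrangements of each other, and
  -- only one rearrangement is monotone.
  have := Tuple.unique_monotone (f := π') (σ := σ) (τ := 1) (by rwa [h1]) hπ'
  rw [← h1, this]
  rfl

theorem exists_stdPart_content_eq {m k : ℕ} (s : Fin k → (ι →₀ ℕ)) (hs : ∀ i, s i ≠ 0)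
    (hm : ∑ i, (s i).degree = m) :
    ∃ π ∈ stdPart m k, ∃ I : Fin m → ι, content π.1 I = s := by
  obtain ⟨π, I, hI⟩ := exists_content_eq s hm
  -- Sorting the legs by their blocks makes the blocks consecutive and keeps the contents.
  set σ := Tuple.sort π
  have h : content (π ∘ σ) (I ∘ σ) = s := by
    rw [← hI]
    ext i α
    rw [content_apply, content_apply]
    exact Finset.card_bij (fun t _ => σ t) (by simp) (by simp)
      (fun t ht => ⟨σ.symm t, by simpa using ht, by simp⟩)
  have hsurj : Function.Surjective (π ∘ σ) := fun i => by
    have hi : (Finset.univ.filter fun t => (π ∘ σ) t = i).card ≠ 0 := by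
      rw [← degree_content (π ∘ σ) (I ∘ σ), h, Ne, Finsupp.degree_eq_zero_iff]
      exact hs i
    obtain ⟨t, ht⟩ := Finset.card_ne_zero.1 hi
    exact ⟨t, by simpa using ht⟩
  exact ⟨⟨_, hsurj⟩, (mem_stdPart _).2 (Tuple.monotone_sort π), _, h⟩

/-- The multinomial weights of the labelled partitions with consecutive blocks of given
contents add up to one. -/
theorem sum_stdPart {K : Type*} [Field K] [CharZero K] {m k : ℕ} (s : Fin k → (ι →₀ ℕ))
    (hs : ∀ i, s i ≠ 0) (hm : ∑ i, (s i).degree = m) :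
    ∑ π ∈ stdPart m k, ∑ I : Fin m → ι, (blockFactorial π : K)⁻¹ *
      (if content π.1 I = s then ∏ i, (expFactorial (s i) : K) else 0) = 1 := by
  obtain ⟨π, hπ, I, hI⟩ := exists_stdPart_content_eq s hs hm
  -- Only one partition into consecutive blocks has the given contents. Its labellings are counted
  -- by a product of multinomial coefficients, which the weights cancel.
  rw [Finset.sum_eq_single_of_mem π hπ]
  · rw [← Finset.mul_sum, ← Finset.sum_filter, Finset.sum_const, ← hI, nsmul_eq_mul,
      ← Nat.cast_prod, ← Nat.cast_mul, sum_content_eq, blockFactorial]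
    simp only [length_block]
    refine inv_mul_cancel₀ (Nat.cast_ne_zero.2 (Finset.prod_ne_zero_iff.2 fun i _ =>
      Nat.factorial_ne_zero _))
  · intro π' hπ' hne
    refine Finset.sum_eq_zero fun J _ => ?_
    rw [if_neg, mul_zero]
    rintro rfl
    exact hne (Subtype.ext (eq_of_content_eq ((mem_stdPart _).1 hπ') ((mem_stdPart _).1 hπ)
      hI.symm))

end Counting

/-! ### Components of the total differential. -/

section Components

variable {K : Type*} [Field K] {A : Type*} [CommRing A] [Bialgebra K A]

/-- The components of the first Gerstenhaber–Schack differential. -/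
def d1Part (X : CFull K A) : ∀ q : ℕ × ℕ, TPow K A (q.1 + 1) →ₗ[K] TPow K A (q.2 + 1)
  | (0, _) => 0
  | (a + 1, c) => d1 K A (a + 1) c (X (a, c))

/-- The components of the second Gerstenhaber–Schack differential. -/
def d2Part (X : CFull K A) : ∀ q : ℕ × ℕ, TPow K A (q.1 + 1) →ₗ[K] TPow K A (q.2 + 1)
  | (_, 0) => 0
  | (a, c + 1) => d2 K A (a + 1) (c + 1) (X (a, c))

theorem d1Part_add (X X' : CFull K A) (q : ℕ × ℕ) :
    d1Part (X + X') q = d1Part X q + d1Part X' q := by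
  obtain ⟨_ | a, c⟩ := q
  · exact (add_zero _).symm
  · exact map_add (d1 K A (a + 1) c) (X (a, c)) (X' (a, c))

theorem d2Part_add (X X' : CFull K A) (q : ℕ × ℕ) :
    d2Part (X + X') q = d2Part X q + d2Part X' q := by
  obtain ⟨a, _ | c⟩ := q
  · exact (add_zero _).symm
  · exact map_add (d2 K A (a + 1) (c + 1)) (X (a, c)) (X' (a, c))

theorem d1Part_lof (p : ℕ × ℕ) (x : TPow K A (p.1 + 1) →ₗ[K] TPow K A (p.2 + 1)) (q : ℕ × ℕ) :
    d1Part (DirectSum.lof K (ℕ × ℕ) (fun p => TPow K A (p.1 + 1) →ₗ[K] TPow K A (p.2 + 1)) p x) q =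
      DirectSum.lof K (ℕ × ℕ) (fun p => TPow K A (p.1 + 1) →ₗ[K] TPow K A (p.2 + 1))
        (p.1 + 1, p.2) (d1 K A (p.1 + 1) p.2 x) q := by
  by_cases h : q = (p.1 + 1, p.2)
  · subst h
    exact (congrArg (d1 K A (p.1 + 1) p.2) (DirectSum.lof_apply K
      (M := fun p : ℕ × ℕ => TPow K A (p.1 + 1) →ₗ[K] TPow K A (p.2 + 1)) p x)).trans
      (DirectSum.lof_apply K (M := fun p : ℕ × ℕ => TPow K A (p.1 + 1) →ₗ[K] TPow K A (p.2 + 1))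
        (p.1 + 1, p.2) (d1 K A (p.1 + 1) p.2 x)).symm
  · refine Eq.trans ?_ (DirectSum.of_eq_of_ne
      (β := fun p : ℕ × ℕ => TPow K A (p.1 + 1) →ₗ[K] TPow K A (p.2 + 1)) (p.1 + 1, p.2) q (d1 K A (p.1 + 1) p.2 x) h).symm
    obtain ⟨_ | a, c⟩ := q
    · rfl
    · have h' : (a, c) ≠ p := fun h' => h (by rw [← h'])
      exact (congrArg (d1 K A (a + 1) c) (DirectSum.of_eq_of_ne
        (β := fun p : ℕ × ℕ => TPow K A (p.1 + 1) →ₗ[K] TPow K A (p.2 + 1))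
        p (a, c) x h')).trans
        (map_zero _)

theorem d2Part_lof (p : ℕ × ℕ) (x : TPow K A (p.1 + 1) →ₗ[K] TPow K A (p.2 + 1)) (q : ℕ × ℕ) :
    d2Part (DirectSum.lof K (ℕ × ℕ) (fun p => TPow K A (p.1 + 1) →ₗ[K] TPow K A (p.2 + 1)) p x) q =
      DirectSum.lof K (ℕ × ℕ) (fun p => TPow K A (p.1 + 1) →ₗ[K] TPow K A (p.2 + 1))
        (p.1, p.2 + 1) (d2 K A (p.1 + 1) (p.2 + 1) x) q := by
  by_cases h : q = (p.1, p.2 + 1)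
  · subst h
    exact (congrArg (d2 K A (p.1 + 1) (p.2 + 1)) (DirectSum.lof_apply K
      (M := fun p : ℕ × ℕ => TPow K A (p.1 + 1) →ₗ[K] TPow K A (p.2 + 1)) p x)).trans
      (DirectSum.lof_apply K (M := fun p : ℕ × ℕ => TPow K A (p.1 + 1) →ₗ[K] TPow K A (p.2 + 1))
        (p.1, p.2 + 1) (d2 K A (p.1 + 1) (p.2 + 1) x)).symm
  · refine Eq.trans ?_
      (DirectSum.of_eq_of_ne
      (β := fun p : ℕ × ℕ => TPow K A (p.1 + 1) →ₗ[K] TPow K A (p.2 + 1)) (p.1, p.2 + 1) q (d2 K A (p.1 + 1) (p.2 + 1) x) h).symm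
    obtain ⟨a, _ | c⟩ := q
    · rfl
    · have h' : (a, c) ≠ p := fun h' => h (by rw [← h'])
      exact (congrArg (d2 K A (a + 1) (c + 1)) (DirectSum.of_eq_of_ne
        (β := fun p : ℕ × ℕ => TPow K A (p.1 + 1) →ₗ[K] TPow K A (p.2 + 1))
        p (a, c) x h')).trans
        (map_zero _)

theorem dFull_apply (X : CFull K A) (q : ℕ × ℕ) :
    dFull K A X q = d1Part X q + (-1 : K) ^ (q.1 + 1) • d2Part X q := by
  induction X using DirectSum.induction_on with
  | zero =>
    rw [map_zero, DirectSum.zero_apply]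
    obtain ⟨_ | a, _ | c⟩ := q
    all_goals simp [d1Part, d2Part]
  | add X X' h h' =>
    rw [map_add, DirectSum.add_apply, h, h', d1Part_add, d2Part_add, smul_add]
    abel
  | of p x =>
    have hx := DirectSum.toModule_lof (R := K) (φ := fun p : ℕ × ℕ =>
      DirectSum.lof K (ℕ × ℕ) (fun p => TPow K A (p.1 + 1) →ₗ[K] TPow K A (p.2 + 1))
        (p.1 + 1, p.2) ∘ₗ d1 K A (p.1 + 1) p.2
      + (-1 : K) ^ (p.1 + 1) •
      (DirectSum.lof K (ℕ × ℕ) (fun p => TPow K A (p.1 + 1) →ₗ[K] TPow K A (p.2 + 1))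
        (p.1, p.2 + 1) ∘ₗ d2 K A (p.1 + 1) (p.2 + 1))) p x
    refine (DFunLike.congr_fun hx q).trans ?_
    rw [LinearMap.add_apply, LinearMap.smul_apply, DirectSum.add_apply, DirectSum.smul_apply,
      LinearMap.comp_apply, LinearMap.comp_apply, ← d1Part_lof, ← d2Part_lof]
    refine congrArg (_ + ·) ?_
    -- The sign comes from the first index of the source and is claimed for that of the target. The
    -- second differential preserves this index, so the signs agree wherever the term is nonzero.
    by_cases h : q.1 = p.1
    · refine congrArg (· • _) ?_
      rw [h]
    · have h0 : d2Part (DirectSum.lof K (ℕ × ℕ)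
          (fun p => TPow K A (p.1 + 1) →ₗ[K] TPow K A (p.2 + 1)) p x) q = 0 := by
        rw [d2Part_lof]
        exact DirectSum.of_eq_of_ne _ _ _ fun h' => h (by rw [h'])
      rw [h0, smul_zero]
      exact (smul_eq_zero_of_right _ h0).symm

theorem ext_apply (Φ : C K A) (q : ℕ × ℕ) : ext K A Φ q = extHom K A (q.1 + 1) (q.2 + 1) (Φ q) :=
  DirectSum.lmap_apply (fun p : ℕ × ℕ => extHom K A (p.1 + 1) (p.2 + 1)) Φ q

theorem res_apply (X : CFull K A) (q : ℕ × ℕ) :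
    res K A X q = resHom K A (q.1 + 1) (q.2 + 1) (X q) :=
  DirectSum.lmap_apply (fun p : ℕ × ℕ => resHom K A (p.1 + 1) (p.2 + 1)) X q

end Components

/-! ### Cochains with a given symbol. -/

section Represents

variable {K : Type*} [Field K] {V : Type*} [AddCommGroup V] [Module K V]
variable {A : Type*} [CommRing A] [Bialgebra K A] (e : O K V ≃ₐc[K] A)
variable {ι : Type} [Fintype ι] [DecidableEq ι] (b : Module.Basis ι K V)

/-- All the components of the cochain `Φ` are polydifferential operators, with symbol `Γ`. -/
def Represents (Φ : C K A) (Γ : List (ι →₀ ℕ) → List (ι →₀ ℕ) → K) : Prop :=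
  ∀ q : ℕ × ℕ, HasSymbol e b (ext K A Φ q) fun s t => Γ (List.ofFn s) (List.ofFn t)

variable {e b}

theorem HasSymbol.congr {m n : ℕ} {Φ : TPow K A m →ₗ[K] TPow K A (n + 1)} {Γ Γ'}
    (h : HasSymbol e b Φ Γ) (hΓ : ∀ s t, Γ s t = Γ' s t) : HasSymbol e b Φ Γ' := by
  rwa [show Γ' = Γ from funext fun s => funext fun t => (hΓ s t).symm]

theorem Represents.zero : Represents e b (0 : C K A) 0 := fun q => by
  rw [map_zero]
  exact HasSymbol.zero

theorem Represents.add {Φ Ψ : C K A} {Γ Γ'} (h : Represents e b Φ Γ) (h' : Represents e b Ψ Γ') :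
    Represents e b (Φ + Ψ) (Γ + Γ') := fun q => by
  rw [map_add]
  exact (h q).add (h' q)

theorem Represents.smul (r : K) {Φ : C K A} {Γ} (h : Represents e b Φ Γ) :
    Represents e b (r • Φ) (r • Γ) := fun q => by
  rw [map_smul]
  exact (h q).smul r

theorem Represents.sum {T : Type*} (S : Finset T) {Φ : T → C K A}
    {Γ : T → List (ι →₀ ℕ) → List (ι →₀ ℕ) → K} (h : ∀ i ∈ S, Represents e b (Φ i) (Γ i)) :
    Represents e b (∑ i ∈ S, Φ i) (∑ i ∈ S, Γ i) := by
  classical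
  induction S using Finset.induction_on with
  | empty => exact Represents.zero
  | insert i S hi ih =>
    rw [Finset.sum_insert hi, Finset.sum_insert hi]
    exact (h i (Finset.mem_insert_self i S)).add
      (ih fun j hj => h j (Finset.mem_insert_of_mem hj))

theorem Represents.cochain_unique [CharZero K] {Φ Ψ : C K A} {Γ} (h : Represents e b Φ Γ)
    (h' : Represents e b Ψ Γ) : Φ = Ψ := by
  refine DFinsupp.ext fun q => ?_
  have := congrArg (resHom K A (q.1 + 1) (q.2 + 1)) ((h q).op_unique (h' q))
  rwa [ext_apply, ext_apply, resHom_extHom, resHom_extHom] at this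

theorem Represents.symbol_eq {Φ : C K A} {Γ Γ'} (h : Represents e b Φ Γ)
    (h' : Represents e b Φ Γ') {w w' : List (ι →₀ ℕ)} (hw : w ≠ []) (hw' : w' ≠ []) :
    Γ w w' = Γ' w w' := by
  obtain ⟨α, w, rfl⟩ := List.exists_cons_of_ne_nil hw
  obtain ⟨β, w', rfl⟩ := List.exists_cons_of_ne_nil hw'
  have := congrFun (congrFun ((h (w.length, w'.length)).symbol_unique (h' (w.length, w'.length)))
    (α :: w).get) (β :: w').get
  simp only at this
  rwa [List.ofFn_get, List.ofFn_get] at this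

theorem zero_mem_ofFn {k : ℕ} (s : Fin k → (ι →₀ ℕ)) : 0 ∈ List.ofFn s ↔ ∃ i, s i = 0 := by
  simp [List.mem_ofFn]

theorem ofFn_ne_nil {k : ℕ} (s : Fin (k + 1) → (ι →₀ ℕ)) : List.ofFn s ≠ [] := by simp

/-- The condition on a pair of families of multi-indices to be nonempty with nonempty members. -/
abbrev Proper (w w' : List (ι →₀ ℕ)) : Prop := (w ≠ [] ∧ 0 ∉ w) ∧ (w' ≠ [] ∧ 0 ∉ w')

theorem HasSymbol.d1Part {X : CFull K A} {Γ : List (ι →₀ ℕ) → List (ι →₀ ℕ) → K}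
    (h : ∀ q : ℕ × ℕ, HasSymbol e b (X q) fun s t => Γ (List.ofFn s) (List.ofFn t))
    (hΓ : ∀ w w', ¬ Proper w w' → Γ w w' = 0) (q : ℕ × ℕ) :
    HasSymbol e b (d1Part X q) fun s t => if Proper (List.ofFn s) (List.ofFn t) then
      listD (fun v => Γ v (List.ofFn t)) (List.ofFn s) else 0 := by
  classical
  obtain ⟨_ | a, c⟩ := q
  -- No component of d¹ ends in cochains of one argument, in agreement with `listD` vanishing on
  -- lists of one entry.
  · have h0 : HasSymbol e b (PolyGS.d1Part X (0, c)) 0 := HasSymbol.zero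
    refine h0.congr fun s t => ?_
    obtain ⟨α, hα⟩ : ∃ α, List.ofFn s = [α] := ⟨_, List.ofFn_succ⟩
    rw [hα, listD_singleton, ite_self]
    rfl
  · have h1 : HasSymbol e b (PolyGS.d1Part X (a + 1, c)) _ := (h (a, c)).d1
    refine h1.congr fun s t => ?_
    rw [faceSum_of_normalized _ fun s hs => hΓ _ _ fun hp => hp.1.2 ((zero_mem_ofFn s).2 hs),
      listD_ofFn (K := K)]
    by_cases hs : ∃ i, s i = 0
    · rw [if_pos hs, if_neg fun hp => hp.1.2 ((zero_mem_ofFn s).2 hs)]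
    · rw [if_neg hs]
      by_cases ht : ∃ i, t i = 0
      · rw [if_neg fun hp => hp.2.2 ((zero_mem_ofFn t).2 ht)]
        refine Finset.sum_eq_zero fun i _ => ?_
        rw [hΓ _ _ fun hp => hp.2.2 ((zero_mem_ofFn t).2 ht), mul_zero]
      · rw [if_pos ⟨⟨ofFn_ne_nil s, fun h => hs ((zero_mem_ofFn s).1 h)⟩,
          ⟨ofFn_ne_nil t, fun h => ht ((zero_mem_ofFn t).1 h)⟩⟩]
        rfl

theorem HasSymbol.d2Part {X : CFull K A} {Γ : List (ι →₀ ℕ) → List (ι →₀ ℕ) → K}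
    (h : ∀ q : ℕ × ℕ, HasSymbol e b (X q) fun s t => Γ (List.ofFn s) (List.ofFn t))
    (hΓ : ∀ w w', ¬ Proper w w' → Γ w w' = 0) (q : ℕ × ℕ) :
    HasSymbol e b (d2Part X q) fun s t => if Proper (List.ofFn s) (List.ofFn t) then
      listD (Γ (List.ofFn s)) (List.ofFn t) else 0 := by
  classical
  obtain ⟨a, _ | c⟩ := q
  · have h0 : HasSymbol e b (PolyGS.d2Part X (a, 0)) 0 := HasSymbol.zero
    refine h0.congr fun s t => ?_
    obtain ⟨α, hα⟩ : ∃ α, List.ofFn t = [α] := ⟨_, List.ofFn_succ⟩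
    rw [hα, listD_singleton, ite_self]
    rfl
  · have h1 : HasSymbol e b (PolyGS.d2Part X (a, c + 1)) _ := (h (a, c)).d2
    refine h1.congr fun s t => ?_
    rw [faceSum_of_normalized _ fun t ht => hΓ _ _ fun hp => hp.2.2 ((zero_mem_ofFn t).2 ht),
      listD_ofFn (K := K)]
    by_cases ht : ∃ i, t i = 0
    · rw [if_pos ht, if_neg fun hp => hp.2.2 ((zero_mem_ofFn t).2 ht)]
    · rw [if_neg ht]
      by_cases hs : ∃ i, s i = 0
      · rw [if_neg fun hp => hp.1.2 ((zero_mem_ofFn s).2 hs)]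
        refine Finset.sum_eq_zero fun i _ => ?_
        rw [hΓ _ _ fun hp => hp.1.2 ((zero_mem_ofFn s).2 hs), mul_zero]
      · rw [if_pos ⟨⟨ofFn_ne_nil s, fun h => hs ((zero_mem_ofFn s).1 h)⟩,
          ⟨ofFn_ne_nil t, fun h => ht ((zero_mem_ofFn t).1 h)⟩⟩]
        rfl

/-- The symbol of the Gerstenhaber–Schack differential. -/
def properTotD (Γ : List (ι →₀ ℕ) → List (ι →₀ ℕ) → K) (w w' : List (ι →₀ ℕ)) : K :=
  if Proper w w' then totD Γ w w' else 0

theorem properTotD_eq_zero (Γ : List (ι →₀ ℕ) → List (ι →₀ ℕ) → K) {w w' : List (ι →₀ ℕ)}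
    (h : ¬ Proper w w') : properTotD Γ w w' = 0 := if_neg h

/-- The sign (-1)^m of the total differential is given by the length of the first list, as in
`totD`. -/
theorem Represents.dFull {Φ : C K A} {Γ} (h : Represents e b Φ Γ)
    (hΓ : ∀ w w', ¬ Proper w w' → Γ w w' = 0) (q : ℕ × ℕ) :
    HasSymbol e b (dFull K A (ext K A Φ) q)
      fun s t => properTotD Γ (List.ofFn s) (List.ofFn t) := by
  rw [dFull_apply]
  refine ((HasSymbol.d1Part h hΓ q).add
    ((HasSymbol.d2Part h hΓ q).smul ((-1) ^ (q.1 + 1)))).congr fun s t => ?_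
  simp only [properTotD, totD, Pi.add_apply, Pi.smul_apply, smul_eq_mul, List.length_ofFn]
  split_ifs <;> simp

/-- The differential has again a normalized symbol, so restricting it to the augmentation ideal and
extending it back changes nothing. -/
theorem Represents.ext_dGS [CharZero K] {Φ : C K A} {Γ} (h : Represents e b Φ Γ)
    (hΓ : ∀ w w', ¬ Proper w w' → Γ w w' = 0) :
    ext K A (dGS K A Φ) = PolyGS.dFull K A (ext K A Φ) := by
  refine DFinsupp.ext fun q => ?_
  rw [ext_apply]
  refine (congrArg _ (res_apply (PolyGS.dFull K A (ext K A Φ)) q)).trans ?_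
  refine HasSymbol.extHom_resHom (h.dFull hΓ q) fun s t hst => properTotD_eq_zero _ fun hp => ?_
  rcases hst with hs | ht
  · exact hp.1.2 ((zero_mem_ofFn s).2 hs)
  · exact hp.2.2 ((zero_mem_ofFn t).2 ht)

theorem Represents.dGS [CharZero K] {Φ : C K A} {Γ} (h : Represents e b Φ Γ)
    (hΓ : ∀ w w', ¬ Proper w w' → Γ w w' = 0) :
    Represents e b (dGS K A Φ) (properTotD Γ) := fun q => by
  rw [h.ext_dGS hΓ]
  exact h.dFull hΓ q

theorem Represents.lof [CharZero K] {q : ℕ × ℕ}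
    {F : TPow K A (q.1 + 1) →ₗ[K] TPow K A (q.2 + 1)}
    {Γ : List (ι →₀ ℕ) → List (ι →₀ ℕ) → K}
    (h : HasSymbol e b F fun s t => Γ (List.ofFn s) (List.ofFn t))
    (hΓ : ∀ w w', ¬ Proper w w' → Γ w w' = 0)
    (hq : ∀ w w', w.length ≠ q.1 + 1 ∨ w'.length ≠ q.2 + 1 → Γ w w' = 0) :
    Represents e b (DirectSum.lof K (ℕ × ℕ) (fun p => Cochain K A (p.1 + 1) (p.2 + 1)) q
      (resHom K A (q.1 + 1) (q.2 + 1) F)) Γ := fun p => by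
  by_cases hp : p = q
  · subst hp
    rw [ext_apply, DirectSum.lof_apply, HasSymbol.extHom_resHom h]
    · exact h
    · rintro s t (hs | ht)
      · exact hΓ _ _ fun hp => hp.1.2 ((zero_mem_ofFn s).2 hs)
      · exact hΓ _ _ fun hp => hp.2.2 ((zero_mem_ofFn t).2 ht)
  · rw [ext_apply, DirectSum.lof_eq_of, DirectSum.of_eq_of_ne _ _ _ hp, map_zero]
    refine HasSymbol.zero.congr fun s t => (hq _ _ ?_).symm
    rw [List.length_ofFn, List.length_ofFn]
    by_contra! hc
    exact hp (Prod.ext (by omega) (by omega))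

end Represents

/-! ### The total weight of a list. -/

section Weights

variable {K : Type*} [Field K] {ι : Type} [Fintype ι] [DecidableEq ι]

/-- The product of the factorials of the entries of a list of multi-indices. -/
def listFactorial (w : List (ι →₀ ℕ)) : K := (w.map fun u => (expFactorial u : K)).prod

theorem listFactorial_ofFn {k : ℕ} (s : Fin k → (ι →₀ ℕ)) :
    (listFactorial (List.ofFn s) : K) = ∏ i, (expFactorial (s i) : K) := by
  rw [listFactorial, List.map_ofFn, List.prod_ofFn]
  rfl

theorem wdeg_ofFn {k : ℕ} (s : Fin k → (ι →₀ ℕ)) : wdeg (List.ofFn s) = ∑ i, (s i).degree := by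
  rw [wdeg, List.map_ofFn, List.sum_ofFn]
  rfl

theorem sum_stdPart_cont [CharZero K] {m : ℕ} {w : List (ι →₀ ℕ)} (hw : w ≠ [] ∧ 0 ∉ w)
    (hm : wdeg w = m) :
    ∑ k ∈ Finset.range m, ∑ π ∈ stdPart m (k + 1), ∑ I : Fin m → ι, (blockFactorial π : K)⁻¹ *
      (if w = cont ⟨k + 1, π⟩ I then listFactorial w else 0) = 1 := by
  obtain ⟨α, v, rfl⟩ := List.exists_cons_of_ne_nil hw.1
  set w := α :: v with hwdef
  obtain ⟨s, hs⟩ : ∃ s : Fin (v.length + 1) → (ι →₀ ℕ), w = List.ofFn s :=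
    ⟨w.get, (List.ofFn_get w).symm⟩
  have hs0 : ∀ i, s i ≠ 0 := fun i hi => hw.2 (hs ▸ (zero_mem_ofFn s).2 ⟨i, hi⟩)
  have hm' : ∑ i, (s i).degree = m := by rw [← wdeg_ofFn, ← hs, hm]
  rw [Finset.sum_eq_single v.length]
  · rw [← sum_stdPart (K := K) s hs0 hm']
    refine Finset.sum_congr rfl fun π _ => Finset.sum_congr rfl fun I _ => ?_
    rw [hs, cont, listFactorial_ofFn]
    simp only [List.ofFn_injective.eq_iff, eq_comm]
  · intro k _ hk
    refine Finset.sum_eq_zero fun π _ => Finset.sum_eq_zero fun I _ => ?_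
    rw [if_neg, mul_zero]
    intro h
    have := congrArg List.length h
    rw [length_cont, hwdef, List.length_cons] at this
    exact hk (by simpa using this.symm)
  -- The blocks are nonempty, so there are at most `m` of them, and the length of the list cannot
  -- fall outside the range.
  · intro hk
    obtain ⟨π, -, -⟩ := exists_stdPart_content_eq s hs0 hm'
    have := Fintype.card_le_of_surjective _ π.2
    simp only [Fintype.card_fin, Finset.mem_range] at this hk
    omega

end Weights

/-! ### The comparison map preserves symbols. -/

section Operators

universe u v

variable {K : Type u} [Field K] [CharZero K] {V : Type v} [AddCommGroup V] [Module K V]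
variable {ι : Type} [Fintype ι] [DecidableEq ι] (b : Module.Basis ι K V)

/-- The symbol is a weighted delta function. A derivative along a word of exponent u is u! times the
divided one, and ∂^t at the origin of the monomial of exponent u is u! for t = u and zero otherwise;
`listFactorial` collects these factorials. -/
theorem represents_polyOp_block {m n k l : ℕ} (π : OrdPart m (k + 1)) (κ : OrdPart n (l + 1))
    (I : Fin m → ι) (J : Fin n → ι) :
    Represents.{u, v, max v u} (eO K V) b (inC K k l (polyOp K (fun i => (block π i).map fun t => b (I t))
        (fun j => (block κ j).map fun s => b.coord (J s))))
      fun w w' => (if w = cont ⟨k + 1, π⟩ I then listFactorial w else 0) *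
        (if w' = cont ⟨l + 1, κ⟩ J then listFactorial w' else 0) := by
  refine Represents.lof (q := (k, l)) ?_ ?_ ?_
  · have h := hasSymbol_polyOpFull b (fun i => (block π i).map fun t => b (I t))
      (fun j => (block κ j).map fun s => b.coord (J s))
      (fun i => Finsupp.single (wordExp ((block π i).map I))
        (expFactorial (wordExp ((block π i).map I)) : K)) fun i f => by
          refine Eq.trans ?_ (Finsupp.sum_single_index
              (h := fun u r => r • divD (eO K V) b u f) (zero_smul K _)).symm
          rw [← dirOp_basis, List.map_map]
          rfl
    refine h.congr fun s t => ?_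
    have h1 : ∀ j, (((block κ j).map fun s => b.coord (J s)).map fun ξ => gen (eO K V) ξ).prod =
        (((block κ j).map J).map fun α => gen (eO K V) (b.coord α)).prod := fun j => by
      rw [List.map_map, List.map_map]
      rfl
    simp only [h1, counit_divD_prod, wordExp_block]
    rw [listFactorial_ofFn, listFactorial_ofFn, cont, cont]
    simp only [List.ofFn_injective.eq_iff]
    congr 1
    · by_cases hs : s = content π.1 I
      · rw [if_pos hs, hs]
        simp
      · rw [if_neg hs]
        obtain ⟨i, hi⟩ := Function.ne_iff.1 hs
        exact Finset.prod_eq_zero (Finset.mem_univ i) (Finsupp.single_eq_of_ne hi)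
    · by_cases ht : t = content κ.1 J
      · rw [if_pos ht, ht]
        simp
      · rw [if_neg ht]
        obtain ⟨i, hi⟩ := Function.ne_iff.1 ht
        refine Finset.prod_eq_zero (Finset.mem_univ i) ?_
        rw [if_neg hi, mul_zero]
  · intro w w' h
    by_cases hw : w = cont ⟨k + 1, π⟩ I
    · by_cases hw' : w' = cont ⟨l + 1, κ⟩ J
      · refine absurd ?_ h
        rw [hw, hw']
        exact ⟨⟨ofFn_ne_nil _, zero_notMem_cont _ _⟩, ⟨ofFn_ne_nil _, zero_notMem_cont _ _⟩⟩
      · rw [if_neg hw', mul_zero]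
    · rw [if_neg hw, zero_mul]
  · rintro w w' (h | h)
    · rw [if_neg, zero_mul]
      rintro rfl
      exact h (length_cont _ _)
    · rw [if_neg (c := w' = _), mul_zero]
      rintro rfl
      exact h (length_cont _ _)

theorem symbol_lof_eq_zero (p : ℕ × ℕ) (x : RepHom K V (p.1 + 1) (p.2 + 1)) {w w' : List (ι →₀ ℕ)}
    (h : wdeg w ≠ p.1 + 1 ∨ wdeg w' ≠ p.2 + 1) :
    symbol b (DirectSum.of (fun p : ℕ × ℕ => RepHom K V (p.1 + 1) (p.2 + 1)) p x) w w' = 0 := by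
  by_cases hp : Proper w w'
  · obtain ⟨p', P, R, I, J, rfl, rfl⟩ := exists_labels hp.1 hp.2
    rw [wdeg_cont, wdeg_cont] at h
    rw [symbol_cont, DirectSum.of_eq_of_ne, map_zero]
    rintro rfl
    exact h.elim (fun h => h rfl) fun h => h rfl
  · exact symbol_eq_zero b _ hp

theorem iMap_of (p : ℕ × ℕ) (x : RepHom K V (p.1 + 1) (p.2 + 1)) :
    iMap K b (DirectSum.of (fun p : ℕ × ℕ => RepHom K V (p.1 + 1) (p.2 + 1)) p x) =
      ∑ k ∈ Finset.range (p.1 + 1), ∑ l ∈ Finset.range (p.2 + 1),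
      ∑ π ∈ stdPart (p.1 + 1) (k + 1), ∑ κ ∈ stdPart (p.2 + 1) (l + 1),
      ∑ I : Fin (p.1 + 1) → ι, ∑ J : Fin (p.2 + 1) → ι,
        coeffΓ K b ⟨k + 1, π⟩ ⟨l + 1, κ⟩ I J x •
          ((blockFactorial π : K) * (blockFactorial κ : K))⁻¹ •
            inC K k l (polyOp K (fun i => (block π i).map fun t => b (I t))
              (fun j => (block κ j).map fun s => b.coord (J s))) := by
  rw [iMap, ← DirectSum.lof_eq_of K, DirectSum.toModule_lof]
  simp only [LinearMap.sum_apply, LinearMap.smulRight_apply]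

/-- The contributions of all partitions into consecutive blocks add up to the symbol. -/
theorem sum_block_symbol (p : ℕ × ℕ) (x : RepHom K V (p.1 + 1) (p.2 + 1))
    (w w' : List (ι →₀ ℕ)) :
    (∑ k ∈ Finset.range (p.1 + 1), ∑ l ∈ Finset.range (p.2 + 1),
      ∑ π ∈ stdPart (p.1 + 1) (k + 1), ∑ κ ∈ stdPart (p.2 + 1) (l + 1),
      ∑ I : Fin (p.1 + 1) → ι, ∑ J : Fin (p.2 + 1) → ι,
        coeffΓ K b ⟨k + 1, π⟩ ⟨l + 1, κ⟩ I J x *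
          (((blockFactorial π : K) * (blockFactorial κ : K))⁻¹ *
          ((if w = cont ⟨k + 1, π⟩ I then listFactorial w else 0) *
          (if w' = cont ⟨l + 1, κ⟩ J then listFactorial w' else 0)))) =
      symbol b (DirectSum.of (fun p : ℕ × ℕ => RepHom K V (p.1 + 1) (p.2 + 1)) p x) w w' := by
  set ρ := DirectSum.of (fun p : ℕ × ℕ => RepHom K V (p.1 + 1) (p.2 + 1)) p x
  have hρ : ρ p = x :=
    DirectSum.of_eq_same (β := fun p : ℕ × ℕ => RepHom K V (p.1 + 1) (p.2 + 1)) p x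
  -- Where the delta functions do not vanish, the coefficient is the value of the symbol at `(w,
  -- w')`. It can be taken out of the sum, which leaves a product of two total weights, each equal
  -- to one.
  have hterm : ∀ (k l : ℕ) (π : OrdPart (p.1 + 1) (k + 1)) (κ : OrdPart (p.2 + 1) (l + 1)) I J,
      coeffΓ K b ⟨k + 1, π⟩ ⟨l + 1, κ⟩ I J x *
        (((blockFactorial π : K) * (blockFactorial κ : K))⁻¹ *
        ((if w = cont ⟨k + 1, π⟩ I then listFactorial w else 0) *
        (if w' = cont ⟨l + 1, κ⟩ J then listFactorial w' else 0))) =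
      symbol b ρ w w' * (((blockFactorial π : K)⁻¹ *
          (if w = cont ⟨k + 1, π⟩ I then listFactorial w else 0)) *
        ((blockFactorial κ : K)⁻¹ *
          (if w' = cont ⟨l + 1, κ⟩ J then listFactorial w' else 0))) := by
    intro k l π κ I J
    by_cases h : w = cont ⟨k + 1, π⟩ I
    · by_cases h' : w' = cont ⟨l + 1, κ⟩ J
      · have : symbol b ρ w w' = coeffΓ K b ⟨k + 1, π⟩ ⟨l + 1, κ⟩ I J x := by
          rw [h, h', symbol_cont, hρ]
        rw [this, mul_inv]
        ring
      · simp [h']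
    · simp [h]
  simp only [hterm, ← Finset.mul_sum]
  by_cases hp : Proper w w' ∧ wdeg w = p.1 + 1 ∧ wdeg w' = p.2 + 1
  · have h1 := sum_stdPart_cont (K := K) hp.1.1 hp.2.1
    have h2 := sum_stdPart_cont (K := K) hp.1.2 hp.2.2
    refine Eq.trans (congrArg (symbol b ρ w w' * ·) ?_) (mul_one _)
    refine Eq.trans ?_ ((congrArg₂ (· * ·) h1 h2).trans (mul_one 1))
    simp only [← Finset.mul_sum, ← Finset.sum_mul]
  · have : symbol b ρ w w' = 0 := by
      by_cases h : Proper w w'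
      · exact symbol_lof_eq_zero b p x (by tauto)
      · exact symbol_eq_zero b _ h
    rw [this, zero_mul]

theorem represents_iMap (ρ : Rep K V) : Represents.{u, v, max v u} (eO K V) b (iMap K b ρ) (symbol b ρ) := by
  induction ρ using DirectSum.induction_on with
  | zero =>
    rw [map_zero]
    have h : symbol b (0 : Rep K V) = 0 := map_zero (symbolHom b)
    rw [h]
    exact Represents.zero
  | add ρ ρ' h h' =>
    rw [map_add]
    have h0 : symbol b (ρ + ρ') = symbol b ρ + symbol b ρ' := map_add (symbolHom b) ρ ρ'
    rw [h0]
    exact h.add h'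
  | of p x =>
    have hs : (∑ k ∈ Finset.range (p.1 + 1), ∑ l ∈ Finset.range (p.2 + 1),
        ∑ π ∈ stdPart (p.1 + 1) (k + 1), ∑ κ ∈ stdPart (p.2 + 1) (l + 1),
        ∑ I : Fin (p.1 + 1) → ι, ∑ J : Fin (p.2 + 1) → ι,
          coeffΓ K b ⟨k + 1, π⟩ ⟨l + 1, κ⟩ I J x •
          ((blockFactorial π : K) * (blockFactorial κ : K))⁻¹ •
          fun w w' => (if w = cont ⟨k + 1, π⟩ I then listFactorial w else 0) *
            (if w' = cont ⟨l + 1, κ⟩ J then listFactorial w' else 0)) =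
        symbol b (DirectSum.of (fun p : ℕ × ℕ => RepHom K V (p.1 + 1) (p.2 + 1)) p x) := by
      ext w w'
      simp only [Finset.sum_apply, Pi.smul_apply, smul_eq_mul]
      exact sum_block_symbol b p x w w'
    rw [iMap_of, ← hs]
    refine Represents.sum _ fun k _ => ?_
    refine Represents.sum _ fun l _ => ?_
    refine Represents.sum _ fun π _ => ?_
    refine Represents.sum _ fun κ _ => ?_
    refine Represents.sum _ fun I _ => ?_
    refine Represents.sum _ fun J _ => ?_
    refine Represents.smul _ ?_
    refine Represents.smul _ ?_
    exact represents_polyOp_block b π κ I J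

end Operators

/-! ### The differential in two lists squares to zero. -/

section Squares

variable {K : Type*} [Field K] {S : Type*} [AddSemigroup S]

theorem listD_comm (Γ : List S → List S → K) (w w' : List S) :
    listD (fun v' => listD (fun v => Γ v v') w) w' = listD (fun v => listD (Γ v) w') w := by
  have h1 := map_listD ((LinearMap.proj w).comp (listDHom (S := S) (N := K) K)).toAddMonoidHom (fun v' v => Γ v v') w'
  refine Eq.trans h1.symm ?_
  refine congrArg (fun Γ => listD Γ w) (funext fun v => ?_)
  exact map_listD (Pi.evalAddMonoidHom (fun _ : List S => K) v) (fun v' v => Γ v v') w'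

theorem totD_congr {Γ Γ' : List S → List S → K} {w w' : List S}
    (h : ∀ p a c q, w = p ++ a :: c :: q → Γ (p ++ (a + c) :: q) w' = Γ' (p ++ (a + c) :: q) w')
    (h' : ∀ p a c q, w' = p ++ a :: c :: q →
      Γ w (p ++ (a + c) :: q) = Γ' w (p ++ (a + c) :: q)) :
    totD Γ w w' = totD Γ' w w' := by
  rw [totD, totD, listD_congr (Γ := fun v => Γ v w') (Γ' := fun v => Γ' v w') w h,
    listD_congr w' h']

/-- The one-sided differentials square to zero and commute. Merging in the first list shortens it by
one and changes the sign, so the mixed terms cancel. -/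
theorem totD_totD (Γ : List S → List S → K) (w w' : List S) : totD (totD Γ) w w' = 0 := by
  have h1 : listD (fun v => totD Γ v w') w =
      -((-1 : K) ^ w.length * listD (fun v => listD (Γ v) w') w) := by
    simp only [totD]
    rw [listD_add, listD_listD (fun v => Γ v w'), zero_add, ← smul_eq_mul, ← neg_smul,
      ← listD_smul]
    refine listD_congr w fun p a c q hw => ?_
    rw [hw, smul_eq_mul]
    congr 1
    simp only [List.length_append, List.length_cons, pow_add, pow_one]
    ring
  have h2 : listD (fun v' => totD Γ w v') w' = listD (fun v => listD (Γ v) w') w := by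
    simp only [totD]
    rw [listD_add]
    have := listD_smul ((-1 : K) ^ w.length) (fun v' => listD (Γ w) v') w'
    simp only [smul_eq_mul] at this
    rw [this, listD_listD (Γ w), mul_zero, add_zero, listD_comm]
  rw [totD, h1]
  exact (congrArg (fun x => _ + (-1 : K) ^ w.length * x) h2).trans (neg_add_cancel _)

end Squares

/-! ### The comparison map is bijective and commutes with the differentials. -/

section Comparison

universe u v

variable {K : Type u} [Field K] {V : Type v} [AddCommGroup V] [Module K V]
variable {ι : Type} [Fintype ι] [DecidableEq ι] (b : Module.Basis ι K V)

/-- A sum of multi-indices is zero only if both are. So `totD` at a proper pair of lists involves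
proper pairs only, where `symbol_dRep` applies. -/
theorem proper_face_left {p : List (ι →₀ ℕ)} {a c : ι →₀ ℕ} {q w' : List (ι →₀ ℕ)}
    (h : Proper (p ++ a :: c :: q) w') : Proper (p ++ (a + c) :: q) w' := by
  refine ⟨⟨by simp, fun h0 => h.1.2 ?_⟩, h.2⟩
  simp only [List.mem_append, List.mem_cons] at h0 ⊢
  rcases h0 with h0 | h0 | h0
  · exact Or.inl h0
  · exact Or.inr (Or.inl (add_eq_zero.1 h0.symm).1.symm)
  · exact Or.inr (Or.inr (Or.inr h0))

theorem dRep_dRep (b : Module.Basis ι K V) (ρ : Rep K V) : dRep K V (dRep K V ρ) = 0 := by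
  refine symbol_injective b ?_
  rw [map_zero]
  ext w w'
  change symbol b _ w w' = 0
  by_cases h : Proper w w'
  · rw [symbol_dRep b _ h.1 h.2, ← totD_totD (symbol b ρ) w w']
    refine totD_congr (fun p a c q hw => ?_) (fun p a c q hw => ?_)
    · have h' : Proper (p ++ (a + c) :: q) w' := proper_face_left (hw ▸ h)
      exact symbol_dRep b ρ h'.1 h'.2
    · have h' : Proper (p ++ (a + c) :: q) w :=
        proper_face_left (hw ▸ (⟨h.2, h.1⟩ : Proper w' w))
      exact symbol_dRep b ρ h'.2 h'.1
  · exact symbol_eq_zero b _ h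

theorem properTotD_symbol (ρ : Rep K V) : properTotD (symbol b ρ) = symbol b (dRep K V ρ) := by
  ext w w'
  by_cases h : Proper w w'
  · rw [symbol_dRep b ρ h.1 h.2, properTotD, if_pos h]
  · rw [symbol_eq_zero b _ h, properTotD_eq_zero _ h]

variable [CharZero K]

/-- Both sides have the symbol `symbol b (dRep K V ρ)`, and a cochain is determined by its symbol.
-/
theorem iMap_dRep (ρ : Rep K V) : iMap K b (dRep K V ρ) = dGS K (O K V) (iMap K b ρ) := by
  have h := Represents.dGS.{u, v, max v u} (represents_iMap b ρ) fun _ _ => symbol_eq_zero b ρ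
  rw [properTotD_symbol] at h
  exact Represents.cochain_unique.{u, v, max v u} (represents_iMap b _) h

theorem ext_dGS_iMap (ρ : Rep K V) : ext K (O K V) (dGS K (O K V) (iMap K b ρ)) =
    dFull K (O K V) (ext K (O K V) (iMap K b ρ)) :=
  Represents.ext_dGS.{u, v, max v u} (represents_iMap b ρ) fun _ _ => symbol_eq_zero b ρ

theorem iMap_injective : Function.Injective (iMap K b) := by
  intro ρ ρ' h
  refine symbol_injective b (funext fun w => funext fun w' => ?_)
  change symbol b ρ w w' = symbol b ρ' w w'
  by_cases hp : Proper w w'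
  · exact (represents_iMap b ρ).symbol_eq (h ▸ represents_iMap b ρ') hp.1.1 hp.2.1
  · rw [symbol_eq_zero b _ hp, symbol_eq_zero b _ hp]

theorem iMap_mem_Cdiff (ρ : Rep K V) : iMap K b ρ ∈ Cdiff K V := by
  induction ρ using DirectSum.induction_on with
  | zero => rw [map_zero]; exact Submodule.zero_mem _
  | add ρ ρ' h h' => rw [map_add]; exact Submodule.add_mem _ h h'
  | of p x =>
    rw [iMap_of]
    refine Submodule.sum_mem _ fun k _ => Submodule.sum_mem _ fun l _ =>
      Submodule.sum_mem _ fun π _ => Submodule.sum_mem _ fun κ _ =>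
      Submodule.sum_mem _ fun I _ => Submodule.sum_mem _ fun J _ =>
      Submodule.smul_mem _ _ (Submodule.smul_mem _ _ (Submodule.subset_span ?_))
    exact ⟨k, l, _, _, fun i => by simpa using block_ne_nil π i,
      fun j => by simpa using block_ne_nil κ j, rfl⟩

theorem exists_degree_bound {k : ℕ} (S : Fin k → Finset (ι →₀ ℕ)) :
    ∃ N, ∀ s : Fin k → (ι →₀ ℕ), (∀ i, s i ∈ S i) → wdeg (List.ofFn s) ≤ N := by
  refine ⟨∑ i, ∑ u ∈ S i, u.degree, fun s hs => ?_⟩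
  rw [wdeg_ofFn]
  exact Finset.sum_le_sum fun i _ =>
    Finset.single_le_sum (f := fun u : ι →₀ ℕ => u.degree) (fun _ _ => Nat.zero_le _) (hs i)

theorem exists_ofFn_eq {k : ℕ} {w : List (ι →₀ ℕ)} (h : w.length = k) :
    ∃ s : Fin k → (ι →₀ ℕ), List.ofFn s = w := by
  subst h
  exact ⟨w.get, List.ofFn_get w⟩

theorem exists_listSymbol {k l : ℕ} (G : (Fin k → (ι →₀ ℕ)) → (Fin l → (ι →₀ ℕ)) → K) :
    ∃ Γ : List (ι →₀ ℕ) → List (ι →₀ ℕ) → K, (∀ s t, Γ (List.ofFn s) (List.ofFn t) = G s t) ∧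
      ∀ w w', w.length ≠ k ∨ w'.length ≠ l → Γ w w' = 0 := by
  classical
  refine ⟨fun w w' => if h : ∃ p : (Fin k → (ι →₀ ℕ)) × (Fin l → (ι →₀ ℕ)),
    List.ofFn p.1 = w ∧ List.ofFn p.2 = w' then G h.choose.1 h.choose.2 else 0, fun s t => ?_,
    fun w w' h => dif_neg ?_⟩
  · have h : ∃ p : (Fin k → (ι →₀ ℕ)) × (Fin l → (ι →₀ ℕ)),
        List.ofFn p.1 = List.ofFn s ∧ List.ofFn p.2 = List.ofFn t := ⟨(s, t), rfl, rfl⟩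
    have h1 := List.ofFn_injective h.choose_spec.1
    have h2 := List.ofFn_injective h.choose_spec.2
    dsimp only
    rw [dif_pos h, h1, h2]
  · rintro ⟨p, rfl, rfl⟩
    simp at h

/-- For arbitrary vectors and linear functions the symbol is no longer a delta function. It still
vanishes at zero entries, because the multi-indices are nonempty, and it has bounded degree, because
the expansions are finite. So it is the symbol of a representation, and uniqueness identifies the
image of the latter with the operator. -/
theorem exists_iMap_eq_polyOp {k l : ℕ} (I : Fin (k + 1) → List V)
    (J : Fin (l + 1) → List (Module.Dual K V)) (hI : ∀ i, I i ≠ []) (hJ : ∀ j, J j ≠ []) :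
    ∃ ρ, iMap K b ρ = inC K k l (polyOp K I J) := by
  choose a ha ha0 using fun i => exists_dirOp_expansion (eO K V) b (I i)
  have h := hasSymbol_polyOpFull b I J a ha
  set c : Fin (l + 1) → (ι →₀ ℕ) → K := fun j u => expFactorial u *
    Coalgebra.counit (R := K) (divD (eO K V) b u ((J j).map fun ξ => gen (eO K V) ξ).prod) with hc
  have hc0 : ∀ j, c j 0 = 0 := fun j => by
    rw [hc]
    dsimp only
    rw [divD_zero, counit_prod_gen _ _ (hJ j), mul_zero]
  obtain ⟨Γ, hΓ, hΓ0⟩ := exists_listSymbol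
    fun (s : Fin (k + 1) → (ι →₀ ℕ)) (t : Fin (l + 1) → (ι →₀ ℕ)) =>
      (∏ i, a i (s i)) * ∏ j, c j (t j)
  have hproper : ∀ w w', ¬ Proper w w' → Γ w w' = 0 := fun w w' hp => by
    by_cases hl : w.length ≠ k + 1 ∨ w'.length ≠ l + 1
    · exact hΓ0 _ _ hl
    · push Not at hl
      obtain ⟨s, rfl⟩ := exists_ofFn_eq hl.1
      obtain ⟨t, rfl⟩ := exists_ofFn_eq hl.2
      rw [hΓ]
      by_cases hs : ∃ i, s i = 0
      · obtain ⟨i, hi⟩ := hs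
        rw [Finset.prod_eq_zero (Finset.mem_univ i) (by rw [hi, ha0 i (hI i)]), zero_mul]
      · by_cases ht : ∃ j, t j = 0
        · obtain ⟨j, hj⟩ := ht
          rw [Finset.prod_eq_zero (Finset.mem_univ j) (by rw [hj, hc0]), mul_zero]
        · exact absurd ⟨⟨ofFn_ne_nil s, fun h => hs ((zero_mem_ofFn s).1 h)⟩,
            ⟨ofFn_ne_nil t, fun h => ht ((zero_mem_ofFn t).1 h)⟩⟩ hp
  obtain ⟨N, hN⟩ := exists_degree_bound fun i => (a i).support
  obtain ⟨N', hN'⟩ := exists_degree_bound fun j =>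
    (coordPoly (eO K V) b ((J j).map fun ξ => gen (eO K V) ξ).prod).support
  have hbound : ∀ w w', max N N' < wdeg w ∨ max N N' < wdeg w' → Γ w w' = 0 := fun w w' hd => by
    by_contra h0
    have hl : ¬ (w.length ≠ k + 1 ∨ w'.length ≠ l + 1) := fun hl => h0 (hΓ0 _ _ hl)
    push Not at hl
    obtain ⟨s, rfl⟩ := exists_ofFn_eq hl.1
    obtain ⟨t, rfl⟩ := exists_ofFn_eq hl.2
    rw [hΓ] at h0
    have h1 := hN s fun i => Finsupp.mem_support_iff.2
      (Finset.prod_ne_zero_iff.1 (left_ne_zero_of_mul h0) i (Finset.mem_univ i))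
    have h2 := hN' t fun j => MvPolynomial.mem_support_iff.2 (by
      rw [coeff_coordPoly]
      exact right_ne_zero_of_mul
        (Finset.prod_ne_zero_iff.1 (right_ne_zero_of_mul h0) j (Finset.mem_univ j)))
    omega
  obtain ⟨ρ, hρ⟩ := exists_symbol_eq b Γ hproper hbound
  have h1 := represents_iMap b ρ
  rw [hρ] at h1
  refine ⟨ρ, Represents.cochain_unique.{u, v, max v u} h1 ?_⟩
  exact Represents.lof.{u, v, max v u} (q := (k, l))
    (HasSymbol.congr.{u, v, max v u} h fun s t => (hΓ s t).symm) hproper hΓ0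

theorem exists_iMap_eq {Φ : C K (O K V)} (hΦ : Φ ∈ Cdiff K V) : ∃ ρ, iMap K b ρ = Φ := by
  have h : Cdiff K V ≤ LinearMap.range (iMap K b) := Submodule.span_le.2 <| by
    rintro _ ⟨k, l, I, J, hI, hJ, rfl⟩
    exact exists_iMap_eq_polyOp b I J hI hJ
  exact h hΦ

theorem mem_RepDeg_iff_iMap (r : ℕ) (ρ : Rep K V) :
    ρ ∈ RepDeg K V r ↔ iMap K b ρ ∈ CDeg K (O K V) r := by
  rw [mem_RepDeg_iff b]
  constructor
  · intro h q hq
    have h0 := HasSymbol.op_unique.{u, v, max v u} (represents_iMap b ρ q) (Ψ := 0)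
      (HasSymbol.congr.{u, v, max v u} HasSymbol.zero.{u, v, max v u} fun s t => by
      refine (h _ _ ?_).symm
      rw [List.length_ofFn, List.length_ofFn]
      omega)
    rw [ext_apply] at h0
    have := congrArg (resHom K (O K V) (q.1 + 1) (q.2 + 1)) h0
    rwa [resHom_extHom, map_zero] at this
  · intro h w w' hl
    by_cases hp : Proper w w'
    · obtain ⟨α, v, rfl⟩ := List.exists_cons_of_ne_nil hp.1.1
      obtain ⟨β, v', rfl⟩ := List.exists_cons_of_ne_nil hp.2.1
      have hq : iMap K b ρ (v.length, v'.length) = 0 := h (v.length, v'.length) (by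
        simp only [List.length_cons] at hl
        omega)
      have h1 := represents_iMap b ρ (v.length, v'.length)
      rw [ext_apply, hq, map_zero] at h1
      have h2 := congrFun (congrFun (HasSymbol.symbol_unique.{u, v, max v u} h1
        HasSymbol.zero.{u, v, max v u}) (α :: v).get) (β :: v').get
      simp only at h2
      rwa [List.ofFn_get, List.ofFn_get] at h2
    · exact symbol_eq_zero b ρ hp

end Comparison

/-! ### Multilinearity in the labels of the legs. -/

section BlockMultilinear

variable {K : Type*} [Field K] {V : Type*} [AddCommGroup V] [Module K V]
variable {R : Type*} [Ring R] [Algebra K R] {W : Type*} [AddCommGroup W] [Module K W]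

/-- The leg `t` occurs exactly once in `w`, so the product is linear in its label. -/
theorem prod_map_update {m : ℕ} (L : V →ₗ[K] R) (w : List (Fin m)) (hw : w.Nodup) {t : Fin m}
    (ht : t ∈ w) (v : Fin m → V) : ∃ p q : R, ∀ x,
      (w.map fun s => L (Function.update v t x s)).prod = p * L x * q := by
  obtain ⟨w₁, w₂, rfl⟩ := List.append_of_mem ht
  refine ⟨(w₁.map fun s => L (v s)).prod, (w₂.map fun s => L (v s)).prod, fun x => ?_⟩
  have h1 : t ∉ w₁ := fun h => (List.nodup_append.1 hw).2.2 t h t (by simp) rfl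
  have h2 : t ∉ w₂ := (List.nodup_cons.1 (List.nodup_append.1 hw).2.1).1
  have h : ∀ u : List (Fin m), t ∉ u → (u.map fun s => L (Function.update v t x s)) =
      u.map fun s => L (v s) := fun u hu => List.map_congr_left fun s hs => by
    rw [Function.update_of_ne]
    rintro rfl
    exact hu hs
  rw [List.map_append, List.map_cons, h _ h1, h _ h2, List.prod_append, List.prod_cons,
    Function.update_self, mul_assoc]

theorem prod_block_update {m k : ℕ} (π : OrdPart m k) (L : V →ₗ[K] R) (v : Fin m → V) (t : Fin m) :
    ∃ p q : R, ∀ x, (fun i => ((block π i).map fun s => L (Function.update v t x s)).prod) =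
      Function.update (fun i => ((block π i).map fun s => L (v s)).prod) (π.1 t) (p * L x * q) := by
  obtain ⟨p, q, h⟩ := prod_map_update L (block π (π.1 t))
    ((List.nodup_finRange m).filter _) (t := t) (by simp [block]) v
  refine ⟨p, q, fun x => funext fun i => ?_⟩
  by_cases hi : i = π.1 t
  · subst hi
    rw [Function.update_self, h]
  · rw [Function.update_of_ne hi]
    refine congrArg List.prod (List.map_congr_left fun s hs => ?_)
    rw [Function.update_of_ne]
    rintro rfl
    simp only [block, List.mem_filter, decide_eq_true_eq] at hs
    exact hi hs.2.symm

/-- A multilinear function of the products over the blocks of an ordered partition is a multilinear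
function of the labels of the legs. -/
def blockMultilinear {m k : ℕ} (π : OrdPart m k) (L : V →ₗ[K] R)
    (F : MultilinearMap K (fun _ : Fin k => R) W) : MultilinearMap K (fun _ : Fin m => V) W :=
  MultilinearMap.mk' (fun v => F fun i => ((block π i).map fun s => L (v s)).prod)
    (fun v t x y => by
      obtain ⟨p, q, h⟩ := prod_block_update π L v t
      rw [h, h, h, map_add, mul_add, add_mul, MultilinearMap.map_update_add])
    (fun v t c x => by
      obtain ⟨p, q, h⟩ := prod_block_update π L v t
      rw [h, h, map_smul, mul_smul_comm, smul_mul_assoc, MultilinearMap.map_update_smul])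

theorem blockMultilinear_apply {m k : ℕ} (π : OrdPart m k) (L : V →ₗ[K] R)
    (F : MultilinearMap K (fun _ : Fin k => R) W) (v : Fin m → V) :
    blockMultilinear π L F v = F fun i => ((block π i).map fun s => L (v s)).prod := rfl

end BlockMultilinear

/-! ### Contraction with the canonical element of V ⊗ V^*. -/

section BasisChange

variable {K : Type*} [Field K] {V : Type*} [AddCommGroup V] [Module K V]
variable {W : Type*} [AddCommGroup W] [Module K W] {ι ι' : Type} [Fintype ι] [DecidableEq ι]
  [Fintype ι'] [DecidableEq ι']

/-- The contraction of a multilinear function with the canonical element does not depend on the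
basis. -/
theorem sum_basis_dual {n : ℕ} (E : (Fin n → V) → (Fin n → Module.Dual K V) → W)
    (F : (Fin n → Module.Dual K V) → MultilinearMap K (fun _ : Fin n => V) W)
    (hF : ∀ v ξ, F ξ v = E v ξ)
    (G : (Fin n → V) → MultilinearMap K (fun _ : Fin n => Module.Dual K V) W)
    (hG : ∀ v ξ, G v ξ = E v ξ) (b : Module.Basis ι K V) (b' : Module.Basis ι' K V) :
    ∑ J : Fin n → ι, E (fun s => b (J s)) (fun s => b.coord (J s)) =
      ∑ J : Fin n → ι', E (fun s => b' (J s)) (fun s => b'.coord (J s)) := by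
  -- Both sums equal one double sum with the transition matrix: the vectors of `b` are expanded in
  -- `b'` on the left, and the functions dual to `b'` in those dual to `b` on the right.
  have h1 : ∀ J : Fin n → ι, E (fun s => b (J s)) (fun s => b.coord (J s)) =
      ∑ J' : Fin n → ι', (∏ s, b'.coord (J' s) (b (J s))) •
        E (fun s => b' (J' s)) (fun s => b.coord (J s)) := fun J => by
    have : (fun s => b (J s)) = fun s => ∑ α, b'.coord α (b (J s)) • b' α :=
      funext fun s => (b'.sum_repr _).symm
    rw [← hF]
    nth_rw 1 [this]
    rw [MultilinearMap.map_sum]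
    refine Finset.sum_congr rfl fun J' _ => ?_
    rw [MultilinearMap.map_smul_univ, hF]
  have h2 : ∀ J' : Fin n → ι', E (fun s => b' (J' s)) (fun s => b'.coord (J' s)) =
      ∑ J : Fin n → ι, (∏ s, b'.coord (J' s) (b (J s))) •
        E (fun s => b' (J' s)) (fun s => b.coord (J s)) := fun J' => by
    have : (fun s => b'.coord (J' s)) = fun s => ∑ α, b'.coord (J' s) (b α) • b.coord α := by
      funext s
      refine b.ext fun β => ?_
      rw [LinearMap.sum_apply, Finset.sum_eq_single β]
      · simp
      · intro α _ hα
        simp [hα.symm]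
      · simp
    rw [← hG, this, MultilinearMap.map_sum]
    refine Finset.sum_congr rfl fun J _ => ?_
    rw [MultilinearMap.map_smul_univ, hG]
  simp only [h1, h2]
  exact Finset.sum_comm

theorem sum_coord_smul {m : ℕ} (b : Module.Basis ι K V) (F : MultilinearMap K (fun _ : Fin m => V) W)
    (y : ⨂[K] _ : Fin m, V) : ∑ I : Fin m → ι, (Basis.piTensorProduct fun _ : Fin m => b).coord I y •
      F (fun t => b (I t)) = PiTensorProduct.lift F y := by
  conv_rhs => rw [← (Basis.piTensorProduct fun _ : Fin m => b).sum_repr y, map_sum]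
  refine Finset.sum_congr rfl fun I _ => ?_
  rw [map_smul, Basis.piTensorProduct_apply, PiTensorProduct.lift.tprod]
  rfl

/-- The sum over the output labels is the basis-free linear extension of `F` to the tensor power;
the sum over the input labels is a contraction with the canonical element. -/
theorem sum_coord_basis {m n : ℕ} (T : (⨂[K] _ : Fin n, V) →ₗ[K] (⨂[K] _ : Fin m, V))
    (H : (Fin m → V) → (Fin n → Module.Dual K V) → W)
    (F : (Fin n → Module.Dual K V) → MultilinearMap K (fun _ : Fin m => V) W)
    (hF : ∀ v ξ, F ξ v = H v ξ)
    (G : (Fin m → V) → MultilinearMap K (fun _ : Fin n => Module.Dual K V) W)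
    (hG : ∀ v ξ, G v ξ = H v ξ) (b : Module.Basis ι K V) (b' : Module.Basis ι' K V) :
    ∑ I : Fin m → ι, ∑ J : Fin n → ι, (Basis.piTensorProduct fun _ : Fin m => b).coord I
        (T (PiTensorProduct.tprod K fun s => b (J s))) •
        H (fun t => b (I t)) (fun s => b.coord (J s)) =
      ∑ I : Fin m → ι', ∑ J : Fin n → ι', (Basis.piTensorProduct fun _ : Fin m => b').coord I
        (T (PiTensorProduct.tprod K fun s => b' (J s))) •
        H (fun t => b' (I t)) (fun s => b'.coord (J s)) := by
  rw [Finset.sum_comm]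
  conv_rhs => rw [Finset.sum_comm]
  simp only [← hF, sum_coord_smul]
  refine sum_basis_dual
    (fun v ξ => PiTensorProduct.lift (F ξ) (T (PiTensorProduct.tprod K v)))
    (fun ξ => (PiTensorProduct.lift (F ξ) ∘ₗ T).compMultilinearMap (PiTensorProduct.tprod K))
    (fun v ξ => rfl)
    (fun v => ∑ I : Fin m → ι, (Basis.piTensorProduct fun _ : Fin m => b).coord I
      (T (PiTensorProduct.tprod K v)) • G fun t => b (I t)) (fun v ξ => ?_) b b'
  rw [← sum_coord_smul b]
  simp only [sum_apply, smul_apply, hF, hG]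

end BasisChange

/-! ### Operators as multilinear functions of their constituents. -/

section PolyOp

variable {K : Type*} [Field K] {A : Type*} [CommRing A] [Bialgebra K A]

/-- The operator with given coefficients and constituents. -/
def multiOp {m n : ℕ} (y : Fin (n + 1) → A) (D : Fin m → Module.End K A) :
    Cochain K A m (n + 1) :=
  resHom K A m (n + 1) (LinearMap.mulLeft K (PiTensorProduct.tprod K y) ∘ₗ
    glue fun i => iterComul K A n ∘ₗ D i)

/-- Multilinearity of `multiOp` in the coefficients, obtained by writing it as a composite of maps
known to be linear or multilinear. -/
def multiOpLeft {m n : ℕ} (D : Fin m → Module.End K A) :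
    MultilinearMap K (fun _ : Fin (n + 1) => A) (Cochain K A m (n + 1)) :=
  (resHom K A m (n + 1) ∘ₗ LinearMap.lcomp K _ (glue fun i => iterComul K A n ∘ₗ D i) ∘ₗ
    LinearMap.mul K (TPow K A (n + 1))).compMultilinearMap (PiTensorProduct.tprod K)

/-- The same in the operators `D`: they are composed with the iterated comultiplication, then
multiplied together, and the result is linear in this product. -/
def multiOpRight {m n : ℕ} (y : Fin (n + 1) → A) :
    MultilinearMap K (fun _ : Fin m => Module.End K A) (Cochain K A m (n + 1)) :=
  (resHom K A m (n + 1) ∘ₗ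
    (LinearMap.mulLeft K (PiTensorProduct.tprod K y)).compRight K ∘ₗ
    (PiTensorProduct.lift (R := K) (s := fun _ : Fin m => A)
      (E := TPow K A (n + 1))).toLinearMap).compMultilinearMap
    (((LinearMap.applyₗ (MultilinearMap.mkPiAlgebra K (Fin m) (TPow K A (n + 1)))).compMultilinearMap
      MultilinearMap.compLinearMapMultilinear).compLinearMap
      fun _ => (iterComul K A n).compRight K)

theorem multiOpRight_apply {m n : ℕ} (y : Fin (n + 1) → A) (D : Fin m → Module.End K A) :
    multiOpRight y D = multiOp y D := rfl

section

universe u v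

variable {K : Type u} [Field K] {V : Type v} [AddCommGroup V] [Module K V]
variable {A : Type*} [CommRing A] [Bialgebra K A] (e : O K V ≃ₐc[K] A)
variable {ι : Type} [Fintype ι] [DecidableEq ι] {κ : Type} [Fintype κ] [DecidableEq κ]

/-- `dirD` as a linear function of the vector. -/
def dirDHom (b : Module.Basis ι K V) : V →ₗ[K] Module.End K A :=
  ∑ α, (b.coord α).smulRight (divD e b (Finsupp.single α 1) : Module.End K A)

theorem dirDHom_apply (b : Module.Basis ι K V) (v : V) :
    (dirDHom e b v : Module.End K A) = dirD e b v := by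
  simp only [dirDHom, LinearMap.sum_apply, LinearMap.smulRight_apply]
  rfl

/-- `b₀` only serves to write the directional derivatives, which are linear in the vector; it stays
fixed while `b` is replaced by `b'`. -/
theorem sum_coord_multiOp (b₀ : Module.Basis ι K V) {m n k l : ℕ} (π : OrdPart m k)
    (τ : OrdPart n (l + 1)) (T : (⨂[K] _ : Fin n, V) →ₗ[K] (⨂[K] _ : Fin m, V))
    (b : Module.Basis ι K V) (b' : Module.Basis κ K V) :
    ∑ I : Fin m → ι, ∑ J : Fin n → ι, (Basis.piTensorProduct fun _ : Fin m => b).coord I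
        (T (PiTensorProduct.tprod K fun s => b (J s))) •
        multiOp (fun j => ((block τ j).map fun s => gen e (b.coord (J s))).prod)
          (fun i => dirOp e b₀ ((block π i).map fun t => b (I t))) =
      ∑ I : Fin m → κ, ∑ J : Fin n → κ, (Basis.piTensorProduct fun _ : Fin m => b').coord I
        (T (PiTensorProduct.tprod K fun s => b' (J s))) •
        multiOp (fun j => ((block τ j).map fun s => gen e (b'.coord (J s))).prod)
          (fun i => dirOp e b₀ ((block π i).map fun t => b' (I t))) := by
  refine sum_coord_basis T
    (fun v ξ => multiOp (fun j => ((block τ j).map fun s => gen e (ξ s)).prod)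
      (fun i => dirOp e b₀ ((block π i).map v)))
    (fun ξ => blockMultilinear π (dirDHom e b₀)
      (multiOpRight fun j => ((block τ j).map fun s => gen e (ξ s)).prod)) (fun v ξ => ?_)
    (fun v => blockMultilinear τ (gen e)
      (multiOpLeft fun i => dirOp e b₀ ((block π i).map v))) (fun v ξ => rfl) b b'
  rw [blockMultilinear_apply, multiOpRight_apply]
  refine congrArg (multiOp _) (funext fun i => ?_)
  simp only [dirDHom_apply, dirOp, List.map_map]
  rfl

end

end PolyOp

/-! ### The comparison map does not depend on the basis. -/

section Independence

universe u v

variable {K : Type u} [Field K] {V : Type v} [AddCommGroup V] [Module K V]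
variable {ι : Type} [Fintype ι] [DecidableEq ι] {κ : Type} [Fintype κ] [DecidableEq κ]

theorem polyOp_eq_multiOp (b₀ : Module.Basis ι K V) {m n : ℕ} (I : Fin m → List V)
    (J : Fin (n + 1) → List (Module.Dual K V)) : polyOp K I J =
      multiOp (fun j => ((J j).map fun ξ => gen (eO K V) ξ).prod)
        fun i => dirOp (eO K V) b₀ (I i) := by
  have h : (fun i => dirOp (eO K V) b₀ (I i)) = fun i => (diffOp K (I i) : Module.End K (O K V)) :=
    funext fun i => LinearMap.ext fun f => (diffOp_eq_dirOp b₀ (I i) f).symm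
  rw [h]
  rfl

theorem iMap_basis [CharZero K] (b : Module.Basis ι K V) (b' : Module.Basis κ K V) (ρ : Rep K V) :
    iMap K b ρ = iMap K b' ρ := by
  induction ρ using DirectSum.induction_on with
  | zero => rw [map_zero, map_zero]
  | add ρ ρ' h h' => rw [map_add, map_add, h, h']
  | of p x =>
    rw [iMap_of, iMap_of]
    refine Finset.sum_congr rfl fun k _ => Finset.sum_congr rfl fun l _ =>
      Finset.sum_congr rfl fun π _ => Finset.sum_congr rfl fun τ _ => ?_
    have h := sum_coord_multiOp.{u, v, max v u} (eO K V) b π τ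
      (toHom K V _ _ x (Finsupp.single ⟨k + 1, π⟩ 1 ⊗ₜ Finsupp.single ⟨l + 1, τ⟩ 1)) b b'
    have h' := congrArg (fun y =>
      ((blockFactorial π : K) * (blockFactorial τ : K))⁻¹ • inC K k l y) h
    simp only [map_sum, map_smul, Finset.smul_sum] at h'
    simp only [coeffΓ_apply, polyOp_eq_multiOp b, List.map_map, Function.comp_def]
    simp only [smul_comm _ ((blockFactorial π : K) * (blockFactorial τ : K))⁻¹]
    exact h'

end Independence

/-! ### Antisymmetrization kills coboundaries. -/

section Antisymmetrization

variable {K : Type*} [Field K] {M : Type*} [AddCommMonoid M]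

theorem push_comp_perm {m k : ℕ} (π : Fin m → Fin k) (f : Fin m → M) (τ : Equiv.Perm (Fin m))
    (h : ∀ j, π (τ j) = π j) : push π (f ∘ τ) = push π f := by
  funext c
  rw [push_apply, push_apply]
  refine Finset.sum_equiv τ (fun j => ?_) fun j _ => rfl
  simp [h]

/-- Merging the positions `i` and `i + 1` does not see their transposition, since addition is
commutative, while the sign changes. So for each `i` the permutations cancel in pairs. -/
theorem sum_sign_listD (G : List M → K) {m : ℕ} (f : Fin (m + 1) → M) :
    ∑ σ : Equiv.Perm (Fin (m + 1)), ((Equiv.Perm.sign σ : ℤ) : K) * listD G (List.ofFn (f ∘ σ)) =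
      0 := by
  simp only [listD_ofFn (K := K), Finset.mul_sum]
  rw [Finset.sum_comm]
  refine Finset.sum_eq_zero fun i _ => ?_
  have hne : i.castSucc ≠ i.succ := (Fin.castSucc_lt_succ (i := i)).ne
  refine Finset.sum_involution (fun σ _ => σ * Equiv.swap i.castSucc i.succ) (fun σ _ => ?_)
    (fun σ _ _ h => ?_) (fun _ _ => Finset.mem_univ _) (fun σ _ => ?_)
  · have h : push i.predAbove (f ∘ ⇑(σ * Equiv.swap i.castSucc i.succ)) =
        push i.predAbove (f ∘ σ) := by
      refine push_comp_perm i.predAbove (f ∘ σ) (Equiv.swap i.castSucc i.succ) fun j => ?_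
      rw [Equiv.swap_apply_def]
      split_ifs with h1 h2
      · rw [h1]; simp
      · rw [h2]; simp
      · rfl
    rw [h, Equiv.Perm.sign_mul, Equiv.Perm.sign_swap hne]
    push_cast
    ring
  · exact hne (by simpa using congrArg (· i.succ) (mul_eq_left.1 h))
  · rw [mul_assoc, Equiv.swap_mul_self, mul_one]

/-- The antisymmetrization of a function of two lists. -/
def antisym {k l : ℕ} (f : Fin k → M) (g : Fin l → M) : (List M → List M → K) →ₗ[K] K where
  toFun Γ := ∑ σ : Equiv.Perm (Fin k), ∑ τ : Equiv.Perm (Fin l),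
    ((Equiv.Perm.sign σ : ℤ) : K) * ((Equiv.Perm.sign τ : ℤ) : K) *
      Γ (List.ofFn (f ∘ σ)) (List.ofFn (g ∘ τ))
  map_add' Γ Γ' := by simp only [Pi.add_apply, mul_add, Finset.sum_add_distrib]
  map_smul' c Γ := by
    simp only [Pi.smul_apply, smul_eq_mul, Finset.mul_sum, RingHom.id_apply]
    refine Finset.sum_congr rfl fun σ _ => Finset.sum_congr rfl fun τ _ => by ring

theorem antisym_apply {k l : ℕ} (f : Fin k → M) (g : Fin l → M) (Γ : List M → List M → K) :
    antisym f g Γ = ∑ σ : Equiv.Perm (Fin k), ∑ τ : Equiv.Perm (Fin l),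
    ((Equiv.Perm.sign σ : ℤ) : K) * ((Equiv.Perm.sign τ : ℤ) : K) *
      Γ (List.ofFn (f ∘ σ)) (List.ofFn (g ∘ τ)) := rfl

theorem antisym_totD {k l : ℕ} (f : Fin (k + 1) → M) (g : Fin (l + 1) → M)
    (Γ : List M → List M → K) : antisym f g (totD Γ) = 0 := by
  simp only [antisym_apply, totD, mul_add, Finset.sum_add_distrib, List.length_ofFn]
  have h1 : ∀ τ : Equiv.Perm (Fin (l + 1)), ∑ σ : Equiv.Perm (Fin (k + 1)),
      ((Equiv.Perm.sign σ : ℤ) : K) * ((Equiv.Perm.sign τ : ℤ) : K) *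
        listD (fun v => Γ v (List.ofFn (g ∘ τ))) (List.ofFn (f ∘ σ)) = 0 := fun τ => by
    rw [← mul_zero ((Equiv.Perm.sign τ : ℤ) : K),
      ← sum_sign_listD (fun v => Γ v (List.ofFn (g ∘ τ))) f, Finset.mul_sum]
    exact Finset.sum_congr rfl fun σ _ => by ring
  have h2 : ∀ σ : Equiv.Perm (Fin (k + 1)), ∑ τ : Equiv.Perm (Fin (l + 1)),
      ((Equiv.Perm.sign σ : ℤ) : K) * ((Equiv.Perm.sign τ : ℤ) : K) *
        ((-1) ^ (k + 1) * listD (Γ (List.ofFn (f ∘ σ))) (List.ofFn (g ∘ τ))) = 0 := fun σ => by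
    rw [← mul_zero (((Equiv.Perm.sign σ : ℤ) : K) * (-1) ^ (k + 1)),
      ← sum_sign_listD (Γ (List.ofFn (f ∘ σ))) g, Finset.mul_sum]
    exact Finset.sum_congr rfl fun τ _ => by ring
  rw [Finset.sum_comm]
  simp only [h1, h2, Finset.sum_const_zero, add_zero]

theorem antisym_eq {k l : ℕ} (f : Fin k → M) (g : Fin l → M) (Γ : List M → List M → K)
    (h : ∀ (σ : Equiv.Perm (Fin k)) (τ : Equiv.Perm (Fin l)), Γ (List.ofFn (f ∘ σ)) (List.ofFn (g ∘ τ)) ≠ 0 → σ = 1 ∧ τ = 1) :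
    antisym f g Γ = Γ (List.ofFn f) (List.ofFn g) := by
  rw [antisym_apply, Finset.sum_eq_single 1, Finset.sum_eq_single 1]
  · simp
  · intro τ _ hτ
    by_contra h0
    exact hτ (h _ _ (right_ne_zero_of_mul h0)).2
  · simp
  · intro σ _ hσ
    refine Finset.sum_eq_zero fun τ _ => ?_
    by_contra h0
    exact hσ (h _ _ (right_ne_zero_of_mul h0)).1
  · simp

end Antisymmetrization

/-! ### Decreasing words and finite sets. -/

section Words

variable {d : ℕ}

/-- The decreasing word in the elements of a finite set. -/
def finsetWord {k : ℕ} (s : Finset (Fin d)) (h : s.card = k) : Fin k → (Fin d →₀ ℕ) :=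
  fun i => Finsupp.single (s.orderEmbOfFin h i.rev) 1

theorem exists_finsetWord {l : List (Fin d)} (hl : l.Pairwise (· > ·)) :
    ∃ h : l.toFinset.card = l.length,
      l.map (fun α => Finsupp.single α 1) = List.ofFn (finsetWord l.toFinset h) := by
  have hn : l.Nodup := hl.imp fun h => h.ne'
  refine ⟨List.toFinset_card_of_nodup hn, ?_⟩
  have h := Finset.orderEmbOfFin_unique (s := l.toFinset) (List.toFinset_card_of_nodup hn)
    (f := fun i : Fin l.length => l.get i.rev) (fun i => by simp) (fun i j hij => by
      exact (List.pairwise_iff_get.1 hl) _ _ (Fin.rev_lt_rev.2 hij))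
  refine List.ext_get (by simp) fun i hi hi' => ?_
  simp only [List.get_ofFn, finsetWord, ← h]
  simp

/-- Among the rearrangements of a decreasing word only the word itself is decreasing. This makes
different cells independent under antisymmetrization. -/
theorem finsetWord_comp_perm {k : ℕ} {s t : Finset (Fin d)} (h : s.card = k) (h' : t.card = k)
    {σ : Equiv.Perm (Fin k)} (hσ : finsetWord s h ∘ σ = finsetWord t h') : s = t ∧ σ = 1 := by
  have h1 : ∀ i, s.orderEmbOfFin h (σ i).rev = t.orderEmbOfFin h' i.rev := fun i =>
    Finsupp.single_left_injective one_ne_zero (congrFun hσ i)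
  have hst : t ⊆ s := fun x hx => by
    obtain ⟨i, rfl⟩ : x ∈ Set.range (t.orderEmbOfFin h') := by
      rwa [Finset.range_orderEmbOfFin]
    rw [← Fin.rev_rev i, ← h1]
    exact Finset.orderEmbOfFin_mem s h _
  obtain rfl : t = s := Finset.eq_of_subset_of_card_le hst (by rw [h, h'])
  refine ⟨rfl, Equiv.ext fun i => ?_⟩
  exact Fin.rev_injective ((t.orderEmbOfFin h).injective (h1 i))

end Words

/-! ### Transport of cohomology along an injective chain map. -/

section Transport

/-- If a linear map identifies two complexes and `θ` detects the cohomology of the first one, then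
it computes the cohomology of the second one. -/
theorem nonempty_quotient_equiv {K R X U : Type*} [Field K] [AddCommGroup R] [Module K R]
    [AddCommGroup X] [Module K X] [AddCommGroup U] [Module K U] (i : R →ₗ[K] X)
    (hi : Function.Injective i) (D : Submodule K X) (hD : ∀ x, x ∈ D ↔ ∃ ρ, i ρ = x)
    (dR : R →ₗ[K] R) (dX : X →ₗ[K] X) (hd : ∀ ρ, i (dR ρ) = dX (i ρ)) (R' : Submodule K R)
    (X' : Submodule K X) (hr : ∀ ρ, ρ ∈ R' ↔ i ρ ∈ X') (θ : R →ₗ[K] U) (hθ : ∀ ρ, θ (dR ρ) = 0)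
    (hsurj : ∀ u, ∃ ρ ∈ R', dR ρ = 0 ∧ θ ρ = u)
    (hker : ∀ ρ ∈ R', dR ρ = 0 → θ ρ = 0 → ∃ ρ', dR ρ' = ρ) :
    Nonempty ((↥(D ⊓ X' ⊓ LinearMap.ker dX) ⧸
      Submodule.comap (D ⊓ X' ⊓ LinearMap.ker dX).subtype (Submodule.map dX D)) ≃ₗ[K] U) := by
  have hrange : LinearMap.range i = D := by
    ext x
    rw [LinearMap.mem_range, hD]
  let iR : R ≃ₗ[K] LinearMap.range i := LinearEquiv.ofInjective i hi
  have hle : D ⊓ X' ⊓ LinearMap.ker dX ≤ LinearMap.range i := by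
    rw [hrange]
    exact inf_le_left.trans inf_le_left
  let Θ : ↥(D ⊓ X' ⊓ LinearMap.ker dX) →ₗ[K] U :=
    θ ∘ₗ iR.symm.toLinearMap ∘ₗ Submodule.inclusion hle
  have hΘ : ∀ ρ (h : i ρ ∈ D ⊓ X' ⊓ LinearMap.ker dX), Θ ⟨i ρ, h⟩ = θ ρ := fun ρ h => by
    refine congrArg θ ?_
    refine (LinearEquiv.symm_apply_eq iR).2 ?_
    exact Subtype.ext (LinearEquiv.ofInjective_apply i ρ).symm
  have hmem : ∀ ρ, i ρ ∈ D ⊓ X' ⊓ LinearMap.ker dX ↔ ρ ∈ R' ∧ dR ρ = 0 := fun ρ => by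
    rw [Submodule.mem_inf, Submodule.mem_inf, LinearMap.mem_ker, ← hd, ← hr, hD,
      map_eq_zero_iff i hi]
    simp
  have hsurj' : Function.Surjective Θ := fun u => by
    obtain ⟨ρ, h1, h2, h3⟩ := hsurj u
    exact ⟨⟨i ρ, (hmem ρ).2 ⟨h1, h2⟩⟩, (hΘ ρ _).trans h3⟩
  have hker' : Submodule.comap (D ⊓ X' ⊓ LinearMap.ker dX).subtype (Submodule.map dX D) =
      LinearMap.ker Θ := by
    ext ⟨x, hx⟩
    obtain ⟨ρ, rfl⟩ := (hD x).1 hx.1.1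
    rw [LinearMap.mem_ker, hΘ, Submodule.mem_comap, Submodule.subtype_apply, Submodule.mem_map]
    constructor
    · rintro ⟨y, hy, h⟩
      obtain ⟨ρ', rfl⟩ := (hD y).1 hy
      rw [← hd] at h
      rw [← hi h, hθ]
    · intro h
      obtain ⟨ρ', rfl⟩ := hker ρ ((hmem ρ).1 hx).1 ((hmem ρ).1 hx).2 h
      exact ⟨i ρ', (hD _).2 ⟨ρ', rfl⟩, (hd ρ').symm⟩
  exact ⟨(Submodule.quotEquivOfEq _ _ hker').trans (Θ.quotKerEquivOfSurjective hsurj')⟩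

end Transport

/-! ### Cocycles of the representation complex. -/

section Decomposition

variable {d : ℕ} {K : Type*} [Field K]

/-- The nonzero multi-indices in a list. -/
def toNZ (w : List (Fin d →₀ ℕ)) : List (NZ (Fin d)) :=
  w.filterMap fun s => if h : s ≠ 0 then some ⟨s, h⟩ else none

theorem toNZ_map (w : List (NZ (Fin d))) : toNZ (w.map Subtype.val) = w := by
  induction w with
  | nil => rfl
  | cons s w ih =>
    rw [List.map_cons, toNZ, List.filterMap_cons, dif_pos s.2]
    exact congrArg (s :: ·) ih

theorem map_toNZ {w : List (Fin d →₀ ℕ)} (h : 0 ∉ w) : (toNZ w).map Subtype.val = w := by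
  induction w with
  | nil => rfl
  | cons s w ih =>
    rw [List.mem_cons, not_or] at h
    rw [toNZ, List.filterMap_cons, dif_pos (Ne.symm h.1)]
    exact congrArg (s :: ·) (ih h.2)

theorem listD_map_val (Γ : List (Fin d →₀ ℕ) → K) (w : List (NZ (Fin d))) :
    listD (fun v : List (NZ (Fin d)) => Γ (v.map Subtype.val)) w =
      listD Γ (w.map Subtype.val) := by
  induction w generalizing Γ with
  | nil => rw [List.map_nil, listD_nil, listD_nil]
  | cons a w ih =>
    cases w with
    | nil => rw [List.map_singleton, listD_singleton, listD_singleton]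
    | cons c w =>
      rw [List.map_cons, List.map_cons, listD_cons_cons, listD_cons_cons]
      exact congrArg₂ (· - ·) rfl (ih fun v => Γ (a.1 :: v))

theorem totD_map_val (Γ : List (Fin d →₀ ℕ) → List (Fin d →₀ ℕ) → K)
    (w w' : List (NZ (Fin d))) :
    totD (fun v v' : List (NZ (Fin d)) => Γ (v.map Subtype.val) (v'.map Subtype.val)) w w' =
      totD Γ (w.map Subtype.val) (w'.map Subtype.val) := by
  rw [totD, totD, listD_map_val fun v => Γ v (w'.map Subtype.val),
    listD_map_val (Γ (w.map Subtype.val)), List.length_map]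

variable {V : Type*} [AddCommGroup V] [Module K V] (b : Module.Basis (Fin d) K V)

/-- Restricted to lists of nonzero multi-indices, the symbol is a cocycle for `totD`, also when a
list is empty, since it vanishes there. Then `exists_of_totD_eq_zero` applies; it gives no bound on
the degree of `Y`. -/
theorem exists_decomposition {ρ : Rep K V} (hρ : dRep K V ρ = 0) :
    ∃ Y X : List (Fin d →₀ ℕ) → List (Fin d →₀ ℕ) → K,
      (∀ u u', X u u' ≠ 0 → ∃ l l' : List (Fin d), l.Pairwise (· > ·) ∧ l'.Pairwise (· > ·) ∧
        u = l.map (fun α => Finsupp.single α 1) ∧ u' = l'.map fun α => Finsupp.single α 1) ∧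
      ∀ u u', Proper u u' → symbol b ρ u u' = totD Y u u' + X u u' := by
  have hval : ∀ w : List (NZ (Fin d)), 0 ∉ w.map Subtype.val := fun w h => by
    obtain ⟨s, -, hs⟩ := List.mem_map.1 h
    exact s.2 hs
  have hz : ∀ w w' : List (NZ (Fin d)), totD (fun v v' : List (NZ (Fin d)) =>
      symbol b ρ (v.map Subtype.val) (v'.map Subtype.val)) w w' = 0 := fun w w' => by
    rw [totD_map_val]
    by_cases h : Proper (w.map Subtype.val) (w'.map Subtype.val)
    · rw [← symbol_dRep b ρ h.1 h.2, hρ]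
      exact congrFun (congrFun (map_zero (symbolHom b)) _) _
    · have h' : w.map Subtype.val = [] ∨ w'.map Subtype.val = [] := by
        by_contra! hc
        exact h ⟨⟨hc.1, hval w⟩, hc.2, hval w'⟩
      rcases h' with h' | h' <;> rw [h', totD, listD_nil]
      · rw [listD_eq_zero _ fun _ _ _ _ _ => symbol_eq_zero b ρ (by simp)]
        simp
      · have h0 : (fun v => symbol b ρ v []) = fun _ => 0 :=
          funext fun v => symbol_eq_zero b ρ (by simp)
        rw [h0, listD_zero]
        simp
  obtain ⟨y, Ξ, hΞ, h⟩ := exists_of_totD_eq_zero _ hz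
  have hletter : ∀ l : List (Fin d), (l.map letter).map Subtype.val =
      l.map fun α => (Finsupp.single α 1 : Fin d →₀ ℕ) := fun l => List.map_map
  refine ⟨fun u u' => y (toNZ u) (toNZ u'),
    fun u u' => if Proper u u' then Ξ (toNZ u) (toNZ u') else 0, fun u u' hX => ?_,
    fun u u' hp => ?_⟩
  · have hp : Proper u u' := by
      by_contra hp
      exact hX (if_neg hp)
    replace hX : Ξ (toNZ u) (toNZ u') ≠ 0 := by simpa only [if_pos hp] using hX
    have hw : IsWord d (toNZ u) ∧ IsWord d (toNZ u') := by
      by_contra hw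
      exact hX (hΞ _ _ hw)
    obtain ⟨⟨l, hl, hl1, -⟩, l', hl', hl'1, -⟩ := hw
    refine ⟨l, l', hl1, hl'1, ?_, ?_⟩
    · rw [← map_toNZ hp.1.2, hl, hletter]
    · rw [← map_toNZ hp.2.2, hl', hletter]
  · have h1 := h (toNZ u) (toNZ u')
    rw [map_toNZ hp.1.2, map_toNZ hp.2.2] at h1
    rw [h1]
    refine Eq.trans ?_ (congrArg (_ + ·) (if_pos hp).symm)
    have h2 := totD_map_val (fun u u' => y (toNZ u) (toNZ u')) (toNZ u) (toNZ u')
    simp only [toNZ_map] at h2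
    rw [h2, map_toNZ hp.1.2, map_toNZ hp.2.2]

end Decomposition

/-! ### The cohomology, indexed by pairs of finite sets. -/

section Cells

variable {d : ℕ} {K : Type*} [Field K]

/-- The pairs of nonempty finite sets with total number of elements `r + 2`. -/
abbrev Cells (d r : ℕ) : Type := Σ p : Finset.HasAntidiagonal.antidiagonal r,
  (Finset.powersetCard (p.1.1 + 1) (Finset.univ : Finset (Fin d))) ×
    (Finset.powersetCard (p.1.2 + 1) (Finset.univ : Finset (Fin d)))

theorem Cells.ext {r : ℕ} {c c' : Cells d r} (h : c.2.1.1 = c'.2.1.1) (h' : c.2.2.1 = c'.2.2.1) :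
    c = c' := by
  obtain ⟨⟨⟨a, a'⟩, ha⟩, ⟨s, hs⟩, ⟨t, ht⟩⟩ := c
  obtain ⟨⟨⟨a₁, a₁'⟩, ha₁⟩, ⟨s₁, hs₁⟩, ⟨t₁, ht₁⟩⟩ := c'
  dsimp only at h h'
  subst h h'
  have h1 := (Finset.mem_powersetCard_univ.1 hs).symm.trans (Finset.mem_powersetCard_univ.1 hs₁)
  have h2 := (Finset.mem_powersetCard_univ.1 ht).symm.trans (Finset.mem_powersetCard_univ.1 ht₁)
  dsimp only at h1 h2
  obtain rfl : a = a₁ := by omega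
  obtain rfl : a' = a₁' := by omega
  rfl

def Cells.left {r : ℕ} (c : Cells d r) : Fin (c.1.1.1 + 1) → (Fin d →₀ ℕ) :=
  finsetWord c.2.1.1 (Finset.mem_powersetCard_univ.1 c.2.1.2)

def Cells.right {r : ℕ} (c : Cells d r) : Fin (c.1.1.2 + 1) → (Fin d →₀ ℕ) :=
  finsetWord c.2.2.1 (Finset.mem_powersetCard_univ.1 c.2.2.2)

theorem ofFn_finsetWord_comp {k k' : ℕ} {s t : Finset (Fin d)} {h : s.card = k} {h' : t.card = k'}
    {σ : Equiv.Perm (Fin k)}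
    (hσ : List.ofFn (finsetWord s h ∘ σ) = List.ofFn (finsetWord t h')) : s = t ∧ σ = 1 := by
  obtain rfl : k = k' := by simpa using congrArg List.length hσ
  exact finsetWord_comp_perm h h' (List.ofFn_injective hσ)

theorem finsetWord_ne_zero {k : ℕ} {s : Finset (Fin d)} (h : s.card = k) (i : Fin k) :
    finsetWord s h i ≠ 0 := by simp [finsetWord]

theorem proper_finsetWord {k l : ℕ} {s t : Finset (Fin d)} (h : s.card = k + 1)
    (h' : t.card = l + 1) (σ : Equiv.Perm (Fin (k + 1))) (τ : Equiv.Perm (Fin (l + 1))) :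
    Proper (List.ofFn (finsetWord s h ∘ σ)) (List.ofFn (finsetWord t h' ∘ τ)) :=
  ⟨⟨ofFn_ne_nil _, fun h0 => let ⟨_, hi⟩ := (zero_mem_ofFn _).1 h0; finsetWord_ne_zero h _ hi⟩,
    ⟨ofFn_ne_nil _, fun h0 => let ⟨_, hi⟩ := (zero_mem_ofFn _).1 h0; finsetWord_ne_zero h' _ hi⟩⟩

theorem antisym_congr {M : Type*} [AddCommMonoid M] {k l : ℕ} {f : Fin k → M} {g : Fin l → M}
    {Γ Γ' : List M → List M → K}
    (h : ∀ (σ : Equiv.Perm (Fin k)) (τ : Equiv.Perm (Fin l)),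
      Γ (List.ofFn (f ∘ σ)) (List.ofFn (g ∘ τ)) = Γ' (List.ofFn (f ∘ σ)) (List.ofFn (g ∘ τ))) :
    antisym f g Γ = antisym f g Γ' := by
  simp only [antisym_apply, h]

variable {V : Type*} [AddCommGroup V] [Module K V] (b : Module.Basis (Fin d) K V)

/-- The antisymmetrizations of the symbol. -/
def alternate (r : ℕ) : Rep K V →ₗ[K] (Cells d r → K) :=
  LinearMap.pi fun c => antisym c.left c.right ∘ₗ symbolHom b

theorem alternate_apply (r : ℕ) (ρ : Rep K V) (c : Cells d r) :
    alternate b r ρ c = antisym c.left c.right (symbol b ρ) := rfl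

theorem alternate_dRep (r : ℕ) (ρ : Rep K V) : alternate b r (dRep K V ρ) = 0 := by
  funext c
  rw [alternate_apply, Pi.zero_apply, ← antisym_totD c.left c.right (symbol b ρ)]
  refine antisym_congr fun σ τ => ?_
  have h : Proper (List.ofFn (c.left ∘ σ)) (List.ofFn (c.right ∘ τ)) := proper_finsetWord _ _ σ τ
  exact symbol_dRep b ρ h.1 h.2

/-- The function with value `x c` at the pair of words of `c`, and zero elsewhere, is a cocycle
because no list with a merged entry is a word of letters. Its antisymmetrizations involve only
identity permutations. -/
theorem exists_alternate_eq (r : ℕ) (x : Cells d r → K) :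
    ∃ ρ ∈ RepDeg K V r, dRep K V ρ = 0 ∧ alternate b r ρ = x := by
  set Γ : List (Fin d →₀ ℕ) → List (Fin d →₀ ℕ) → K := fun u u' => ∑ c : Cells d r,
    if u = List.ofFn c.left ∧ u' = List.ofFn c.right then x c else 0
  have hΓ : ∀ u u', Γ u u' ≠ 0 → ∃ c : Cells d r, u = List.ofFn c.left ∧ u' = List.ofFn c.right :=
    fun u u' h => by
      obtain ⟨c, -, hc⟩ := Finset.exists_ne_zero_of_sum_ne_zero h
      refine ⟨c, ?_⟩
      by_contra h'
      exact hc (if_neg h')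
  have hsum : ∀ c : Cells d r, c.1.1.1 + c.1.1.2 = r := fun c =>
    Finset.HasAntidiagonal.mem_antidiagonal.1 c.1.2
  have hdeg : ∀ {k} {s : Finset (Fin d)} (h : s.card = k), wdeg (List.ofFn (finsetWord s h)) = k :=
    fun h => by
      rw [wdeg_ofFn]
      simp [finsetWord, Finsupp.degree_single]
  obtain ⟨ρ, hρ⟩ := exists_symbol_eq b Γ (fun u u' hp => by
      by_contra h
      obtain ⟨c, rfl, rfl⟩ := hΓ u u' h
      exact hp (proper_finsetWord _ _ 1 1)) (N := r + 1) (fun u u' hN => by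
      by_contra h
      obtain ⟨c, rfl, rfl⟩ := hΓ u u' h
      have := hsum c
      rw [Cells.left, Cells.right, hdeg, hdeg] at hN
      omega)
  have hface : ∀ {k} {s : Finset (Fin d)} (h : s.card = k) (p q : List (Fin d →₀ ℕ)) (a c),
      0 ∉ p ++ a :: c :: q → p ++ (a + c) :: q ≠ List.ofFn (finsetWord s h) := fun h p q a c h0 he => by
    have hm : a + c ∈ List.ofFn (finsetWord _ h) := he ▸ by simp
    obtain ⟨i, hi⟩ := List.mem_ofFn.1 hm
    refine add_ne_letter ⟨a, ?_⟩ ⟨c, ?_⟩ _ (Subtype.ext hi.symm)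
    · rintro rfl
      simp at h0
    · rintro rfl
      simp at h0
  refine ⟨ρ, (mem_RepDeg_iff b r ρ).2 fun u u' hl => ?_, symbol_injective b ?_, funext fun c => ?_⟩
  · rw [hρ]
    by_contra h
    obtain ⟨c, rfl, rfl⟩ := hΓ u u' h
    have := hsum c
    rw [List.length_ofFn, List.length_ofFn] at hl
    omega
  · rw [map_zero]
    ext u u'
    change symbol b _ u u' = 0
    by_cases hp : Proper u u'
    · rw [symbol_dRep b ρ hp.1 hp.2, hρ, totD, listD_eq_zero, listD_eq_zero]
      · simp
      · intro p a c q hu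
        by_contra h
        obtain ⟨e, -, he⟩ := hΓ _ _ h
        exact hface _ p q a c (hu ▸ hp.2.2) he
      · intro p a c q hu
        by_contra h
        obtain ⟨e, he, -⟩ := hΓ _ _ h
        exact hface _ p q a c (hu ▸ hp.1.2) he
    · exact symbol_eq_zero b _ hp
  · rw [alternate_apply, hρ, antisym_eq]
    · refine (Finset.sum_eq_single c (fun c' _ hc' => if_neg fun h => hc' ?_) (by simp)).trans
        (if_pos ⟨rfl, rfl⟩)
      exact (Cells.ext (ofFn_finsetWord_comp (σ := 1) h.1).1
        (ofFn_finsetWord_comp (σ := 1) h.2).1).symm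
    · intro σ τ h
      obtain ⟨c', h1, h2⟩ := hΓ _ _ h
      exact ⟨(ofFn_finsetWord_comp h1).2, (ofFn_finsetWord_comp h2).2⟩

theorem totD_ite {S : Type*} [Add S] (U U' : List S → Prop) [DecidablePred U] [DecidablePred U']
    (Γ : List S → List S → K) (w w' : List S)
    (hU : ∀ p a c q, U (p ++ (a + c) :: q) ↔ U (p ++ a :: c :: q))
    (hU' : ∀ p a c q, U' (p ++ (a + c) :: q) ↔ U' (p ++ a :: c :: q)) :
    totD (fun v v' => if U v ∧ U' v' then Γ v v' else 0) w w' =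
      if U w ∧ U' w' then totD Γ w w' else 0 := by
  have h1 : listD (fun v => if U v ∧ U' w' then Γ v w' else 0) w =
      if U w ∧ U' w' then listD (fun v => Γ v w') w else 0 :=
    listD_ite (fun v => U v ∧ U' w') _ w fun p a c q => by rw [hU]
  have h2 : listD (fun v' => if U w ∧ U' v' then Γ w v' else 0) w' =
      if U w ∧ U' w' then listD (Γ w) w' else 0 :=
    listD_ite (fun v' => U w ∧ U' v') _ w' fun p a c q => by rw [hU']
  rw [totD, totD, h1]
  refine (congrArg (fun x => _ + (-1 : K) ^ w.length * x) h2).trans ?_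
  split_ifs <;> simp

/-- Antisymmetrizing the decomposition of `symbol b ρ` kills `totD Y` and returns the value of `X`
at a decreasing pair of words. As the antisymmetrizations vanish, so does `X` on proper lists, and
`Y` is a primitive. -/
theorem exists_dRep_eq (r : ℕ) {ρ : Rep K V} (hr : ρ ∈ RepDeg K V r) (hρ : dRep K V ρ = 0)
    (h0 : alternate b r ρ = 0) : ∃ ρ', dRep K V ρ' = ρ := by
  obtain ⟨Y, X, hX, h⟩ := exists_decomposition b hρ
  have hX0 : ∀ u u', Proper u u' → X u u' = 0 := fun u u' hp => by
    by_contra hne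
    obtain ⟨l, l', hl, hl', rfl, rfl⟩ := hX u u' hne
    obtain ⟨hs, hs'⟩ := exists_finsetWord hl
    obtain ⟨ht, ht'⟩ := exists_finsetWord hl'
    rw [hs', ht'] at hne hp
    generalize l.toFinset = s at *
    generalize l'.toFinset = t at *
    generalize l.length = k at *
    generalize l'.length = k' at *
    obtain ⟨k, rfl⟩ : ∃ m, k = m + 1 := Nat.exists_eq_succ_of_ne_zero fun hk => by
      subst hk; exact hp.1.1 (by simp)
    obtain ⟨k', rfl⟩ : ∃ m, k' = m + 1 := Nat.exists_eq_succ_of_ne_zero fun hk => by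
      subst hk; exact hp.2.1 (by simp)
    have h1 : antisym (finsetWord s hs) (finsetWord t ht) (symbol b ρ) =
        X (List.ofFn (finsetWord s hs)) (List.ofFn (finsetWord t ht)) := by
      rw [antisym_congr (Γ' := totD Y + X) fun σ τ => h _ _ (proper_finsetWord hs ht σ τ), map_add,
        antisym_totD, zero_add, antisym_eq]
      intro σ τ hστ
      obtain ⟨l, l', hl, hl', e, e'⟩ := hX _ _ hστ
      obtain ⟨_, e1⟩ := exists_finsetWord hl
      obtain ⟨_, e2⟩ := exists_finsetWord hl'
      exact ⟨(ofFn_finsetWord_comp (e.trans e1)).2, (ofFn_finsetWord_comp (e'.trans e2)).2⟩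
    rw [← h1] at hne
    by_cases hkl : k + k' = r
    · refine hne (congrFun h0 ⟨⟨(k, k'), Finset.HasAntidiagonal.mem_antidiagonal.2 hkl⟩,
        ⟨s, Finset.mem_powersetCard_univ.2 hs⟩, ⟨t, Finset.mem_powersetCard_univ.2 ht⟩⟩)
    -- Off the total length `r + 2` the symbol itself vanishes by the degree hypothesis.
    · refine hne ?_
      rw [antisym_congr (Γ' := 0) fun σ τ => (mem_RepDeg_iff b r ρ).1 hr _ _ ?_, map_zero]
      rw [List.length_ofFn, List.length_ofFn]
      omega
  obtain ⟨N, hN⟩ := symbol_bounded b ρ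
  -- `Y` may have unbounded degree and then is no symbol. Mergings preserve the total degree, so
  -- cutting `Y` off at the bound `N` for `ρ` commutes with `totD`.
  set Γ : List (Fin d →₀ ℕ) → List (Fin d →₀ ℕ) → K := fun u u' =>
    if Proper u u' then (if wdeg u ≤ N ∧ wdeg u' ≤ N then Y u u' else 0) else 0 with hΓdef
  obtain ⟨ρ', hρ'⟩ := exists_symbol_eq b Γ (fun u u' hp => if_neg hp) (N := N) (fun u u' hd => by
    have : ¬ (wdeg u ≤ N ∧ wdeg u' ≤ N) := by omega
    simp [hΓdef, this])
  refine ⟨ρ', symbol_injective b (funext fun u => funext fun u' => ?_)⟩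
  change symbol b _ u u' = symbol b _ u u'
  by_cases hp : Proper u u'
  · rw [symbol_dRep b ρ' hp.1 hp.2, hρ']
    have h1 : totD Γ u u' =
        totD (fun u u' => if wdeg u ≤ N ∧ wdeg u' ≤ N then Y u u' else 0) u u' := by
      refine totD_congr (fun p a c q hu => if_pos (proper_face_left (hu ▸ hp)))
        (fun p a c q hu => if_pos ?_)
      have := proper_face_left (hu ▸ (⟨hp.2, hp.1⟩ : Proper u' u))
      exact ⟨this.2, this.1⟩
    rw [h1, totD_ite (fun u => wdeg u ≤ N) (fun u => wdeg u ≤ N) Y u u'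
      (fun p a c q => by rw [wdeg_merge]) (fun p a c q => by rw [wdeg_merge])]
    split_ifs with hd
    · rw [h u u' hp, hX0 u u' hp, add_zero]
    · exact (hN u u' (by omega)).symm
  · rw [symbol_eq_zero b _ hp, symbol_eq_zero b _ hp]

theorem card_cells (d r : ℕ) : Fintype.card (Cells d r) =
    ∑ p : Finset.HasAntidiagonal.antidiagonal r, d.choose (p.1.1 + 1) * d.choose (p.1.2 + 1) := by
  simp [Cells, Fintype.card_sigma]

/-- Only dimensions are compared: the sets of k coordinates are as many as the dimension of ∧^k. -/
theorem nonempty_cells_equiv [FiniteDimensional K V] (r : ℕ) :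
    Nonempty ((Cells (Module.finrank K V) r → K) ≃ₗ[K]
      ⨁ p : Finset.HasAntidiagonal.antidiagonal r,
        (⋀[K]^(p.1.1 + 1) V) ⊗[K] (⋀[K]^(p.1.2 + 1) (Module.Dual K V))) := by
  refine ⟨LinearEquiv.ofFinrankEq _ _ ?_⟩
  rw [Module.finrank_fintype_fun_eq_card, card_cells, Module.finrank_directSum]
  refine Finset.sum_congr rfl fun p _ => ?_
  rw [Module.finrank_tensorProduct, exteriorPower.finrank_eq, exteriorPower.finrank_eq,
    Subspace.dual_finrank_eq]

end Cells

/-! ### The isomorphism of complexes and its cohomology. -/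

section Conclusion

universe u v

variable {K : Type u} [Field K] [CharZero K] {V : Type v} [AddCommGroup V] [Module K V]
variable {ι : Type} [Fintype ι] [DecidableEq ι] (b : Module.Basis ι K V)

/-- The comparison map as an isomorphism onto the polydifferential operators. -/
def comparison : Rep K V ≃ₗ[K] Cdiff K V :=
  LinearEquiv.ofBijective ((iMap K b).codRestrict (Cdiff K V) (iMap_mem_Cdiff b))
    ⟨fun _ _ h => iMap_injective b (congrArg Subtype.val h),
      fun Φ => let ⟨ρ, hρ⟩ := exists_iMap_eq b Φ.2; ⟨ρ, Subtype.ext hρ⟩⟩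

theorem dGS_Cdiff (b : Module.Basis ι K V) {Φ : C K (O K V)} (hΦ : Φ ∈ Cdiff K V) :
    dGS K (O K V) Φ ∈ Cdiff K V ∧ dGS K (O K V) (dGS K (O K V) Φ) = 0 ∧
      ext K (O K V) (dGS K (O K V) Φ) = dFull K (O K V) (ext K (O K V) Φ) := by
  obtain ⟨ρ, rfl⟩ := exists_iMap_eq b hΦ
  refine ⟨?_, ?_, ext_dGS_iMap b ρ⟩
  · rw [← iMap_dRep]
    exact iMap_mem_Cdiff b _
  · rw [← iMap_dRep, ← iMap_dRep, dRep_dRep b, map_zero]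

theorem nonempty_Hdiff_equiv {d : ℕ} (b : Module.Basis (Fin d) K V) (r : ℕ) :
    Nonempty (Hdiff K V r ≃ₗ[K] (Cells d r → K)) :=
  nonempty_quotient_equiv (iMap K b) (iMap_injective b) (Cdiff K V)
    (fun _ => ⟨exists_iMap_eq b, fun ⟨ρ, h⟩ => h ▸ iMap_mem_Cdiff b ρ⟩) (dRep K V)
    (dGS K (O K V)) (iMap_dRep b) (RepDeg K V r) (CDeg K (O K V) r) (mem_RepDeg_iff_iMap b r)
    (alternate b r) (alternate_dRep b r) (exists_alternate_eq b r) fun _ => exists_dRep_eq b r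

end Conclusion

end PolyGS

end

open PolyGS in
theorem proposition3p5p3 (K : Type*) [Field K] [CharZero K]
    (V : Type*) [AddCommGroup V] [Module K V] [FiniteDimensional K V] :
    (∀ ρ : Rep K V, dRep K V (dRep K V ρ) = 0) ∧
    (∀ Φ ∈ Cdiff K V, dGS K (O K V) Φ ∈ Cdiff K V ∧ dGS K (O K V) (dGS K (O K V) Φ) = 0 ∧
      ext K (O K V) (dGS K (O K V) Φ) = dFull K (O K V) (ext K (O K V) Φ)) ∧
    (∃ i : Rep K V ≃ₗ[K] Cdiff K V,
      (∀ (b : Module.Basis (Fin (Module.finrank K V)) K V) (ρ : Rep K V),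
        (i ρ : C K (O K V)) = iMap K b ρ) ∧
      (∀ ρ : Rep K V, (i (dRep K V ρ) : C K (O K V)) = dGS K (O K V) (i ρ)) ∧
      (∀ (r : ℕ) (ρ : Rep K V),
        ρ ∈ RepDeg K V r ↔ (i ρ : C K (O K V)) ∈ CDeg K (O K V) r)) ∧
    (∀ r : ℕ, Nonempty (Hdiff K V r ≃ₗ[K]
      ⨁ p : Finset.HasAntidiagonal.antidiagonal r,
        (⋀[K]^(p.1.1 + 1) V) ⊗[K] (⋀[K]^(p.1.2 + 1) (Module.Dual K V)))) := by
  -- Any basis will do: `iMap_basis` shows that the isomorphism built from this one is given by the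
  -- same formula in every other.
  let b := Module.finBasis K V
  refine ⟨dRep_dRep b, fun Φ hΦ => dGS_Cdiff b hΦ,
    ⟨comparison b, fun b' ρ => iMap_basis b b' ρ, iMap_dRep b, mem_RepDeg_iff_iMap b⟩, fun r => ?_⟩
  obtain ⟨e⟩ := nonempty_Hdiff_equiv b r
  obtain ⟨e'⟩ := nonempty_cells_equiv (K := K) (V := V) r
  exact ⟨e.trans e'⟩
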